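/- **Setting.** Let $A\in\mathbb R^{n\times n}$, $B\in\mathbb R^{n\times m}$, $Q\in\mathbb R^{n\times n}$ positive semidefinite, $R\in\mathbb R^{m\times m}$ positive definite, $(A,B)$ stabilizable, $(A,Q^{1/2})$ detectable, and let $\mathcal D$ be a probability distribution on $\mathbb R^n$ such that $v\sim\mathcal D$ satisfies $\mathbb E[v]=0$, $\mathbb E[vv^\top]=I_n$ and $\|v\|_2^2\le C_m$ almost surely, $C_m>0$. Put $d=mn$. For $K\in\mathbb R^{m\times n}$ let $\mathcal J(K;x_0)=\sum_{t\ge0}(x_t^\top Qx_t+u_t^\top Ru_t)\in[0,\infty]$ with $x_{t+1}=Ax_t+Bu_t$, $u_t=-Kx_t$, and $\mathcal J(K)=\mathbb E_{x_0\sim\mathcal D}[\mathcal J(K;x_0)]$. Let $\mathcal K_{st}=\{K:\rho(A-BK)<1\}$ and $K^*=(B^\top P^*B+R)^{-1}B^\top P^*A$, where $P^*$ is the unique positive semidefinite solution of $P=A^\top PA+Q-A^\top PB(B^\top PB+R)^{-1}B^\top PA$. Fix $K_0\in\mathcal K_{st}$, and let $\Delta_0=\mathcal J(K_0)-\mathcal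 J(K^*)$ and $\mathcal G^0=\{K\in\mathcal K_{st}:\mathcal J(K)-\mathcal J(K^*)\le10\Delta_0\}$. **Constants.** Let $\mu>0$ satisfy $\mu(\mathcal J(K)-\mathcal J(K^*))\le\|\nabla\mathcal J(K)\|_F^2$ for all $K\in\mathcal K_{st}$. For every $K\in\mathcal K_{st}$ let $\lambda_K,\widetilde\lambda_K,\zeta_K,\phi_K,\beta_K>0$ be such that: whenever $\|K'-K\|_F\le\zeta_K$, then $K'\in\mathcal K_{st}$, $|\mathcal J(K')-\mathcal J(K)|\le\lambda_K\|K'-K\|_F$ and, for $\mathcal D$-almost every $x_0$ (with an exceptional set independent of $K'$), $|\mathcal J(K';x_0)-\mathcal J(K;x_0)|\le\widetilde\lambda_K\|K'-K\|_F$; whenever $\|K'-K\|_F\le\beta_K$, then $K'\in\mathcal K_{st}$ and $\|\nabla\mathcal J(K')-\nabla\mathcal J(K)\|_F\le\phi_K\|K'-K\|_F$. Assume that $$\phi_0=\sup_{\mathcal G^0}\phi_K,\quad \lambda_0=\sup_{\mathcal G^0}\lambda_K,\quad \widetilde\lambda_0=\sup_{\mathcal G^0}\widetilde\lambda_K,\quad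 \rho_0=\inf_{\mathcal G^0}\min\{\beta_K,\zeta_K\}$$ are finite, and let $\theta_0=\min\{1/(2\phi_0),\rho_0/\lambda_0\}$. (Part 0 of the theorem says that such constants exist, with $\rho_0>0$.) **Algorithm.** Let $\eta,r,\delta>0$. In round $s=0,1,\dots$ a fresh pair $(x^{(s)},D_s)\sim\mathcal D\otimes\mathrm{Unif}(\{D\in\mathbb R^{m\times n}:\|D\|_F=1\})$ is drawn, independent of all samples and perturbations of earlier rounds, and $$K_{s+1}=K_s-\eta\,G(K_s)+\eta E_s .$$ Here $E_s$ is an arbitrary random matrix with $\|E_s\|_F\le\delta$ almost surely (it may depend on the past and on the current sample), and $G(K_s)$ is either the one-point estimate $\mathcal J(K_s+rD_s;x^{(s)})\frac drD_s$ or the two-point estimate $[\mathcal J(K_s+rD_s;x^{(s)})-\mathcal J(K_s-rD_s;x^{(s)})]\frac d{2r}D_s$ (infinite costs may be replaced by $0$ here). **Theorem 1.** (0) Constants $\mu,\lambda_K,\widetilde\lambda_K,\zeta_K,\phi_K,\beta_K$ as above, with finite $\phi_0,\lambda_0,\widetilde\lambda_0$ and with $\rho_0>0$, exist. For all such constants,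 let $\epsilon>0$ satisfy $\epsilon\log(120\Delta_0/\epsilon)<12\Delta_0$, let $T_s$ be $\frac4{\eta\mu}\log\frac{120\Delta_0}\epsilon$, rounded up to a nonnegative integer, and suppose that $$\delta\le\min\Big\{\tfrac{\mu\theta_0}{16}\sqrt{\tfrac\epsilon{15}},\ \tfrac12\sqrt{\tfrac{\mu\epsilon}{30}}\Big\},\qquad r\le\min\Big\{\tfrac{\mu\theta_0}{16\phi_0}\sqrt{\tfrac\epsilon{15}},\ \tfrac1{4\phi_0}\sqrt{\tfrac{\mu\epsilon}{15}},\ \rho_0\Big\}.$$ (1) One-point estimate: if moreover $r\le10\mathcal J(K_0)/\lambda_0$ and $$\eta\le\min\Big\{\frac{\mu r^2\epsilon}{480\phi_0[20C_m\mathcal J(K_0)d]^2},\ \frac1{4\phi_0},\ \frac{\rho_0r}{20C_m\mathcal J(K_0)d+\delta r}\Big\},$$ then, with probability at least $3/4$, $K_{T_s}\in\mathcal K_{st}$ and $\mathcal J(K_{T_s})-\mathcal J(K^*)<\epsilon$. (2) Two-point estimate: if moreover $$\eta\le\min\Big\{\frac{\mu\epsilon}{480\phi_0d\widetilde\lambda_0^2},\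 \frac1{4\phi_0},\ \frac{\rho_0}{d\widetilde\lambda_0+\delta}\Big\},$$ then, with probability at least $3/4$, $K_{T_s}\in\mathcal K_{st}$ and $\mathcal J(K_{T_s})-\mathcal J(K^*)<\epsilon$. -/

import Mathlib

open MeasureTheory ProbabilityTheory
open scoped ENNReal Matrix MatrixOrder

/-- Feedback gains: real `m × n` matrices, as a Euclidean space, so that `‖·‖` is the Frobenius
norm, `inner` the Frobenius inner product and `gradient` the Frobenius gradient. -/
abbrev Gain (m n : ℕ) : Type := EuclideanSpace ℝ (Fin m × Fin n)

/-- The matrix of a gain. -/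
def Gain.mat {m n : ℕ} (K : Gain m n) : Matrix (Fin m) (Fin n) ℝ :=
  Matrix.of fun i j => K (i, j)

/-- The gain with a given matrix. -/
def Gain.ofMat {m n : ℕ} (M : Matrix (Fin m) (Fin n) ℝ) : Gain m n :=
  WithLp.toLp 2 fun p => M p.1 p.2

/-- The uniform probability distribution on the Frobenius unit sphere of `ℝ^{m × n}`, as a measure
on the space of all matrices: the normalized surface measure. -/
noncomputable def unifSphere (m n : ℕ) : Measure (Gain m n) :=
  let σ : Measure (Metric.sphere (0 : Gain m n) 1) := (volume : Measure (Gain m n)).toSphere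
  ((σ Set.univ)⁻¹ • σ).map Subtype.val

/-- `ρ(M) < 1`: all complex eigenvalues of the real matrix `M` lie in the open unit disc. -/
def SchurStable {n : ℕ} (M : Matrix (Fin n) (Fin n) ℝ) : Prop :=
  spectralRadius ℂ (M.map (algebraMap ℝ ℂ)) < 1

/-- `(A, B)` is stabilizable. -/
def Stabilizable {n m : ℕ} (A : Matrix (Fin n) (Fin n) ℝ) (B : Matrix (Fin n) (Fin m) ℝ) : Prop :=
  ∃ F : Matrix (Fin m) (Fin n) ℝ, SchurStable (A - B * F)

/-- `(A, C)` is detectable. -/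
def Detectable {n p : ℕ} (A : Matrix (Fin n) (Fin n) ℝ) (C : Matrix (Fin p) (Fin n) ℝ) : Prop :=
  ∃ F : Matrix (Fin n) (Fin p) ℝ, SchurStable (A - F * C)

/-- Data of the linear quadratic regulator: the system `x_{t+1} = A x_t + B u_t`, the stage cost
`xᵀ Q x + uᵀ R u`, and the distribution of the initial state. -/
structure LQR (n m : ℕ) where
  A : Matrix (Fin n) (Fin n) ℝ
  B : Matrix (Fin n) (Fin m) ℝ
  Q : Matrix (Fin n) (Fin n) ℝ
  R : Matrix (Fin m) (Fin m) ℝ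
  init : Measure (Fin n → ℝ)

namespace LQR

variable {n m : ℕ} (L : LQR n m)

/-- The standing assumptions on the system, the cost and the initial distribution. -/
structure Standing (Cm : ℝ) : Prop where
  stabilizable : Stabilizable L.A L.B
  posSemidef_Q : L.Q.PosSemidef
  posDef_R : L.R.PosDef
  detectable : Detectable L.A (CFC.sqrt L.Q)
  isProb : IsProbabilityMeasure L.init
  mean : ∀ i, ∫ v, v i ∂L.init = 0
  covariance : ∀ i j, ∫ v, v i * v j ∂L.init = (1 : Matrix (Fin n) (Fin n) ℝ) i j
  bounded : ∀ᵐ v ∂L.init, v ⬝ᵥ v ≤ Cm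
  Cm_pos : 0 < Cm

/-- The closed-loop matrix `A - B K` of the policy `u_t = -K x_t`. -/
def closedLoop (K : Gain m n) : Matrix (Fin n) (Fin n) ℝ := L.A - L.B * K.mat

/-- The set of stabilizing gains. -/
def stab : Set (Gain m n) := {K | SchurStable (L.closedLoop K)}

/-- The stage cost `xᵀ Q x + uᵀ R u`. -/
def stageCost (x : Fin n → ℝ) (u : Fin m → ℝ) : ℝ := x ⬝ᵥ L.Q *ᵥ x + u ⬝ᵥ L.R *ᵥ u

/-- The state at time `t` under the policy `u_t = -K x_t`, from the initial state `x`. -/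
def state (K : Gain m n) (x : Fin n → ℝ) (t : ℕ) : Fin n → ℝ := (L.closedLoop K ^ t) *ᵥ x

/-- The infinite-horizon cost of the policy `u_t = -K x_t` from the initial state `x`, possibly
infinite. -/
noncomputable def costFrom (K : Gain m n) (x : Fin n → ℝ) : ℝ≥0∞ :=
  ∑' t : ℕ, ENNReal.ofReal (L.stageCost (L.state K x t) (-(K.mat *ᵥ L.state K x t)))

/-- The expected cost over a random initial state, possibly infinite. -/
noncomputable def cost (K : Gain m n) : ℝ≥0∞ := ∫⁻ x, L.costFrom K x ∂L.init

/-- Real value of `costFrom`. -/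
noncomputable def J₁ (K : Gain m n) (x : Fin n → ℝ) : ℝ := (L.costFrom K x).toReal

/-- Real value of `cost`; it is used only on stabilizing gains, where the cost is finite. -/
noncomputable def J (K : Gain m n) : ℝ := (L.cost K).toReal

/-- `P` is a positive semidefinite solution of the discrete algebraic Riccati equation. -/
def IsDARE (P : Matrix (Fin n) (Fin n) ℝ) : Prop :=
  P.PosSemidef ∧
    P = L.Aᵀ * P * L.A + L.Q
      - L.Aᵀ * P * L.B * (L.Bᵀ * P * L.B + L.R)⁻¹ * L.Bᵀ * P * L.A

/-- The (unique) positive semidefinite solution of the Riccati equation. -/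
noncomputable def Pstar : Matrix (Fin n) (Fin n) ℝ := Classical.epsilon L.IsDARE

/-- The optimal gain `K⋆ = (Bᵀ P⋆ B + R)⁻¹ Bᵀ P⋆ A`. -/
noncomputable def Kstar : Gain m n :=
  Gain.ofMat ((L.Bᵀ * L.Pstar * L.B + L.R)⁻¹ * L.Bᵀ * L.Pstar * L.A)

/-- The optimality gap `J(K) - J(K⋆)`. -/
noncomputable def gap (K : Gain m n) : ℝ := L.J K - L.J L.Kstar

/-- The sublevel set of gains whose gap is at most ten times that of `K₀`. -/
def sublevel (K₀ : Gain m n) : Set (Gain m n) := {K | K ∈ L.stab ∧ L.gap K ≤ 10 * L.gap K₀}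

/-- Local constants of the cost at every stabilizing gain `K`: Lipschitz constants `lam K` for the
expected cost and `lamT K` for the cost from (almost) every initial state on the ball of radius
`zeta K`, and a Lipschitz constant `phi K` for the gradient on the ball of radius `beta K`. -/
structure LocalConstants (lam lamT zeta phi beta : Gain m n → ℝ) : Prop where
  pos : ∀ K ∈ L.stab, 0 < lam K ∧ 0 < lamT K ∧ 0 < zeta K ∧ 0 < phi K ∧ 0 < beta K
  lipschitz : ∀ K ∈ L.stab, ∀ K', ‖K' - K‖ ≤ zeta K →
    K' ∈ L.stab ∧ |L.J K' - L.J K| ≤ lam K * ‖K' - K‖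
  lipschitz_from : ∀ K ∈ L.stab, ∀ᵐ x ∂L.init, ∀ K', ‖K' - K‖ ≤ zeta K →
    |L.J₁ K' x - L.J₁ K x| ≤ lamT K * ‖K' - K‖
  smooth : ∀ K ∈ L.stab, ∀ K', ‖K' - K‖ ≤ beta K →
    K' ∈ L.stab ∧ ‖gradient L.J K' - gradient L.J K‖ ≤ phi K * ‖K' - K‖

/-- The Polyak–Łojasiewicz inequality with constant `mu`. -/
def IsPL (mu : ℝ) : Prop := 0 < mu ∧ ∀ K ∈ L.stab, mu * L.gap K ≤ ‖gradient L.J K‖ ^ 2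

/-- `mu` is a PL constant, and `lam0`, `lamT0`, `phi0`, `rho0` are the suprema of `lam`, `lamT`,
`phi` and the infimum of `min (beta K) (zeta K)` over the sublevel set of `K₀`, for some choice of
local constants. -/
def RegularityConstants (K₀ : Gain m n) (mu lam0 lamT0 phi0 rho0 : ℝ) : Prop :=
  L.IsPL mu ∧ ∃ lam lamT zeta phi beta : Gain m n → ℝ,
    L.LocalConstants lam lamT zeta phi beta ∧
    IsLUB (lam '' L.sublevel K₀) lam0 ∧
    IsLUB (lamT '' L.sublevel K₀) lamT0 ∧
    IsLUB (phi '' L.sublevel K₀) phi0 ∧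
    IsGLB ((fun K => min (beta K) (zeta K)) '' L.sublevel K₀) rho0

/-- The one-point gradient estimate `J(K + r D; x) (d / r) D`, `d = m n`. -/
noncomputable def onePoint (r : ℝ) (K D : Gain m n) (x : Fin n → ℝ) : Gain m n :=
  (L.J₁ (K + r • D) x * ((m * n : ℝ) / r)) • D

/-- The two-point gradient estimate `[J(K + r D; x) - J(K - r D; x)] (d / (2 r)) D`, `d = m n`. -/
noncomputable def twoPoint (r : ℝ) (K D : Gain m n) (x : Fin n → ℝ) : Gain m n :=
  ((L.J₁ (K + r • D) x - L.J₁ (K - r • D) x) * ((m * n : ℝ) / (2 * r))) • D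

/-- The randomness of the algorithm. In every round `s` a fresh pair `(x s, D s)` with law
`init ⊗ Unif(sphere)` is drawn independently of everything that happened in earlier rounds; the
perturbation `E s` is an arbitrary random matrix, which may depend on the past and on the current
sample, of Frobenius norm at most `δ`. -/
structure Sampling {Ω : Type*} [MeasurableSpace Ω] (P : Measure Ω) (δ : ℝ)
    (x : ℕ → Ω → Fin n → ℝ) (D E : ℕ → Ω → Gain m n) : Prop where
  measurable_x : ∀ s, Measurable (x s)
  measurable_D : ∀ s, Measurable (D s)
  measurable_E : ∀ s, Measurable (E s)
  law : ∀ s, P.map (fun ω => (x s ω, D s ω)) = L.init.prod (unifSphere m n)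
  indep : ∀ s, Indep (MeasurableSpace.comap (fun ω => (x s ω, D s ω)) inferInstance)
    (⨆ j : Fin s, MeasurableSpace.comap (fun ω => (x j ω, D j ω, E j ω)) inferInstance) P
  bound : ∀ s, ∀ᵐ ω ∂P, ‖E s ω‖ ≤ δ

end LQR

/-- The perturbed iteration `K_{s+1} = K_s - η G(K_s, D_s; x_s) + η E_s` along given samples. -/
noncomputable def perturbedIterate {n m : ℕ} (G : Gain m n → Gain m n → (Fin n → ℝ) → Gain m n)
    (η : ℝ) (K₀ : Gain m n) (x : ℕ → Fin n → ℝ) (D E : ℕ → Gain m n) : ℕ → Gain m n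
  | 0 => K₀
  | s + 1 =>
    perturbedIterate G η K₀ x D E s - η • G (perturbedIterate G η K₀ x D E s) (D s) (x s)
      + η • E s

/-- The iteration with gradient estimator `G` is `ε`-optimal (with a stabilizing gain) after `T`
steps with probability at least `3/4`. -/
def LQR.Succeeds {n m : ℕ} (L : LQR n m) {Ω : Type*} [MeasurableSpace Ω] (P : Measure Ω)
    (G : Gain m n → Gain m n → (Fin n → ℝ) → Gain m n) (η : ℝ) (K₀ : Gain m n)
    (x : ℕ → Ω → Fin n → ℝ) (D E : ℕ → Ω → Gain m n) (T : ℕ) (ε : ℝ) : Prop :=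
  3 / 4 ≤ P.real {ω |
    let K := perturbedIterate G η K₀ (fun s => x s ω) (fun s => D s ω) (fun s => E s ω) T
    K ∈ L.stab ∧ L.J K - L.J L.Kstar < ε}

/-! The cost of a stabilizing gain is `J(K) = tr P_K`, where `P_K` solves a Lyapunov equation, so
`J` is smooth on the open set of stabilizing gains. Two facts carry the existence of the constants.
The sublevel sets of `J` are compact (`LQR.Standing.isCompact_sublevel`): the cost is coercive since
`R` is positive definite, lower semicontinuous as an extended function, and finite only at
stabilizing gains, by detectability (`LQR.Standing.mem_stab_of_cost_ne_top`). And the cost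
difference of two stabilizing gains is an explicit quadratic expression (`LQR.Standing.J_add_sub`),
from which follow the formula for the policy gradient and, by completing the square, the
Polyak–Łojasiewicz inequality (`LQR.Standing.exists_isPL`). The local constants are Lipschitz
constants of smooth functions on a compact neighbourhood of the sublevel set.

For the convergence, write `Δ` for the gap `J(K) - J(K⋆)` and `v = ∇J(K)`. A step along `-g + e`,
with `g` the gradient estimate and `‖e‖ ≤ δ`, obeys a descent inequality. The perturbation `e` may
depend on `g`, so it is removed pathwise by Young's inequality, which costs half of `η ‖v‖²`
(`LQR.RegularityConstants.gap_step_le`). Only then is the expectation taken, and two properties of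
the estimator are needed.

* Its bias is at most `φ r`: by the divergence theorem, the average of `(d / r) J(K + r D) D` over
  the sphere is the average of `∇J` over the ball of radius `r`
  (`norm_sphere_estimator_sub_gradient_le`). The divergence theorem on a ball is the limit of an
  integration by parts against a radial cutoff.
* Its second moment is bounded. For the one-point estimate this is the bound `J(K; x) ≤ C_m J(K)`.
  For the two-point estimate the almost sure bound `d λ̃` would lose a factor `d` in the second
  moment. The function `h(D) = J(K + r D; x) - J(K - r D; x)` is odd on the sphere and has gradient
  at most `2 r λ̃`, and odd functions on the sphere satisfy a Poincaré inequality
  (`sphere_poincare_odd`): along great ellipses they are antiperiodic, and Wirtinger's inequality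
  applies (`wirtinger_antiperiodic`). This gives the second moment `2 d λ̃²`.

So the mean gap grows by at most `η μ ε / 96` per step and, by the Polyak–Łojasiewicz inequality,
also contracts by the factor `1 - η μ / 4` up to an additive error
(`LQR.RegularityConstants.lintegral_descentBound_le`), as long as the gain and its perturbations of
length `r` stay in the sublevel set, where the local constants are available. This is ensured by
stopping when the gap exceeds a level `M`. A perturbation of length `r` increases the square root of
the gap by at most `√(ε / 240)`, as the squared gradient is dominated by the gap
(`LQR.RegularityConstants.gap_add_le`), so a level `M` somewhat below `10 Δ₀` is admissible. With
`p s` the probability of not having stopped and `e s` the expected gap on that event, the stopped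
iteration obeys `M (p s - p (s + 1)) + e (s + 1) ≤ c₁ e s + c₂ p s`
(`LQR.Sampling.exists_stopped_recursion`), and summing this recursion together with Markov's
inequality gives the success probability (`LQR.succeeds_of_isEstimator`). -/

/-! ### The uniform distribution on the sphere -/

section Sphere

open Set Metric Filter Topology

variable {E : Type*} [NormedAddCommGroup E] [InnerProductSpace ℝ E] [FiniteDimensional ℝ E]
  [MeasurableSpace E] [BorelSpace E]

/-- The normalized surface measure of the unit sphere, as a measure on the ambient space. For
`μ = volume` on `Gain m n` this is `unifSphere m n` by definition. -/
noncomputable def sphereUnif (μ : Measure E) : Measure E :=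
  ((μ.toSphere univ)⁻¹ • μ.toSphere).map Subtype.val

variable (μ : Measure E) [μ.IsAddHaarMeasure]

theorem isProbabilityMeasure_sphereUnif [Nontrivial E] :
    IsProbabilityMeasure (sphereUnif μ) := by
  have h0 : μ.toSphere univ ≠ 0 := by
    rw [Ne, Measure.measure_univ_eq_zero]
    exact μ.toSphere_ne_zero
  refine ⟨?_⟩
  rw [sphereUnif, Measure.map_apply measurable_subtype_coe MeasurableSet.univ, preimage_univ,
    Measure.smul_apply, smul_eq_mul]
  exact ENNReal.inv_mul_cancel h0 (measure_ne_top _ _)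

omit [FiniteDimensional ℝ E] [μ.IsAddHaarMeasure] in
theorem ae_norm_eq_one_sphereUnif : ∀ᵐ D ∂(sphereUnif μ), ‖D‖ = 1 := by
  rw [sphereUnif, ae_map_iff measurable_subtype_coe.aemeasurable
    (measurableSet_eq_fun measurable_norm measurable_const)]
  exact Eventually.of_forall fun x => by simp

/-- Polar coordinates: the direction `x / ‖x‖` of a point drawn with a radial density is uniform on
the unit sphere, and independent of the radius. -/
theorem lintegral_norm_mul_direction [Nontrivial E] {k : ℝ → ℝ≥0∞} (hk : Measurable k)
    {u : E → ℝ≥0∞} (hu : Measurable u) :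
    ∫⁻ x, k ‖x‖ * u (‖x‖⁻¹ • x) ∂μ = (∫⁻ x, k ‖x‖ ∂μ) * ∫⁻ D, u D ∂(sphereUnif μ) := by
  have key : ∀ v : E → ℝ≥0∞, Measurable v →
      ∫⁻ x, k ‖x‖ * v (‖x‖⁻¹ • x) ∂μ =
        (∫⁻ D, v D ∂μ.toSphere) *
          ∫⁻ t : Ioi (0 : ℝ), k t ∂(.volumeIoiPow (Module.finrank ℝ E - 1)) := by
    intro v hv
    have h1 : ∫⁻ x, k ‖x‖ * v (‖x‖⁻¹ • x) ∂μ =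
        ∫⁻ x : ({(0)}ᶜ : Set E), k ‖x.1‖ * v (‖x.1‖⁻¹ • x.1) ∂(μ.comap (↑)) := by
      rw [lintegral_subtype_comap (measurableSet_singleton _).compl
        fun x : E => k ‖x‖ * v (‖x‖⁻¹ • x), restrict_compl_singleton]
    have h2 := μ.measurePreserving_homeomorphUnitSphereProd.lintegral_comp
      (f := fun p : sphere (0 : E) 1 × Ioi (0 : ℝ) => v p.1 * k p.2) (by fun_prop)
    rw [h1]
    calc _ = ∫⁻ a, v (homeomorphUnitSphereProd E a).1 * k (homeomorphUnitSphereProd E a).2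
            ∂(μ.comap ((↑) : ({(0)}ᶜ : Set E) → E)) := by
          refine lintegral_congr fun a => ?_
          rw [mul_comm]
          simp
      _ = _ := h2
      _ = _ := lintegral_prod_mul (f := fun D : sphere (0 : E) 1 => v D)
          (g := fun t : Ioi (0 : ℝ) => k t) (by fun_prop) (by fun_prop)
  have h0 : μ.toSphere univ ≠ 0 := by
    rw [Ne, Measure.measure_univ_eq_zero]
    exact μ.toSphere_ne_zero
  have hone := key (fun _ => 1) measurable_const
  simp only [mul_one, lintegral_const, one_mul] at hone
  rw [key u hu, hone, sphereUnif, lintegral_map hu measurable_subtype_coe, lintegral_smul_measure,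
    smul_eq_mul]
  have hc := ENNReal.mul_inv_cancel h0 (measure_ne_top μ.toSphere univ)
  set c := μ.toSphere univ
  set I := ∫⁻ D : sphere (0 : E) 1, u D ∂μ.toSphere
  set Kk := ∫⁻ t : Ioi (0 : ℝ), k t ∂(.volumeIoiPow (Module.finrank ℝ E - 1))
  calc I * Kk = (c * c⁻¹) * (I * Kk) := by rw [hc, one_mul]
    _ = _ := by ring

/-- The pushforward of Lebesgue measure on a rotation-invariant set under `x ↦ x / ‖x‖`. -/
theorem map_direction_restrict [Nontrivial E] {B : Set ℝ} (hB : MeasurableSet B) :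
    (μ.restrict (norm ⁻¹' B)).map (fun x => ‖x‖⁻¹ • x) = μ (norm ⁻¹' B) • sphereUnif μ := by
  have hm : Measurable fun x : E => ‖x‖⁻¹ • x := by fun_prop
  have hA : MeasurableSet (norm ⁻¹' B : Set E) := measurable_norm hB
  refine Measure.ext fun S hS => ?_
  have h := lintegral_norm_mul_direction μ (k := B.indicator 1) (u := S.indicator 1)
    (measurable_one.indicator hB) (measurable_one.indicator hS)
  have h1 : ∀ x : E, B.indicator (1 : ℝ → ℝ≥0∞) ‖x‖ = (norm ⁻¹' B : Set E).indicator 1 x :=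
    fun x => rfl
  rw [Measure.map_apply hm hS, Measure.restrict_apply (hm hS), Measure.smul_apply, smul_eq_mul]
  simp only [h1] at h
  rw [lintegral_indicator_one hA, lintegral_indicator_one hS] at h
  rw [← h, ← lintegral_indicator_one ((hm hS).inter hA)]
  refine lintegral_congr fun x => ?_
  by_cases h1 : x ∈ (norm ⁻¹' B : Set E) <;> by_cases h2 : ‖x‖⁻¹ • x ∈ S <;>
    simp [indicator, h1, h2]

theorem measurePreserving_neg_sphereUnif :
    MeasurePreserving (fun D : E => -D) (sphereUnif μ) (sphereUnif μ) := by
  refine ⟨measurable_neg, ?_⟩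
  rcases subsingleton_or_nontrivial E with h | h
  · have : (fun D : E => -D) = id := funext fun D => Subsingleton.elim _ _
    rw [this, Measure.map_id]
  · have hm : Measurable fun x : E => ‖x‖⁻¹ • x := by fun_prop
    have hb := map_direction_restrict μ (B := Iio (1 : ℝ)) measurableSet_Iio
    have hB : (norm ⁻¹' (Iio 1) : Set E) = ball 0 1 := by ext; simp
    rw [hB] at hb
    have hne0 : μ (ball (0 : E) 1) ≠ 0 := (measure_ball_pos μ 0 one_pos).ne'
    have hnet : μ (ball (0 : E) 1) ≠ ⊤ := measure_ball_lt_top.ne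
    have hu : sphereUnif μ = (μ (ball (0 : E) 1))⁻¹ •
        (μ.restrict (ball 0 1)).map (fun x => ‖x‖⁻¹ • x) := by
      rw [hb, smul_smul, ENNReal.inv_mul_cancel hne0 hnet, one_smul]
    have hneg : (μ.restrict (ball (0 : E) 1)).map (fun x => -x) = μ.restrict (ball 0 1) := by
      have := ((Measure.measurePreserving_neg μ).restrict_preimage
        (measurableSet_ball (x := (0 : E)) (ε := 1))).map_eq
      rwa [show (Neg.neg ⁻¹' ball (0 : E) 1) = ball 0 1 by ext; simp] at this
    rw [hu, Measure.map_smul, Measure.map_map measurable_neg hm]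
    congr 1
    conv_rhs => rw [← hneg]
    rw [Measure.map_map hm measurable_neg]
    congr 1
    ext x
    simp

end Sphere

/-! ### The divergence theorem on a ball -/

section Stokes

open Set Metric Filter Topology

variable {E : Type*} [NormedAddCommGroup E] [InnerProductSpace ℝ E]

theorem hasFDerivAt_norm_of_ne_zero {x : E} (hx : x ≠ 0) :
    HasFDerivAt (fun y : E => ‖y‖) (‖x‖⁻¹ • innerSL ℝ x) x := by
  have := (hasStrictFDerivAt_norm_sq x).hasFDerivAt.sqrt (by simpa using hx)
  have h6 : (fun y : E => √(‖y‖ ^ 2)) = fun y => ‖y‖ :=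
    funext fun y => Real.sqrt_sq (norm_nonneg y)
  rw [h6] at this
  refine this.congr_fderiv ?_
  ext w
  have hn : ‖x‖ ≠ 0 := norm_ne_zero_iff.2 hx
  simp [Real.sqrt_sq (norm_nonneg x)]
  field_simp

/-- The radial cutoff that is `1` for `‖x‖ ≤ r - s`, `0` for `‖x‖ ≥ r`, and linear in `‖x‖` in
between. -/
noncomputable def radialCutoff (r s : ℝ) (x : E) : ℝ := max 0 (min 1 ((r - ‖x‖) / s))

omit [InnerProductSpace ℝ E] in
theorem lipschitzWith_radialCutoff (r : ℝ) {s : ℝ} (hs : 0 < s) :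
    LipschitzWith (Real.toNNReal s⁻¹) (radialCutoff r s : E → ℝ) := by
  have h1 : LipschitzWith (Real.toNNReal s⁻¹) fun x : E => (r - ‖x‖) / s := by
    refine LipschitzWith.of_dist_le_mul fun x y => ?_
    rw [Real.coe_toNNReal _ (by positivity), Real.dist_eq, ← sub_div, abs_div, abs_of_pos hs,
      div_eq_inv_mul, dist_eq_norm]
    gcongr
    rw [show r - ‖x‖ - (r - ‖y‖) = -(‖x‖ - ‖y‖) by ring, abs_neg]
    exact abs_norm_sub_norm_le x y
  exact (h1.const_min 1).const_max 0

theorem hasCompactSupport_radialCutoff [FiniteDimensional ℝ E] (r : ℝ) {s : ℝ} (hs : 0 < s) :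
    HasCompactSupport (radialCutoff r s : E → ℝ) := by
  refine HasCompactSupport.intro (isCompact_closedBall (0 : E) r) fun x hx => ?_
  have : r < ‖x‖ := by simpa using hx
  have h2 : (r - ‖x‖) / s ≤ 0 := div_nonpos_of_nonpos_of_nonneg (by linarith) hs.le
  simp [radialCutoff, h2]

omit [InnerProductSpace ℝ E] in
theorem radialCutoff_eq_one {r s : ℝ} (hs : 0 < s) {x : E} (hx : ‖x‖ ≤ r - s) :
    radialCutoff r s x = 1 := by
  have : 1 ≤ (r - ‖x‖) / s := by rw [le_div_iff₀ hs]; linarith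
  simp [radialCutoff, this]

omit [InnerProductSpace ℝ E] in
theorem radialCutoff_eq_zero {r s : ℝ} (hs : 0 < s) {x : E} (hx : r ≤ ‖x‖) :
    radialCutoff r s x = 0 := by
  have h2 : (r - ‖x‖) / s ≤ 0 := div_nonpos_of_nonpos_of_nonneg (by linarith) hs.le
  simp [radialCutoff, h2]

omit [InnerProductSpace ℝ E] in
theorem radialCutoff_nonneg (r s : ℝ) (x : E) : 0 ≤ radialCutoff r s x := le_max_left _ _

omit [InnerProductSpace ℝ E] in
theorem radialCutoff_le_one (r s : ℝ) (x : E) : radialCutoff r s x ≤ 1 :=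
  max_le zero_le_one (min_le_left _ _)

theorem lineDeriv_radialCutoff_of_lt {r s : ℝ} (hs : 0 < s) {x : E} (hx : ‖x‖ < r - s) (v : E) :
    lineDeriv ℝ (radialCutoff r s) x v = 0 := by
  have h : radialCutoff r s =ᶠ[𝓝 x] fun _ => (1 : ℝ) := by
    filter_upwards [(isOpen_lt continuous_norm continuous_const).mem_nhds hx] with y hy
    exact radialCutoff_eq_one hs (le_of_lt hy)
  rw [h.lineDeriv_eq]
  simp [lineDeriv]

theorem lineDeriv_radialCutoff_of_gt {r s : ℝ} (hs : 0 < s) {x : E} (hx : r < ‖x‖) (v : E) :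
    lineDeriv ℝ (radialCutoff r s) x v = 0 := by
  have h : radialCutoff r s =ᶠ[𝓝 x] fun _ => (0 : ℝ) := by
    filter_upwards [(isOpen_lt continuous_const continuous_norm).mem_nhds hx] with y hy
    exact radialCutoff_eq_zero hs (le_of_lt hy)
  rw [h.lineDeriv_eq]
  simp [lineDeriv]

theorem lineDeriv_radialCutoff_shell {r s : ℝ} (hs : 0 < s) (hsr : s < r) {x : E}
    (h1 : r - s < ‖x‖) (h2 : ‖x‖ < r) (v : E) :
    lineDeriv ℝ (radialCutoff r s) x v = -(s⁻¹ * inner ℝ (‖x‖⁻¹ • x) v) := by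
  have hx : x ≠ 0 := by
    rintro rfl
    rw [norm_zero] at h1
    linarith
  have h : radialCutoff r s =ᶠ[𝓝 x] fun y => s⁻¹ * (r - ‖y‖) := by
    filter_upwards [(isOpen_lt continuous_const continuous_norm).mem_nhds h1,
      (isOpen_lt continuous_norm continuous_const).mem_nhds h2] with y hy1 hy2
    have hy1' : r - s < ‖y‖ := hy1
    have hy2' : ‖y‖ < r := hy2
    have h3 : (r - ‖y‖) / s ≤ 1 := by rw [div_le_one hs]; linarith
    have h4 : 0 ≤ (r - ‖y‖) / s := div_nonneg (by linarith) hs.le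
    rw [radialCutoff, min_eq_right h3, max_eq_right h4, div_eq_inv_mul]
  rw [h.lineDeriv_eq]
  have h5 := hasFDerivAt_norm_of_ne_zero hx
  have h7 := ((h5.const_sub r).const_mul s⁻¹).hasLineDerivAt v
  rw [h7.lineDeriv]
  simp [inner_smul_left]

variable [FiniteDimensional ℝ E] [MeasurableSpace E] [BorelSpace E]
  (μ : Measure E) [μ.IsAddHaarMeasure]

theorem setIntegral_direction [Nontrivial E] {B : Set ℝ} (hB : MeasurableSet B) {u : E → ℝ}
    (hu : AEStronglyMeasurable u (sphereUnif μ)) :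
    ∫ x in norm ⁻¹' B, u (‖x‖⁻¹ • x) ∂μ = μ.real (norm ⁻¹' B) * ∫ D, u D ∂(sphereUnif μ) := by
  have hm : Measurable fun x : E => ‖x‖⁻¹ • x := by fun_prop
  have h := map_direction_restrict μ hB
  rw [← smul_eq_mul, measureReal_def, ← integral_smul_measure, ← h, integral_map hm.aemeasurable]
  rw [h]
  exact hu.smul_measure _

theorem measureReal_shell {r s : ℝ} (hs : 0 < s) (hsr : s < r) :
    μ.real (norm ⁻¹' (Ioo (r - s) r) : Set E) =
      μ.real (ball (0 : E) 1) * (r ^ Module.finrank ℝ E - (r - s) ^ Module.finrank ℝ E) := by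
  have h1 : (norm ⁻¹' (Ioo (r - s) r) : Set E) = ball 0 r \ closedBall 0 (r - s) := by
    ext x
    simp [and_comm]
  rw [h1, measureReal_sdiff (closedBall_subset_ball (by linarith)) measurableSet_closedBall
    measure_ball_lt_top.ne, measureReal_def, measureReal_def, measureReal_def,
    μ.addHaar_ball_of_pos _ (by linarith), μ.addHaar_closedBall _ (by linarith),
    ENNReal.toReal_mul, ENNReal.toReal_mul, ENNReal.toReal_ofReal (pow_nonneg (by linarith) _),
    ENNReal.toReal_ofReal (pow_nonneg (by linarith) _)]
  ring

/-- One finite-width instance of the divergence theorem: integration by parts against the radial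
cutoff compares the integral of a directional derivative over the ball with a thin shell average
of the function; both errors are of the order of the volume of the shell. -/
theorem abs_integral_lineDeriv_sub_le [Nontrivial E] {g : E → ℝ} {L : NNReal}
    (hg : LipschitzWith L g) {r s : ℝ} (hs : 0 < s) (hsr : s < r) (w : E) :
    |∫ x in ball 0 r, lineDeriv ℝ g x w ∂μ -
        s⁻¹ * (μ.real (norm ⁻¹' (Ioo (r - s) r) : Set E) *
          ∫ D, g (r • D) * inner ℝ D w ∂(sphereUnif μ))| ≤
      2 * L * ‖w‖ * μ.real (norm ⁻¹' (Ioo (r - s) r) : Set E) := by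
  have hr : 0 < r := hs.trans hsr
  set S : Set E := norm ⁻¹' (Ioo (r - s) r) with hS
  set χ : E → ℝ := radialCutoff r s with hχ
  have hSm : MeasurableSet S := measurable_norm measurableSet_Ioo
  have hSfin : μ S < ⊤ := lt_of_le_of_lt (measure_mono fun x hx => by
    rw [mem_closedBall_zero_iff]; exact hx.2.le) (measure_closedBall_lt_top (x := (0 : E)) (r := r))
  have hSball : S ⊆ ball 0 r := fun x hx => by rw [mem_ball_zero_iff]; exact hx.2
  have hld : ∀ x, ‖lineDeriv ℝ g x w‖ ≤ L * ‖w‖ := fun x =>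
    norm_lineDeriv_le_of_lipschitz ℝ hg
  have hldm : AEStronglyMeasurable (fun x => lineDeriv ℝ g x w) μ :=
    aestronglyMeasurable_lineDeriv hg.continuous μ
  have hχc : Continuous χ := (lipschitzWith_radialCutoff r hs).continuous
  have hint : Integrable (fun x => lineDeriv ℝ g x w) (μ.restrict (ball 0 r)) :=
    Measure.integrableOn_of_bounded (M := L * ‖w‖) measure_ball_lt_top.ne hldm
      (Eventually.of_forall hld)
  have hint2 : Integrable (fun x => lineDeriv ℝ g x w * χ x) (μ.restrict (ball 0 r)) :=
    Measure.integrableOn_of_bounded (M := L * ‖w‖) measure_ball_lt_top.ne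
      (hldm.mul hχc.aestronglyMeasurable)
      (Eventually.of_forall fun x => by
        rw [norm_mul]
        calc _ ≤ L * ‖w‖ * 1 := by
              refine mul_le_mul (hld x) ?_ (norm_nonneg _) (by positivity)
              rw [Real.norm_of_nonneg (radialCutoff_nonneg r s x)]
              exact radialCutoff_le_one r s x
          _ = _ := mul_one _)
  -- integration by parts against the cutoff
  have hibp := LipschitzWith.integral_lineDeriv_mul_eq (μ := μ) hg
    (lipschitzWith_radialCutoff r hs) (hasCompactSupport_radialCutoff r hs) w
  have hleft : ∫ x, lineDeriv ℝ g x w * χ x ∂μ =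
      ∫ x in ball 0 r, lineDeriv ℝ g x w * χ x ∂μ := by
    refine (setIntegral_eq_integral_of_forall_compl_eq_zero fun x hx => ?_).symm
    rw [hχ, radialCutoff_eq_zero hs (by simpa using hx), mul_zero]
  have hright : ∫ x, lineDeriv ℝ (radialCutoff r s) x (-w) * g x ∂μ =
      ∫ x in S, s⁻¹ * inner ℝ (‖x‖⁻¹ • x) w * g x ∂μ := by
    rw [← integral_indicator hSm]
    have hn1 : ∀ᵐ x ∂μ, x ∉ sphere (0 : E) r :=
      measure_eq_zero_iff_ae_notMem.1 (Measure.addHaar_sphere μ 0 r)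
    have hn2 : ∀ᵐ x ∂μ, x ∉ sphere (0 : E) (r - s) :=
      measure_eq_zero_iff_ae_notMem.1 (Measure.addHaar_sphere μ 0 (r - s))
    refine integral_congr_ae ?_
    filter_upwards [hn1, hn2] with x h1 h2
    rw [mem_sphere_zero_iff_norm] at h1 h2
    by_cases hxS : x ∈ S
    · rw [indicator_of_mem hxS, lineDeriv_radialCutoff_shell hs hsr hxS.1 hxS.2]
      simp
    · rw [indicator_of_notMem hxS]
      rcases lt_or_gt_of_ne h2 with h3 | h3
      · rw [lineDeriv_radialCutoff_of_lt hs h3, zero_mul]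
      · have h4 : r < ‖x‖ := by
          by_contra h5
          exact hxS ⟨h3, lt_of_le_of_ne (not_lt.1 h5) h1⟩
        rw [lineDeriv_radialCutoff_of_gt hs h4, zero_mul]
  rw [hleft, hright] at hibp
  -- the part of the ball where the cutoff is not `1`
  have hA : |∫ x in ball 0 r, lineDeriv ℝ g x w ∂μ -
      ∫ x in ball 0 r, lineDeriv ℝ g x w * χ x ∂μ| ≤ L * ‖w‖ * μ.real S := by
    rw [← integral_sub hint hint2]
    have : ∫ x in ball 0 r, (lineDeriv ℝ g x w - lineDeriv ℝ g x w * χ x) ∂μ =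
        ∫ x in S, (lineDeriv ℝ g x w - lineDeriv ℝ g x w * χ x) ∂μ := by
      refine setIntegral_eq_of_subset_of_forall_sdiff_eq_zero measurableSet_ball hSball
        fun x hx => ?_
      have h1 : ‖x‖ ≤ r - s := by
        by_contra h
        exact hx.2 ⟨not_le.1 h, by simpa using hx.1⟩
      rw [hχ, radialCutoff_eq_one hs h1, mul_one, sub_self]
    rw [this, ← Real.norm_eq_abs]
    refine norm_setIntegral_le_of_norm_le_const hSfin fun x _ => ?_
    rw [← mul_one_sub, norm_mul]
    calc _ ≤ L * ‖w‖ * 1 := by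
          refine mul_le_mul (hld x) ?_ (norm_nonneg _) (by positivity)
          rw [Real.norm_of_nonneg (sub_nonneg.2 (radialCutoff_le_one r s x))]
          linarith [radialCutoff_nonneg r s x]
      _ = _ := mul_one _
  -- replacing `g x` by its value at the boundary point `r x / ‖x‖`
  have hinner : ∀ x ∈ S, |inner ℝ (‖x‖⁻¹ • x) w| ≤ ‖w‖ := fun x hx => by
    refine (abs_real_inner_le_norm _ _).trans ?_
    have : ‖x‖ ≠ 0 := by
      have := hx.1
      intro h0
      rw [h0] at this
      linarith
    rw [norm_smul, norm_inv, norm_norm, inv_mul_cancel₀ this, one_mul]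
  have hdirm : Measurable fun x : E => ‖x‖⁻¹ • x := by fun_prop
  have hM : ∃ M, ∀ x ∈ closedBall (0 : E) r, ‖g x‖ ≤ M :=
    (isCompact_closedBall (0 : E) r).exists_bound_of_continuousOn hg.continuous.continuousOn
  obtain ⟨M, hM⟩ := hM
  have hM0 : 0 ≤ M := (norm_nonneg _).trans (hM 0 (by simp [hr.le]))
  have hdirn : ∀ x ∈ S, ‖‖x‖⁻¹ • x‖ = 1 := fun x hx => by
    have : ‖x‖ ≠ 0 := by
      have := hx.1
      intro h0
      rw [h0] at this
      linarith
    rw [norm_smul, norm_inv, norm_norm, inv_mul_cancel₀ this]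
  have hi1 : IntegrableOn (fun x => s⁻¹ * inner ℝ (‖x‖⁻¹ • x) w * g x) S μ := by
    refine IntegrableOn.of_bound (C := s⁻¹ * ‖w‖ * M) hSfin ?_ ?_
    · exact ((measurable_const.mul (hdirm.inner measurable_const)).mul
        hg.continuous.measurable).aestronglyMeasurable
    · filter_upwards [ae_restrict_mem hSm] with x hx
      rw [norm_mul, norm_mul, Real.norm_of_nonneg (by positivity : 0 ≤ s⁻¹)]
      gcongr
      · exact hinner x hx
      · exact hM x (ball_subset_closedBall (hSball hx))
  have hi2 : IntegrableOn
      (fun x => s⁻¹ * inner ℝ (‖x‖⁻¹ • x) w * g (r • (‖x‖⁻¹ • x))) S μ := by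
    refine IntegrableOn.of_bound (C := s⁻¹ * ‖w‖ * M) hSfin ?_ ?_
    · exact ((measurable_const.mul (hdirm.inner measurable_const)).mul
        (hg.continuous.measurable.comp (hdirm.const_smul r))).aestronglyMeasurable
    · filter_upwards [ae_restrict_mem hSm] with x hx
      rw [norm_mul, norm_mul, Real.norm_of_nonneg (by positivity : 0 ≤ s⁻¹)]
      gcongr
      · exact hinner x hx
      · refine hM _ ?_
        rw [mem_closedBall_zero_iff, norm_smul, hdirn x hx, mul_one, Real.norm_of_nonneg hr.le]
  have hB : |(∫ x in S, s⁻¹ * inner ℝ (‖x‖⁻¹ • x) w * g x ∂μ) -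
      ∫ x in S, s⁻¹ * inner ℝ (‖x‖⁻¹ • x) w * g (r • (‖x‖⁻¹ • x)) ∂μ| ≤
        L * ‖w‖ * μ.real S := by
    rw [← integral_sub hi1 hi2, ← Real.norm_eq_abs]
    refine norm_setIntegral_le_of_norm_le_const hSfin fun x hx => ?_
    rw [← mul_sub, norm_mul, norm_mul, Real.norm_of_nonneg (by positivity : 0 ≤ s⁻¹)]
    have h1 : ‖g x - g (r • (‖x‖⁻¹ • x))‖ ≤ L * s := by
      refine (hg.norm_sub_le _ _).trans ?_
      gcongr
      have hx0 : 0 < ‖x‖ := lt_trans (by linarith) hx.1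
      have : x - r • (‖x‖⁻¹ • x) = (‖x‖ - r) • (‖x‖⁻¹ • x) := by
        rw [sub_smul, smul_inv_smul₀ hx0.ne']
      rw [this, norm_smul, hdirn x hx, mul_one, Real.norm_eq_abs, abs_le]
      exact ⟨by linarith [hx.1], by linarith [hx.2]⟩
    calc s⁻¹ * ‖inner ℝ (‖x‖⁻¹ • x) w‖ * ‖g x - g (r • (‖x‖⁻¹ • x))‖
        ≤ s⁻¹ * ‖w‖ * (L * s) := by
          gcongr
          exact hinner x hx
      _ = L * ‖w‖ := by field_simp
  have hC : ∫ x in S, s⁻¹ * inner ℝ (‖x‖⁻¹ • x) w * g (r • (‖x‖⁻¹ • x)) ∂μ =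
      s⁻¹ * (μ.real S * ∫ D, g (r • D) * inner ℝ D w ∂(sphereUnif μ)) := by
    rw [← setIntegral_direction μ measurableSet_Ioo
      (u := fun D => g (r • D) * inner ℝ D w) (by
        have := hg.continuous
        exact Continuous.aestronglyMeasurable (by fun_prop)), ← integral_const_mul]
    refine integral_congr_ae (Eventually.of_forall fun x => ?_)
    ring
  rw [hC] at hB
  rw [hibp] at hA
  calc _ ≤ _ := abs_sub_le _ _ _
    _ ≤ L * ‖w‖ * μ.real S + L * ‖w‖ * μ.real S := add_le_add hA hB
    _ = _ := by ring

/-- The divergence theorem on a ball, for Lipschitz functions. -/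
theorem integral_lineDeriv_ball [Nontrivial E] {g : E → ℝ} {L : NNReal}
    (hg : LipschitzWith L g) {r : ℝ} (hr : 0 < r) (w : E) :
    ∫ x in ball 0 r, lineDeriv ℝ g x w ∂μ =
      Module.finrank ℝ E * r ^ (Module.finrank ℝ E - 1) * μ.real (ball (0 : E) 1) *
        ∫ D, g (r • D) * inner ℝ D w ∂(sphereUnif μ) := by
  set d := Module.finrank ℝ E
  set V := μ.real (ball (0 : E) 1)
  set I := ∫ D, g (r • D) * inner ℝ D w ∂(sphereUnif μ)
  set Z := ∫ x in ball 0 r, lineDeriv ℝ g x w ∂μ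
  have hder : HasDerivAt (fun t : ℝ => r ^ d - (r - t) ^ d) (d * r ^ (d - 1)) 0 := by
    have := (((hasDerivAt_id (0 : ℝ)).const_sub r).fun_pow d).const_sub (r ^ d)
    simpa using this
  have hquot : Tendsto (fun s : ℝ => s⁻¹ * (r ^ d - (r - s) ^ d)) (𝓝[>] 0)
      (𝓝 (d * r ^ (d - 1))) := by
    have := hder.tendsto_slope_zero_right
    simpa using this
  have hzero : Tendsto (fun s : ℝ => r ^ d - (r - s) ^ d) (𝓝[>] 0) (𝓝 0) := by
    have : Continuous fun s : ℝ => r ^ d - (r - s) ^ d := by fun_prop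
    have h2 := (this.tendsto 0).mono_left (nhdsWithin_le_nhds (s := Ioi 0))
    simpa using h2
  have hlim : Tendsto (fun s : ℝ => |Z - s⁻¹ * (V * (r ^ d - (r - s) ^ d) * I)|) (𝓝[>] 0)
      (𝓝 |Z - d * r ^ (d - 1) * V * I|) := by
    have h1 : Tendsto (fun s : ℝ => Z - s⁻¹ * (r ^ d - (r - s) ^ d) * (V * I)) (𝓝[>] 0)
        (𝓝 (Z - d * r ^ (d - 1) * (V * I))) := tendsto_const_nhds.sub (hquot.mul_const _)
    rw [mul_assoc _ V I]
    exact h1.abs.congr fun s => by congr 1; ring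
  have hlim2 : Tendsto (fun s : ℝ => 2 * L * ‖w‖ * (V * (r ^ d - (r - s) ^ d))) (𝓝[>] 0)
      (𝓝 0) := by
    simpa using (hzero.const_mul V).const_mul (2 * L * ‖w‖)
  have hle : |Z - d * r ^ (d - 1) * V * I| ≤ 0 := by
    refine le_of_tendsto_of_tendsto hlim hlim2 ?_
    filter_upwards [Ioo_mem_nhdsGT hr] with s hs
    have := abs_integral_lineDeriv_sub_le μ hg hs.1 hs.2 w
    rwa [measureReal_shell μ hs.1 hs.2] at this
  exact sub_eq_zero.1 (abs_eq_zero.1 (le_antisymm hle (abs_nonneg _)))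

/-- The divergence theorem on a ball, for functions that are differentiable with bounded derivative
on the closed ball. -/
theorem integral_fderiv_ball [Nontrivial E] {f : E → ℝ} {r L : ℝ} (hr : 0 < r)
    (hf : ∀ x ∈ closedBall (0 : E) r, DifferentiableAt ℝ f x)
    (hL : ∀ x ∈ closedBall (0 : E) r, ‖fderiv ℝ f x‖ ≤ L) (w : E) :
    ∫ x in ball 0 r, fderiv ℝ f x w ∂μ =
      Module.finrank ℝ E * r ^ (Module.finrank ℝ E - 1) * μ.real (ball (0 : E) 1) *
        ∫ D, f (r • D) * inner ℝ D w ∂(sphereUnif μ) := by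
  have hlip : LipschitzOnWith (Real.toNNReal L) f (closedBall 0 r) :=
    (convex_closedBall (0 : E) r).lipschitzOnWith_of_nnnorm_fderiv_le hf fun x hx => by
      rw [← NNReal.coe_le_coe, coe_nnnorm]
      exact (hL x hx).trans (Real.le_coe_toNNReal L)
  obtain ⟨g, hg, hgf⟩ := hlip.extend_real
  have h := integral_lineDeriv_ball μ hg hr w
  have h1 : ∫ x in ball 0 r, fderiv ℝ f x w ∂μ = ∫ x in ball 0 r, lineDeriv ℝ g x w ∂μ := by
    refine setIntegral_congr_fun measurableSet_ball fun x hx => ?_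
    have h2 : g =ᶠ[𝓝 x] f := by
      filter_upwards [isOpen_ball.mem_nhds hx] with y hy
      exact (hgf (ball_subset_closedBall hy)).symm
    rw [h2.lineDeriv_eq, (hf x (ball_subset_closedBall hx)).lineDeriv_eq_fderiv]
  rw [h1, h]
  congr 1
  refine integral_congr_ae ?_
  filter_upwards [ae_norm_eq_one_sphereUnif μ] with D hD
  rw [hgf]
  rw [mem_closedBall_zero_iff, norm_smul, hD, mul_one, Real.norm_of_nonneg hr.le]

theorem integrable_smul_sphereUnif [Nontrivial E] {f : E → ℝ} {r C : ℝ}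
    (hm : Measurable f) (hC : ∀ D : E, ‖D‖ = 1 → |f (r • D)| ≤ C) :
    Integrable (fun D => f (r • D) • D) (sphereUnif μ) := by
  have := isProbabilityMeasure_sphereUnif μ
  refine Integrable.of_bound (C := C) ?_ ?_
  · exact ((hm.comp (measurable_const_smul r)).smul measurable_id).aestronglyMeasurable
  · filter_upwards [ae_norm_eq_one_sphereUnif μ] with D hD
    rw [norm_smul, hD, mul_one]
    exact hC D hD

/-- The one-point estimator `(d / r) f(r D) D` has mean within `φ r` of the gradient at the centre,
if the gradient varies by at most `φ ‖x‖` within the ball. -/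
theorem norm_sphere_estimator_sub_gradient_le [Nontrivial E] {f : E → ℝ} {r φ : ℝ} (hr : 0 < r)
    (hm : Measurable f)
    (hf : ∀ x ∈ closedBall (0 : E) r, DifferentiableAt ℝ f x)
    (hφ : ∀ x ∈ closedBall (0 : E) r, ‖gradient f x - gradient f 0‖ ≤ φ * ‖x‖) (hφ0 : 0 ≤ φ) :
    ‖(Module.finrank ℝ E / r : ℝ) • ∫ D, f (r • D) • D ∂(sphereUnif μ) - gradient f 0‖ ≤
      φ * r := by
  have hd : 0 < Module.finrank ℝ E := Module.finrank_pos
  set d := Module.finrank ℝ E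
  set V := μ.real (ball (0 : E) 1) with hV
  have hVpos : 0 < V :=
    ENNReal.toReal_pos (measure_ball_pos μ _ (by positivity)).ne' measure_ball_lt_top.ne
  have hVr : μ.real (ball (0 : E) r) = r ^ d * V := by
    rw [measureReal_def, μ.addHaar_ball_of_pos _ hr, ENNReal.toReal_mul,
      ENNReal.toReal_ofReal (by positivity)]
    rfl
  have hfd : ∀ x ∈ closedBall (0 : E) r, ∀ w, fderiv ℝ f x w = inner ℝ (gradient f x) w :=
    fun x hx w => by
      rw [gradient, InnerProductSpace.toDual_symm_apply]
  have hL : ∀ x ∈ closedBall (0 : E) r, ‖fderiv ℝ f x‖ ≤ ‖gradient f 0‖ + φ * r := by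
    intro x hx
    have h1 : ‖fderiv ℝ f x‖ = ‖gradient f x‖ := by
      rw [gradient, LinearIsometryEquiv.norm_map]
    rw [h1]
    have h2 : ‖gradient f x‖ ≤ ‖gradient f 0‖ + ‖gradient f x - gradient f 0‖ := by
      have := norm_add_le (gradient f 0) (gradient f x - gradient f 0)
      rwa [add_sub_cancel] at this
    have h3 : φ * ‖x‖ ≤ φ * r := by
      gcongr
      simpa using hx
    linarith [hφ x hx]
  have hcont : ContinuousOn f (closedBall 0 r) := fun x hx =>
    (hf x hx).continuousAt.continuousWithinAt
  obtain ⟨C, hC⟩ := (isCompact_closedBall (0 : E) r).exists_bound_of_continuousOn hcont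
  have hint := integrable_smul_sphereUnif μ (r := r) hm (C := C) fun D hD => hC _ (by
    rw [mem_closedBall_zero_iff, norm_smul, hD, mul_one, Real.norm_of_nonneg hr.le])
  -- testing against a direction `w`
  have key : ∀ w : E, inner ℝ ((d / r : ℝ) • ∫ D, f (r • D) • D ∂(sphereUnif μ) -
      gradient f 0) w ≤ φ * r * ‖w‖ := by
    intro w
    have h1 := integral_fderiv_ball μ hr hf hL w
    have h2 : inner ℝ (∫ D, f (r • D) • D ∂(sphereUnif μ)) w =
        ∫ D, f (r • D) * inner ℝ D w ∂(sphereUnif μ) := by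
      rw [real_inner_comm, ← integral_inner hint]
      refine integral_congr_ae (Eventually.of_forall fun D => ?_)
      simp only
      rw [inner_smul_right, real_inner_comm]
    have hpow : r ^ d = r ^ (d - 1) * r := by
      rw [← pow_succ, Nat.sub_add_cancel hd]
    have h3 : (d / r : ℝ) * ∫ D, f (r • D) * inner ℝ D w ∂(sphereUnif μ) =
        (μ.real (ball (0 : E) r))⁻¹ * ∫ x in ball 0 r, fderiv ℝ f x w ∂μ := by
      rw [h1, hVr, hpow, ← hV]
      field_simp
      ring
    have hfdint : IntegrableOn (fun x => fderiv ℝ f x w) (ball 0 r) μ := by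
      refine IntegrableOn.of_bound (C := (‖gradient f 0‖ + φ * r) * ‖w‖) measure_ball_lt_top
        (measurable_fderiv_apply_const ℝ f w).aestronglyMeasurable ?_
      filter_upwards [ae_restrict_mem measurableSet_ball] with x hx
      exact ((fderiv ℝ f x).le_opNorm w).trans
        (by gcongr; exact hL x (ball_subset_closedBall hx))
    have h4 : (∫ x in ball 0 r, fderiv ℝ f x w ∂μ) -
        μ.real (ball (0 : E) r) * inner ℝ (gradient f 0) w ≤
          φ * r * ‖w‖ * μ.real (ball (0 : E) r) := by
      have h5 : μ.real (ball (0 : E) r) * inner ℝ (gradient f 0) w =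
          ∫ x in ball (0 : E) r, inner ℝ (gradient f 0) w ∂μ := by
        rw [setIntegral_const, smul_eq_mul]
      rw [h5, ← integral_sub hfdint (integrableOn_const measure_ball_lt_top.ne)]
      refine (le_abs_self _).trans ?_
      rw [← Real.norm_eq_abs]
      refine norm_setIntegral_le_of_norm_le_const measure_ball_lt_top fun x hx => ?_
      have hx' := ball_subset_closedBall hx
      rw [hfd x hx', ← inner_sub_left]
      refine (norm_inner_le_norm _ _).trans ?_
      gcongr
      refine (hφ x hx').trans ?_
      gcongr
      simpa using hx'
    rw [inner_sub_left, inner_smul_left, h2]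
    simp only [conj_trivial]
    rw [h3]
    have hBr : 0 < μ.real (ball (0 : E) r) :=
    ENNReal.toReal_pos (measure_ball_pos μ _ (by positivity)).ne' measure_ball_lt_top.ne
    calc _ = (μ.real (ball (0 : E) r))⁻¹ * ((∫ x in ball 0 r, fderiv ℝ f x w ∂μ) -
        μ.real (ball (0 : E) r) * inner ℝ (gradient f 0) w) := by field_simp
      _ ≤ (μ.real (ball (0 : E) r))⁻¹ * (φ * r * ‖w‖ * μ.real (ball (0 : E) r)) := by gcongr
      _ = _ := by field_simp
  set v := (d / r : ℝ) • ∫ D, f (r • D) • D ∂(sphereUnif μ) - gradient f 0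
  have h := key v
  rw [real_inner_self_eq_norm_sq, sq] at h
  rcases (norm_nonneg v).eq_or_lt with h0 | h0
  · rw [← h0]; positivity
  · exact le_of_mul_le_mul_right h h0

/-- Second moments of the uniform distribution on the sphere. -/
theorem integral_inner_mul_inner_sphereUnif [Nontrivial E] (v w : E) :
    Module.finrank ℝ E * ∫ D, inner ℝ v D * inner ℝ D w ∂(sphereUnif μ) = inner ℝ v w := by
  have h := integral_fderiv_ball μ (f := fun x => inner ℝ v x) (r := 1) (L := ‖v‖) one_pos
    (fun x _ => (innerSL ℝ v).differentiableAt)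
    (fun x _ => by
      rw [show (fun x => inner ℝ v x) = (innerSL ℝ v : E → ℝ) from rfl,
        (innerSL ℝ v).fderiv, innerSL_apply_norm]) w
  have h2 : ∀ x : E, fderiv ℝ (fun x => inner ℝ v x) x w = inner ℝ v w := fun x => by
    rw [show (fun x => inner ℝ v x) = (innerSL ℝ v : E → ℝ) from rfl, (innerSL ℝ v).fderiv]
    rfl
  simp only [h2, setIntegral_const, smul_eq_mul, one_pow, mul_one, one_smul] at h
  have hV : 0 < μ.real (ball (0 : E) 1) :=
    ENNReal.toReal_pos (measure_ball_pos μ _ (by positivity)).ne' measure_ball_lt_top.ne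
  have : μ.real (ball (0 : E) 1) * (Module.finrank ℝ E *
      ∫ D, inner ℝ v D * inner ℝ D w ∂(sphereUnif μ)) =
      μ.real (ball (0 : E) 1) * inner ℝ v w := by rw [h]; ring
  exact mul_left_cancel₀ hV.ne' this

end Stokes

/-! ### Wirtinger's inequality and rotations -/

section Wirtinger

open Real

/-- Wirtinger's inequality for antiperiodic functions: such a function has no constant Fourier
mode, so differentiation does not decrease its `L²` norm over a period. -/
theorem wirtinger_antiperiodic {u u' : ℝ → ℝ} (hu : ∀ t, HasDerivAt u (u' t) t)
    (hu' : Continuous u') (hanti : ∀ t, u (t + π) = -u t) :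
    ∫ t in (0 : ℝ)..2 * π, u t ^ 2 ≤ ∫ t in (0 : ℝ)..2 * π, u' t ^ 2 := by
  have hpi : (0 : ℝ) < 2 * π := by positivity
  have hc : Continuous u := continuous_iff_continuousAt.2 fun t => (hu t).continuousAt
  have hper : u (2 * π) = u 0 := by
    have h1 := hanti 0
    have h2 := hanti π
    rw [zero_add] at h1
    rw [two_mul, h2, h1, neg_neg]
  set f : ℝ → ℂ := fun t => (u t : ℂ) with hf
  set f' : ℝ → ℂ := fun t => (u' t : ℂ) with hf'
  have hfc : Continuous f := Complex.continuous_ofReal.comp hc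
  have hfc' : Continuous f' := Complex.continuous_ofReal.comp hu'
  have hmem : ∀ g : ℝ → ℂ, Continuous g → MemLp g 2 (volume.restrict (Set.Ioc 0 (2 * π))) := by
    intro g hg
    obtain ⟨C, hC⟩ := (isCompact_Icc (a := (0 : ℝ)) (b := 2 * π)).exists_bound_of_continuousOn
      hg.continuousOn
    refine MemLp.of_bound hg.aestronglyMeasurable C ?_
    filter_upwards [ae_restrict_mem measurableSet_Ioc] with t ht
    exact hC t (Set.Ioc_subset_Icc_self ht)
  have hp := hasSum_sq_fourierCoeffOn hpi (hmem f hfc)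
  have hp' := hasSum_sq_fourierCoeffOn hpi (hmem f' hfc')
  have hle : ∀ n : ℤ, ‖fourierCoeffOn hpi f n‖ ^ 2 ≤ ‖fourierCoeffOn hpi f' n‖ ^ 2 := by
    intro n
    by_cases hn : n = 0
    · subst hn
      have h0 : fourierCoeffOn hpi f 0 = 0 := by
        rw [fourierCoeffOn_eq_integral]
        have h1 : ∫ x in (0 : ℝ)..2 * π, f x = 0 := by
          have hi : ∀ a b : ℝ, IntervalIntegrable f volume a b := fun a b =>
            hfc.intervalIntegrable a b
          rw [← intervalIntegral.integral_add_adjacent_intervals (hi 0 π) (hi π (2 * π))]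
          have h2 : ∫ x in π..2 * π, f x = ∫ x in (0 : ℝ)..π, f (x + π) := by
            rw [intervalIntegral.integral_comp_add_right, zero_add, ← two_mul]
          have h3 : ∀ x, f (x + π) = -f x := fun x => by simp [hf, hanti]
          rw [h2]
          simp only [h3, intervalIntegral.integral_neg]
          ring
        simp [h1]
      rw [h0]
      simp
    · have h := fourierCoeffOn_of_hasDerivAt hpi hn
        (f := f) (f' := f') (fun x _ => (hu x).ofReal_comp) (hfc'.intervalIntegrable _ _)
      have h2 : f (2 * π) - f 0 = 0 := by simp [hf, hper]
      rw [h2, mul_zero, zero_sub] at h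
      have hn1 : (1 : ℝ) ≤ |(n : ℝ)| := by
        exact_mod_cast Int.one_le_abs hn
      have h3 : ‖fourierCoeffOn hpi f n‖ * |(n : ℝ)| = ‖fourierCoeffOn hpi f' n‖ := by
        rw [h]
        simp only [norm_mul, norm_div, norm_neg, norm_one, Complex.norm_I, Complex.norm_real,
          Complex.norm_intCast, Complex.norm_ofNat, Complex.ofReal_zero, sub_zero,
          Complex.ofReal_mul, Complex.ofReal_ofNat, Real.norm_of_nonneg pi_pos.le, mul_one]
        have : |(n : ℝ)| ≠ 0 := by positivity
        field_simp
      have h4 : ‖fourierCoeffOn hpi f n‖ ≤ ‖fourierCoeffOn hpi f' n‖ := by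
        rw [← h3]
        exact le_mul_of_one_le_right (norm_nonneg _) hn1
      gcongr
  have h := hasSum_le hle hp hp'
  have h2 := le_of_smul_le_smul_left h (by positivity)
  simpa [hf, hf'] using h2

end Wirtinger

section Rotation

variable {E : Type*} [NormedAddCommGroup E] [InnerProductSpace ℝ E] [FiniteDimensional ℝ E]
  [MeasurableSpace E] [BorelSpace E] (μ : Measure E) [μ.IsAddHaarMeasure]

theorem measurePreserving_shear_fst (t : ℝ) :
    MeasurePreserving (fun p : E × E => (p.1 + t • p.2, p.2)) (μ.prod μ) (μ.prod μ) := by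
  have h : MeasurePreserving (fun p : E × E => (p.1, p.2 + t • p.1)) (μ.prod μ) (μ.prod μ) :=
    (MeasurePreserving.id μ).skew_product (g := fun x y => y + t • x) (by fun_prop)
      (Filter.Eventually.of_forall fun x => (measurePreserving_add_right μ (t • x)).map_eq)
  exact (Measure.measurePreserving_swap.comp h).comp Measure.measurePreserving_swap

theorem measurePreserving_shear_snd (t : ℝ) :
    MeasurePreserving (fun p : E × E => (p.1, p.2 + t • p.1)) (μ.prod μ) (μ.prod μ) :=
  (MeasurePreserving.id μ).skew_product (g := fun x y => y + t • x) (by fun_prop)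
    (Filter.Eventually.of_forall fun x => (measurePreserving_add_right μ (t • x)).map_eq)

/-- Rotations in the plane of the two factors preserve `μ × μ`. -/
theorem measurePreserving_rotation {c s : ℝ} (h : c ^ 2 + s ^ 2 = 1) :
    MeasurePreserving (fun p : E × E => (c • p.1 + s • p.2, -s • p.1 + c • p.2))
      (μ.prod μ) (μ.prod μ) := by
  by_cases hc : 1 + c = 0
  · have hc' : c = -1 := by linarith
    have hs : s = 0 := by
      rw [hc'] at h
      nlinarith
    have := (Measure.measurePreserving_neg μ).prod (Measure.measurePreserving_neg μ)
    convert this using 1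
    ext p <;> simp [hc', hs]
  · -- a rotation is a product of three shears
    have := ((measurePreserving_shear_fst μ (s / (1 + c))).comp
      (measurePreserving_shear_snd μ (-s))).comp (measurePreserving_shear_fst μ (s / (1 + c)))
    convert this using 1
    have e1 : c = 1 + s / (1 + c) * (-s) := by
      field_simp
      linarith
    have e2 : s = s / (1 + c) + (s / (1 + c)) * (1 + (-s) * (s / (1 + c))) := by
      field_simp
      linear_combination s * h
    have e3 : c = 1 + (-s) * (s / (1 + c)) := by
      field_simp
      linarith
    generalize s / (1 + c) = t at e1 e2 e3
    ext p
    · have e : c • p.1 + s • p.2 = (1 + t * (-s)) • p.1 + (t + t * (1 + (-s) * t)) • p.2 := by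
        rw [← e1, ← e2]
      simp only [Function.comp, e]
      module
    · have e : -s • p.1 + c • p.2 = -s • p.1 + (1 + (-s) * t) • p.2 := by
        rw [← e3]
      simp only [Function.comp, e]
      module

theorem ae_prod_inner_sq_ne (hd : 2 ≤ Module.finrank ℝ E) :
    ∀ᵐ p : E × E ∂(μ.prod μ), inner ℝ p.1 p.2 ^ 2 ≠ ‖p.1‖ ^ 2 * ‖p.2‖ ^ 2 := by
  have hnt : Nontrivial E := Module.nontrivial_of_finrank_pos (R := ℝ) (by omega)
  rw [ae_iff]
  simp only [ne_eq, not_not]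
  have hm : MeasurableSet {p : E × E | inner ℝ p.1 p.2 ^ 2 = ‖p.1‖ ^ 2 * ‖p.2‖ ^ 2} :=
    (isClosed_eq (by fun_prop) (by fun_prop)).measurableSet
  rw [Measure.measure_prod_null hm]
  have h0 : ∀ᵐ x ∂μ, x ≠ 0 := by
    rw [ae_iff]
    simp
  filter_upwards [h0] with x hx
  have hsub : Prod.mk x ⁻¹' {p : E × E | inner ℝ p.1 p.2 ^ 2 = ‖p.1‖ ^ 2 * ‖p.2‖ ^ 2} ⊆
      (Submodule.span ℝ {x} : Set E) := by
    intro y hy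
    have hy' : inner ℝ x y ^ 2 = ‖x‖ ^ 2 * ‖y‖ ^ 2 := hy
    rw [SetLike.mem_coe, Submodule.mem_span_singleton]
    refine ⟨inner ℝ x y / ‖x‖ ^ 2, ?_⟩
    have hx2 : ‖x‖ ^ 2 ≠ 0 := by positivity
    rw [← sub_eq_zero, ← norm_eq_zero, ← sq_eq_zero_iff, norm_sub_sq_real, norm_smul,
      inner_smul_left, mul_pow, Real.norm_eq_abs, sq_abs]
    simp only [conj_trivial]
    field_simp
    linear_combination -hy'
  refine measure_mono_null hsub (Measure.addHaar_submodule μ _ ?_)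
  intro htop
  have h1 := finrank_span_singleton (K := ℝ) hx
  rw [htop, finrank_top] at h1
  omega

end Rotation

/-! ### A Poincaré inequality on the sphere -/

section Poincare

open Set Metric Filter Topology Real

variable {E : Type*} [NormedAddCommGroup E] [InnerProductSpace ℝ E] [FiniteDimensional ℝ E]

/-- The gradient at `x ≠ 0` of the positively homogeneous extension `x ↦ ‖x‖ h(x / ‖x‖)` of a
function `h` on the unit sphere. -/
noncomputable def homExtGradient (h : E → ℝ) (x : E) : E :=
  (h (‖x‖⁻¹ • x) - inner ℝ (gradient h (‖x‖⁻¹ • x)) (‖x‖⁻¹ • x)) • (‖x‖⁻¹ • x) +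
    gradient h (‖x‖⁻¹ • x)

omit [FiniteDimensional ℝ E] in
theorem norm_direction {x : E} (hx : x ≠ 0) : ‖‖x‖⁻¹ • x‖ = 1 := by
  rw [norm_smul, norm_inv, norm_norm, inv_mul_cancel₀ (norm_ne_zero_iff.2 hx)]

theorem hasFDerivAt_homExt {h : E → ℝ} {x : E} (hx : x ≠ 0)
    (hh : DifferentiableAt ℝ h (‖x‖⁻¹ • x)) :
    HasFDerivAt (fun y => ‖y‖ * h (‖y‖⁻¹ • y)) (innerSL ℝ (homExtGradient h x)) x := by
  have hn : ‖x‖ ≠ 0 := norm_ne_zero_iff.2 hx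
  have h5 := hasFDerivAt_norm_of_ne_zero hx
  have hinv := (hasDerivAt_inv hn).comp_hasFDerivAt x h5
  have hdir := hinv.smul (hasFDerivAt_id x)
  have hh2 : HasFDerivAt h (fderiv ℝ h (‖x‖⁻¹ • x)) (((Inv.inv ∘ fun y : E => ‖y‖) • id) x) :=
    hh.hasFDerivAt
  have := h5.mul (hh2.comp x hdir)
  refine this.congr_fderiv ?_
  ext v
  have hfd : ∀ w, fderiv ℝ h (‖x‖⁻¹ • x) w = inner ℝ (gradient h (‖x‖⁻¹ • x)) w :=
    fun w => by rw [gradient, InnerProductSpace.toDual_symm_apply]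
  simp only [homExtGradient, add_apply, smul_apply,
    ContinuousLinearMap.comp_apply, Function.comp, smul_eq_mul, innerSL_apply_apply,
    inner_add_left, inner_smul_left, conj_trivial, hfd, ContinuousLinearMap.smulRight_apply,
    inner_add_right, inner_smul_right, Pi.smul_apply', id, ContinuousLinearMap.id_apply]
  field_simp
  ring

theorem norm_homExtGradient_sq_le {h : E → ℝ} {L : ℝ} {x : E} (hx : x ≠ 0)
    (hL : ‖gradient h (‖x‖⁻¹ • x)‖ ≤ L) :
    ‖homExtGradient h x‖ ^ 2 ≤ h (‖x‖⁻¹ • x) ^ 2 + L ^ 2 := by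
  have h1 := norm_direction hx
  have h2 : ‖gradient h (‖x‖⁻¹ • x)‖ ^ 2 ≤ L ^ 2 := by gcongr
  rw [homExtGradient, norm_add_sq_real, norm_smul, h1, inner_smul_left, mul_one, Real.norm_eq_abs,
    sq_abs, real_inner_comm]
  simp only [conj_trivial]
  nlinarith [sq_nonneg (inner ℝ (‖x‖⁻¹ • x) (gradient h (‖x‖⁻¹ • x)))]

theorem continuousAt_homExtGradient {h : E → ℝ} {U : Set E} (hU : IsOpen U)
    (hsU : sphere (0 : E) 1 ⊆ U) (hh : ContDiffOn ℝ 1 h U) {x : E} (hx : x ≠ 0) :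
    ContinuousAt (homExtGradient h) x := by
  have hn : ‖x‖ ≠ 0 := norm_ne_zero_iff.2 hx
  have hdir : ContinuousAt (fun y : E => ‖y‖⁻¹ • y) x :=
    (continuous_norm.continuousAt.inv₀ hn).smul continuousAt_id
  have hmem : ‖x‖⁻¹ • x ∈ U := hsU (by rw [mem_sphere_zero_iff_norm, norm_direction hx])
  have hc1 : ContinuousAt (fun y : E => h (‖y‖⁻¹ • y)) x :=
    ContinuousAt.comp (g := h) (hh.continuousOn.continuousAt (hU.mem_nhds hmem)) hdir
  have hc2 : ContinuousAt (fun y : E => gradient h (‖y‖⁻¹ • y)) x := by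
    have h3 : ContinuousAt (gradient h) (‖x‖⁻¹ • x) :=
      (InnerProductSpace.toDual ℝ E).symm.continuous.continuousAt.comp
        ((hh.continuousOn_fderiv_of_isOpen hU le_rfl).continuousAt (hU.mem_nhds hmem))
    exact ContinuousAt.comp (g := gradient h) h3 hdir
  exact ((hc1.sub (hc2.inner hdir)).smul hdir).add hc2

/-- Wirtinger's inequality along the great ellipse `cos t x + sin t y`. -/
theorem integral_homExt_ellipse_le {h : E → ℝ} {U : Set E} (hU : IsOpen U)
    (hsU : sphere (0 : E) 1 ⊆ U) (hh : ContDiffOn ℝ 1 h U) (hodd : ∀ D, h (-D) = -h D)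
    {x y : E} (hxy : inner ℝ x y ^ 2 ≠ ‖x‖ ^ 2 * ‖y‖ ^ 2) :
    ∫⁻ t in Ioc 0 (2 * π), ENNReal.ofReal ((‖cos t • x + sin t • y‖ *
        h (‖cos t • x + sin t • y‖⁻¹ • (cos t • x + sin t • y))) ^ 2) ≤
      ∫⁻ t in Ioc 0 (2 * π), ENNReal.ofReal
        (inner ℝ (homExtGradient h (cos t • x + sin t • y)) (-sin t • x + cos t • y) ^ 2) := by
  have hpi : (0 : ℝ) ≤ 2 * π := by positivity
  have hz : ∀ t : ℝ, cos t • x + sin t • y ≠ 0 := by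
    intro t h0
    apply hxy
    by_cases hs : sin t = 0
    · have hc : cos t ≠ 0 := by
        intro hc
        have := sin_sq_add_cos_sq t
        rw [hs, hc] at this
        norm_num at this
      rw [hs, zero_smul, add_zero, smul_eq_zero] at h0
      simp [h0.resolve_left hc]
    · have : y = -((sin t)⁻¹ * cos t) • x := by
        have h1 : sin t • y = -(cos t • x) := by
          rw [eq_neg_iff_add_eq_zero, add_comm]; exact h0
        rw [neg_smul, mul_smul, ← smul_neg, ← h1, inv_smul_smul₀ hs]
      rw [this, inner_smul_right, real_inner_self_eq_norm_sq, norm_smul, mul_pow, mul_pow,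
        Real.norm_eq_abs, sq_abs]
      ring
  have hdz : ∀ t : ℝ, HasDerivAt (fun t : ℝ => cos t • x + sin t • y)
      (-sin t • x + cos t • y) t := fun t =>
    ((hasDerivAt_cos t).smul_const x).add ((hasDerivAt_sin t).smul_const y)
  have hder : ∀ t : ℝ, HasDerivAt (fun t : ℝ => ‖cos t • x + sin t • y‖ *
        h (‖cos t • x + sin t • y‖⁻¹ • (cos t • x + sin t • y)))
      (inner ℝ (homExtGradient h (cos t • x + sin t • y)) (-sin t • x + cos t • y)) t := by
    intro t
    have hmem : ‖cos t • x + sin t • y‖⁻¹ • (cos t • x + sin t • y) ∈ U :=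
      hsU (by rw [mem_sphere_zero_iff_norm, norm_direction (hz t)])
    have hd : DifferentiableAt ℝ h (‖cos t • x + sin t • y‖⁻¹ • (cos t • x + sin t • y)) :=
      (hh.contDiffAt (hU.mem_nhds hmem)).differentiableAt one_ne_zero
    exact (hasFDerivAt_homExt (hz t) hd).comp_hasDerivAt t (hdz t)
  have hcz : Continuous fun t : ℝ => cos t • x + sin t • y := by fun_prop
  have hcont : Continuous fun t : ℝ =>
      inner ℝ (homExtGradient h (cos t • x + sin t • y)) (-sin t • x + cos t • y) := by
    refine Continuous.inner ?_ (by fun_prop)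
    refine continuous_iff_continuousAt.2 fun t => ?_
    exact ContinuousAt.comp (g := homExtGradient h)
      (continuousAt_homExtGradient hU hsU hh (hz t)) hcz.continuousAt
  have hcont0 : Continuous fun t : ℝ => ‖cos t • x + sin t • y‖ *
        h (‖cos t • x + sin t • y‖⁻¹ • (cos t • x + sin t • y)) :=
    continuous_iff_continuousAt.2 fun t => (hder t).continuousAt
  have hw := wirtinger_antiperiodic hder hcont fun t => by
    rw [cos_add_pi, sin_add_pi, neg_smul, neg_smul, ← neg_add, norm_neg, smul_neg, hodd,
      mul_neg]
  rw [intervalIntegral.integral_of_le hpi, intervalIntegral.integral_of_le hpi] at hw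
  have hi : ∀ g : ℝ → ℝ, Continuous g →
      ∫⁻ t in Ioc 0 (2 * π), ENNReal.ofReal (g t ^ 2) =
        ENNReal.ofReal (∫ t in Ioc 0 (2 * π), g t ^ 2) := fun g hg =>
    (ofReal_integral_eq_lintegral_ofReal
      ((hg.pow 2).integrableOn_Ioc) (Eventually.of_forall fun t => sq_nonneg _)).symm
  rw [hi _ hcont0, hi _ hcont]
  exact ENNReal.ofReal_le_ofReal hw

variable [MeasurableSpace E] [BorelSpace E] (μ : Measure E) [μ.IsAddHaarMeasure]

theorem measurable_gradient (h : E → ℝ) : Measurable (gradient h) :=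
  (InnerProductSpace.toDual ℝ E).symm.continuous.measurable.comp (measurable_fderiv ℝ h)

theorem measurable_homExtGradient {h : E → ℝ} (hm : Measurable h) :
    Measurable (homExtGradient h) := by
  have hdir : Measurable fun x : E => ‖x‖⁻¹ • x := by fun_prop
  have hg := (measurable_gradient h).comp hdir
  exact (((hm.comp hdir).sub (hg.inner hdir)).smul hdir).add hg

theorem lintegral_inner_sq_sphereUnif [Nontrivial E] (v : E) :
    ∫⁻ D, ENNReal.ofReal (inner ℝ v D ^ 2) ∂(sphereUnif μ) =
      ENNReal.ofReal (‖v‖ ^ 2 / Module.finrank ℝ E) := by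
  have := isProbabilityMeasure_sphereUnif μ
  have h := integral_inner_mul_inner_sphereUnif μ v v
  have h2 : ∀ D : E, inner ℝ v D * inner ℝ D v = inner ℝ v D ^ 2 := fun D => by
    rw [real_inner_comm v D, sq]
  simp only [h2, real_inner_self_eq_norm_sq] at h
  have hd : (0 : ℝ) < Module.finrank ℝ E := by exact_mod_cast Module.finrank_pos
  rw [← h, mul_div_cancel_left₀ _ hd.ne', ofReal_integral_eq_lintegral_ofReal]
  · refine Integrable.of_bound (C := ‖v‖ ^ 2)
      (Continuous.aestronglyMeasurable (by fun_prop)) ?_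
    filter_upwards [ae_norm_eq_one_sphereUnif μ] with D hD
    rw [Real.norm_eq_abs, abs_of_nonneg (sq_nonneg _), ← sq_abs]
    have := abs_real_inner_le_norm v D
    rw [hD, mul_one] at this
    gcongr
  · exact Eventually.of_forall fun D => sq_nonneg _

/-- Averaging a function of a pair over all rotations does not change its integral. -/
theorem lintegral_rotation_average {H : E × E → ℝ≥0∞} (hH : Measurable H) :
    ∫⁻ p, (∫⁻ t in Ioc 0 (2 * π), H (cos t • p.1 + sin t • p.2, -sin t • p.1 + cos t • p.2))
      ∂(μ.prod μ) = ENNReal.ofReal (2 * π) * ∫⁻ p, H p ∂(μ.prod μ) := by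
  have hRm : Measurable fun q : (E × E) × ℝ =>
      (cos q.2 • q.1.1 + sin q.2 • q.1.2, -sin q.2 • q.1.1 + cos q.2 • q.1.2) :=
    Continuous.measurable (by fun_prop)
  rw [lintegral_lintegral_swap
    (f := fun (p : E × E) (t : ℝ) => H (cos t • p.1 + sin t • p.2, -sin t • p.1 + cos t • p.2))
    (hH.comp hRm).aemeasurable]
  have h2 : ∀ t : ℝ, ∫⁻ p, H (cos t • p.1 + sin t • p.2, -sin t • p.1 + cos t • p.2) ∂(μ.prod μ) =
      ∫⁻ p, H p ∂(μ.prod μ) := fun t =>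
    (measurePreserving_rotation μ (c := cos t) (s := sin t)
      (by rw [add_comm]; exact sin_sq_add_cos_sq t)).lintegral_comp hH
  simp only [h2, lintegral_const]
  rw [Measure.restrict_apply_univ, Real.volume_Ioc, sub_zero, mul_comm]

set_option maxHeartbeats 1000000 in
/-- **Spherical Poincaré inequality for odd functions**: if `h` is odd and its gradient on the unit
sphere of `ℝᵈ` is at most `L`, then `(d - 1) E h² ≤ L²`. Wirtinger's inequality is applied to the
homogeneous extension of `h` along the ellipses `cos t x + sin t y`, for `(x, y)` uniform in the
unit ball of `E × E`, whose law is invariant under the rotations `t`. -/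
theorem sphere_poincare_odd (hd : 2 ≤ Module.finrank ℝ E) {h : E → ℝ} (hm : Measurable h)
    {U : Set E} (hU : IsOpen U) (hsU : sphere (0 : E) 1 ⊆ U) (hh : ContDiffOn ℝ 1 h U)
    (hodd : ∀ D, h (-D) = -h D) {L : ℝ} (hL : ∀ D : E, ‖D‖ = 1 → ‖gradient h D‖ ≤ L) :
    (Module.finrank ℝ E - 1 : ℝ) * ∫ D, h D ^ 2 ∂(sphereUnif μ) ≤ L ^ 2 := by
  have hnt : Nontrivial E := Module.nontrivial_of_finrank_pos (R := ℝ) (by omega)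
  have hprob := isProbabilityMeasure_sphereUnif μ
  set d := Module.finrank ℝ E with hdd
  have hd0 : (0 : ℝ) < d := by exact_mod_cast (by omega : 0 < d)
  -- the unit ball of `E × E`, as a weight depending on the two norms
  set w : ℝ → ℝ → ℝ≥0∞ := fun a b => if a ^ 2 + b ^ 2 < 1 then 1 else 0 with hw
  have hwm : Measurable fun p : ℝ × ℝ => w p.1 p.2 :=
    Measurable.ite (measurableSet_lt (by fun_prop) measurable_const) measurable_const
      measurable_const
  have hwm2 : Measurable fun p : E × E => w ‖p.1‖ ‖p.2‖ :=
    hwm.comp (f := fun p : E × E => (‖p.1‖, ‖p.2‖)) (by fun_prop)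
  set A : E × E → ℝ≥0∞ := fun p => ENNReal.ofReal ((‖p.1‖ * h (‖p.1‖⁻¹ • p.1)) ^ 2) with hA
  set B : E × E → ℝ≥0∞ := fun p => ENNReal.ofReal (inner ℝ (homExtGradient h p.1) p.2 ^ 2) with hB
  have hAm : Measurable A := by
    have hdir : Measurable fun p : E × E => ‖p.1‖⁻¹ • p.1 := by fun_prop
    exact ((measurable_fst.norm.mul (hm.comp hdir)).pow_const 2).ennreal_ofReal
  have hBm : Measurable B :=
    ((((measurable_homExtGradient hm).comp measurable_fst).inner measurable_snd).pow_const
      2).ennreal_ofReal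
  set R : ℝ → E × E → E × E := fun t p =>
    (cos t • p.1 + sin t • p.2, -sin t • p.1 + cos t • p.2) with hR
  have hwR : ∀ t p, w ‖(R t p).1‖ ‖(R t p).2‖ = w ‖p.1‖ ‖p.2‖ := by
    intro t p
    have : ‖(R t p).1‖ ^ 2 + ‖(R t p).2‖ ^ 2 = ‖p.1‖ ^ 2 + ‖p.2‖ ^ 2 := by
      simp only [hR, norm_add_sq_real, norm_smul, norm_neg, inner_smul_left, inner_smul_right,
        mul_pow, Real.norm_eq_abs, sq_abs, conj_trivial]
      linear_combination (‖p.1‖ ^ 2 + ‖p.2‖ ^ 2) * sin_sq_add_cos_sq t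
    simp only [hw, this]
  -- averaging a function of the rotated pair over all rotations
  have havg : ∀ G : E × E → ℝ≥0∞, Measurable G →
      ∫⁻ p, w ‖p.1‖ ‖p.2‖ * (∫⁻ t in Ioc 0 (2 * π), G (R t p)) ∂(μ.prod μ) =
        ENNReal.ofReal (2 * π) * ∫⁻ p, w ‖p.1‖ ‖p.2‖ * G p ∂(μ.prod μ) := by
    intro G hG
    rw [← lintegral_rotation_average μ (H := fun p => w ‖p.1‖ ‖p.2‖ * G p) (hwm2.mul hG)]
    refine lintegral_congr fun p => ?_
    rw [← lintegral_const_mul]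
    · refine lintegral_congr fun t => ?_
      have := hwR t p
      simp only [hR] at this
      rw [this]
    · exact hG.comp (by fun_prop)
  have hAB : ∫⁻ p, w ‖p.1‖ ‖p.2‖ * A p ∂(μ.prod μ) ≤
      ∫⁻ p, w ‖p.1‖ ‖p.2‖ * B p ∂(μ.prod μ) := by
    have h1 : ∫⁻ p, w ‖p.1‖ ‖p.2‖ * (∫⁻ t in Ioc 0 (2 * π), A (R t p)) ∂(μ.prod μ) ≤
        ∫⁻ p, w ‖p.1‖ ‖p.2‖ * (∫⁻ t in Ioc 0 (2 * π), B (R t p)) ∂(μ.prod μ) := by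
      refine lintegral_mono_ae ?_
      filter_upwards [ae_prod_inner_sq_ne μ hd] with p hp
      exact mul_le_mul_right (integral_homExt_ellipse_le hU hsU hh hodd hp) _
    rw [havg A hAm, havg B hBm] at h1
    have hpi : ENNReal.ofReal (2 * π) ≠ 0 := by
      rw [Ne, ENNReal.ofReal_eq_zero, not_le]; positivity
    exact (ENNReal.mul_le_mul_iff_right hpi ENNReal.ofReal_ne_top).1 h1
  -- the second moment of either component
  set C : ℝ≥0∞ := ∫⁻ x, ∫⁻ y, w ‖x‖ ‖y‖ * ENNReal.ofReal (‖x‖ ^ 2) ∂μ ∂μ with hC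
  have hCm : Measurable fun p : E × E => w ‖p.1‖ ‖p.2‖ * ENNReal.ofReal (‖p.1‖ ^ 2) :=
    hwm2.mul ((measurable_fst.norm.pow_const 2).ennreal_ofReal)
  have hCm2 : Measurable fun p : E × E => w ‖p.1‖ ‖p.2‖ * ENNReal.ofReal (‖p.2‖ ^ 2) :=
    hwm2.mul ((measurable_snd.norm.pow_const 2).ennreal_ofReal)
  have hCswap : C = ∫⁻ x, ∫⁻ y, w ‖x‖ ‖y‖ * ENNReal.ofReal (‖y‖ ^ 2) ∂μ ∂μ := by
    rw [hC, lintegral_lintegral_swap hCm.aemeasurable]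
    refine lintegral_congr fun x => lintegral_congr fun y => ?_
    simp only [hw, add_comm]
  have hC0 : C ≠ 0 := by
    rw [hC, ← lintegral_prod _ hCm.aemeasurable, Ne, lintegral_eq_zero_iff hCm]
    intro h0
    have hopen : IsOpen {p : E × E | ‖p.1‖ ^ 2 + ‖p.2‖ ^ 2 < 1 ∧ p.1 ≠ 0} :=
      (isOpen_lt (by fun_prop : Continuous fun p : E × E => ‖p.1‖ ^ 2 + ‖p.2‖ ^ 2)
        continuous_const).and (isOpen_ne_fun continuous_fst continuous_const)
    obtain ⟨e, he⟩ := exists_norm_eq E (c := 1 / 2) (by norm_num)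
    have hne : {p : E × E | ‖p.1‖ ^ 2 + ‖p.2‖ ^ 2 < 1 ∧ p.1 ≠ 0}.Nonempty :=
      ⟨(e, 0), by simp only [he, norm_zero]; norm_num, by
        rw [← norm_ne_zero_iff]; simp [he]⟩
    have hpos := hopen.measure_pos (μ.prod μ) hne
    refine hpos.ne' (measure_mono_null (fun p hp => ?_) (ae_iff.1 h0))
    simp only [mem_ofPred_eq, Pi.zero_apply, mul_eq_zero, not_or, hw, hp.1, if_true]
    refine ⟨one_ne_zero, ?_⟩
    have : 0 < ‖p.1‖ := norm_pos_iff.2 hp.2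
    rw [ENNReal.ofReal_eq_zero, not_le]
    positivity
  have hCtop : C ≠ ⊤ := by
    have hle : C ≤ ∫⁻ x, ∫⁻ y, (closedBall (0 : E) 1).indicator 1 x *
        (closedBall (0 : E) 1).indicator 1 y ∂μ ∂μ := by
      refine lintegral_mono fun x => lintegral_mono fun y => ?_
      simp only [hw]
      split_ifs with hxy
      · have hx : ‖x‖ ^ 2 ≤ 1 := by nlinarith [sq_nonneg ‖y‖]
        have hy : ‖y‖ ^ 2 ≤ 1 := by nlinarith [sq_nonneg ‖x‖]
        have hx1 : ‖x‖ ≤ 1 := (sq_le_one_iff₀ (norm_nonneg x)).1 hx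
        have hy1 : ‖y‖ ≤ 1 := (sq_le_one_iff₀ (norm_nonneg y)).1 hy
        rw [indicator_of_mem (by simpa using hx1), indicator_of_mem (by simpa using hy1)]
        simp only [Pi.one_apply, one_mul]
        exact ENNReal.ofReal_le_one.2 hx
      · simp
    refine (hle.trans_lt ?_).ne
    have hi : ∫⁻ y, (closedBall (0 : E) 1).indicator (1 : E → ℝ≥0∞) y ∂μ = μ (closedBall 0 1) :=
      lintegral_indicator_one measurableSet_closedBall
    have hmi : Measurable ((closedBall (0 : E) 1).indicator (1 : E → ℝ≥0∞)) :=
      measurable_one.indicator measurableSet_closedBall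
    simp only [lintegral_const_mul _ hmi, hi]
    rw [lintegral_mul_const _ hmi, hi]
    exact ENNReal.mul_lt_top measure_closedBall_lt_top measure_closedBall_lt_top
  have hhb : ∃ M, ∀ D ∈ sphere (0 : E) 1, ‖h D‖ ≤ M :=
    (isCompact_sphere (0 : E) 1).exists_bound_of_continuousOn (hh.continuousOn.mono hsU)
  obtain ⟨M, hM⟩ := hhb
  have hint : Integrable (fun D => h D ^ 2) (sphereUnif μ) := by
    refine Integrable.of_bound (C := M ^ 2) (hm.pow_const 2).aestronglyMeasurable ?_
    filter_upwards [ae_norm_eq_one_sphereUnif μ] with D hD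
    rw [norm_pow]
    have := hM D (by simpa using hD)
    gcongr
  set I : ℝ := ∫ D, h D ^ 2 ∂(sphereUnif μ) with hI
  have hI0 : 0 ≤ I := integral_nonneg fun D => sq_nonneg _
  have hsq : ∫⁻ D, ENNReal.ofReal (h D ^ 2) ∂(sphereUnif μ) = ENNReal.ofReal I :=
    (ofReal_integral_eq_lintegral_ofReal hint (Eventually.of_forall fun D => sq_nonneg _)).symm
  have hsq2 : ∫⁻ D, ENNReal.ofReal ((h D ^ 2 + L ^ 2) / d) ∂(sphereUnif μ) =
      ENNReal.ofReal ((I + L ^ 2) / d) := by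
    have hi : Integrable (fun D => (h D ^ 2 + L ^ 2) / (d : ℝ)) (sphereUnif μ) :=
      (hint.add (integrable_const _)).div_const _
    rw [← ofReal_integral_eq_lintegral_ofReal hi
      (Eventually.of_forall fun D => by positivity), integral_div,
      integral_add hint (integrable_const _), integral_const, probReal_univ, one_smul]
  have hkm : ∀ g : ℝ × ℝ → ℝ≥0∞, Measurable g →
      Measurable fun a : ℝ => ∫⁻ y : E, g (a, ‖y‖) ∂μ := fun g hg =>
    Measurable.lintegral_prod_right' (f := fun q : ℝ × E => g (q.1, ‖q.2‖))
      (hg.comp (by fun_prop))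
  have hAeq : ∫⁻ p, w ‖p.1‖ ‖p.2‖ * A p ∂(μ.prod μ) = C * ENNReal.ofReal I := by
    rw [lintegral_prod (fun p : E × E => w ‖p.1‖ ‖p.2‖ * A p) (hwm2.mul hAm).aemeasurable]
    have h1 : ∀ x : E, ∫⁻ y, w ‖x‖ ‖y‖ * A (x, y) ∂μ =
        (∫⁻ y, w ‖x‖ ‖y‖ * ENNReal.ofReal (‖x‖ ^ 2) ∂μ) *
          ENNReal.ofReal (h (‖x‖⁻¹ • x) ^ 2) := by
      intro x
      rw [← lintegral_mul_const]
      · refine lintegral_congr fun y => ?_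
        simp only [hA]
        rw [mul_pow, ENNReal.ofReal_mul (sq_nonneg _), mul_assoc]
      · exact hCm.comp (measurable_const.prodMk measurable_id)
    simp only [h1]
    rw [← hsq, hC]
    exact lintegral_norm_mul_direction μ
      (k := fun a => ∫⁻ y, w a ‖y‖ * ENNReal.ofReal (a ^ 2) ∂μ)
      (hkm (fun q => w q.1 q.2 * ENNReal.ofReal (q.1 ^ 2))
        (hwm.mul ((measurable_fst.pow_const 2).ennreal_ofReal)))
      ((hm.pow_const 2).ennreal_ofReal)
  have hBle : ∫⁻ p, w ‖p.1‖ ‖p.2‖ * B p ∂(μ.prod μ) ≤ C * ENNReal.ofReal ((I + L ^ 2) / d) := by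
    rw [lintegral_prod (fun p : E × E => w ‖p.1‖ ‖p.2‖ * B p) (hwm2.mul hBm).aemeasurable]
    have hx0 : ∀ᵐ x ∂μ, x ≠ 0 := by
      rw [ae_iff]
      simp
    have h1 : ∀ᵐ x ∂μ, ∫⁻ y, w ‖x‖ ‖y‖ * B (x, y) ∂μ ≤
        (∫⁻ y, w ‖x‖ ‖y‖ * ENNReal.ofReal (‖y‖ ^ 2) ∂μ) *
          ENNReal.ofReal ((h (‖x‖⁻¹ • x) ^ 2 + L ^ 2) / d) := by
      filter_upwards [hx0] with x hx
      have h2 : ∀ y : E, w ‖x‖ ‖y‖ * B (x, y) = w ‖x‖ ‖y‖ * ENNReal.ofReal (‖y‖ ^ 2) *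
          ENNReal.ofReal (inner ℝ (homExtGradient h x) (‖y‖⁻¹ • y) ^ 2) := by
        intro y
        rw [mul_assoc]
        congr 1
        simp only [hB]
        rcases eq_or_ne y 0 with rfl | hy
        · simp
        · rw [← ENNReal.ofReal_mul (sq_nonneg _)]
          congr 1
          have : ‖y‖ ≠ 0 := norm_ne_zero_iff.2 hy
          rw [inner_smul_right]
          field_simp
      simp only [h2]
      have h3 := lintegral_norm_mul_direction μ
        (k := fun b => w ‖x‖ b * ENNReal.ofReal (b ^ 2))
        (u := fun D => ENNReal.ofReal (inner ℝ (homExtGradient h x) D ^ 2))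
        ((hwm.comp (measurable_const.prodMk measurable_id)).mul
          ((measurable_id.pow_const 2).ennreal_ofReal))
        (((measurable_const.inner measurable_id).pow_const 2).ennreal_ofReal)
      rw [h3, lintegral_inner_sq_sphereUnif]
      gcongr
      exact norm_homExtGradient_sq_le hx (hL _ (norm_direction hx))
    refine (lintegral_mono_ae h1).trans_eq ?_
    rw [hCswap, ← hsq2]
    exact lintegral_norm_mul_direction μ
      (k := fun a => ∫⁻ y, w a ‖y‖ * ENNReal.ofReal (‖y‖ ^ 2) ∂μ)
      (u := fun D => ENNReal.ofReal ((h D ^ 2 + L ^ 2) / d))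
      (hkm (fun q => w q.1 q.2 * ENNReal.ofReal (q.2 ^ 2))
        (hwm.mul ((measurable_snd.pow_const 2).ennreal_ofReal)))
      ((((hm.pow_const 2).add_const _).div_const _).ennreal_ofReal)
  rw [hAeq] at hAB
  have hfin := (ENNReal.mul_le_mul_iff_right hC0 hCtop).1 (hAB.trans hBle)
  rw [ENNReal.ofReal_le_ofReal_iff (by positivity), le_div_iff₀ hd0] at hfin
  linarith

/-- Second moment of a symmetric difference on the sphere of `ℝᵈ`: up to the factor `2` it is at
most what it would be for the linear function `D ↦ L ⟨D, e⟩`. -/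
theorem integral_sq_symmetric_difference_le [Nontrivial E] {f : E → ℝ} (hm : Measurable f)
    {U : Set E} (hU : IsOpen U) (hsU : sphere (0 : E) 1 ⊆ U) (hf : ContDiffOn ℝ 1 f U) {L : ℝ}
    (hL : ∀ D : E, ‖D‖ = 1 → ‖gradient f D‖ ≤ L)
    (hL2 : ∀ D : E, ‖D‖ = 1 → |f D - f (-D)| ≤ 2 * L) :
    (Module.finrank ℝ E : ℝ) ^ 2 * ∫ D, (f D - f (-D)) ^ 2 ∂(sphereUnif μ) ≤
      8 * Module.finrank ℝ E * L ^ 2 := by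
  have hprob := isProbabilityMeasure_sphereUnif μ
  have hd1 : 1 ≤ Module.finrank ℝ E := Module.finrank_pos
  rcases hd1.eq_or_lt with h1 | h2
  · rw [← h1]
    have hb : ∫ D, (f D - f (-D)) ^ 2 ∂(sphereUnif μ) ≤ 4 * L ^ 2 := by
      have h3 := norm_integral_le_of_norm_le_const (μ := sphereUnif μ)
        (f := fun D => (f D - f (-D)) ^ 2) (C := 4 * L ^ 2) (by
          filter_upwards [ae_norm_eq_one_sphereUnif μ] with D hD
          rw [norm_pow, Real.norm_eq_abs]
          have h4 := hL2 D hD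
          calc |f D - f (-D)| ^ 2 ≤ (2 * L) ^ 2 := by gcongr
            _ = 4 * L ^ 2 := by ring)
      rw [probReal_univ, mul_one] at h3
      exact (le_abs_self _).trans h3
    push_cast
    nlinarith [sq_nonneg L]
  · have hneg : ContDiffOn ℝ 1 (fun D => f (-D)) (-U) :=
      hf.comp contDiff_neg.contDiffOn fun x hx => hx
    have hsU' : sphere (0 : E) 1 ⊆ -U := fun D hD => hsU (by simpa using hD)
    have hh : ContDiffOn ℝ 1 (fun D => (f D - f (-D)) / 2) (U ∩ -U) :=
      ((hf.mono inter_subset_left).sub (hneg.mono inter_subset_right)).div_const 2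
    have hgr : ∀ D : E, ‖D‖ = 1 → ‖gradient (fun D => (f D - f (-D)) / 2) D‖ ≤ L := by
      intro D hD
      have hDU : D ∈ U := hsU (by simpa using hD)
      have hDU' : -D ∈ U := hsU (by simpa using hD)
      have d1 := ((hf.contDiffAt (hU.mem_nhds hDU)).differentiableAt one_ne_zero).hasFDerivAt
      have d2 := ((hf.contDiffAt (hU.mem_nhds hDU')).differentiableAt one_ne_zero).hasFDerivAt
      have d3 := ((d1.sub (d2.comp D (hasFDerivAt_id D).neg)).const_mul (1 / 2)).fderiv
      have e : (fun D => (f D - f (-D)) / 2) = fun D => 1 / 2 * (f D - f (-D)) := by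
        ext; ring
      have n1 := hL D hD
      have n2 := hL (-D) (by rwa [norm_neg])
      rw [gradient, LinearIsometryEquiv.norm_map] at n1 n2 ⊢
      rw [e]
      refine (congrArg norm d3).trans_le ?_
      rw [norm_smul]
      have n3 : ‖(fderiv ℝ f (-D)).comp (-ContinuousLinearMap.id ℝ E)‖ ≤ L := by
        rw [ContinuousLinearMap.comp_neg, ContinuousLinearMap.comp_id, norm_neg]
        exact n2
      have n4 := norm_sub_le (fderiv ℝ f D) ((fderiv ℝ f (-D)).comp (-ContinuousLinearMap.id ℝ E))
      rw [Real.norm_of_nonneg (by norm_num)]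
      have n5 : ‖fderiv ℝ f D - (fderiv ℝ f (-D)).comp (-ContinuousLinearMap.id ℝ E)‖ ≤
          2 * L := by linarith
      calc _ ≤ 1 / 2 * (2 * L) := by gcongr
        _ = L := by ring
    have hP := sphere_poincare_odd μ h2 (h := fun D => (f D - f (-D)) / 2)
      ((hm.sub (hm.comp measurable_neg)).div_const 2)
      (hU.inter hU.neg) (subset_inter hsU hsU') hh (fun D => by simp; ring) hgr
    have e : ∫ D, ((f D - f (-D)) / 2) ^ 2 ∂(sphereUnif μ) =
        (∫ D, (f D - f (-D)) ^ 2 ∂(sphereUnif μ)) / 4 := by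
      rw [← integral_div]
      refine integral_congr_ae (Eventually.of_forall fun D => ?_)
      ring
    rw [e] at hP
    set I := ∫ D, (f D - f (-D)) ^ 2 ∂(sphereUnif μ)
    have hI : 0 ≤ I := integral_nonneg fun D => sq_nonneg _
    have hd2 : (2 : ℝ) ≤ Module.finrank ℝ E := by exact_mod_cast h2
    set d : ℝ := (Module.finrank ℝ E : ℝ)
    -- `d² I ≤ 2 d (d - 1) I` for `d ≥ 2`
    nlinarith [mul_nonneg (mul_nonneg (by linarith : 0 ≤ d) hI) (by linarith : 0 ≤ d - 2)]

end Poincare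

/-! ### Schur stability and Lyapunov equations -/

section Stein

open Filter Topology

variable {R : Type*} [NormedRing R] [NormedAlgebra ℝ R]

/-- The solution `x` of the equation `x = a x b + c` in a Banach algebra, when the operator
`x ↦ x - a x b` is invertible. -/
noncomputable def stein (a b c : R) : R :=
  Ring.inverse (1 - ContinuousLinearMap.mulLeftRight ℝ R a b) c

theorem mulLeftRight_pow (a b : R) (k : ℕ) :
    ContinuousLinearMap.mulLeftRight ℝ R a b ^ k =
      ContinuousLinearMap.mulLeftRight ℝ R (a ^ k) (b ^ k) := by
  induction k with
  | zero => ext x; simp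
  | succ k ih =>
    ext x
    rw [pow_succ', mul_apply_eq_comp, ih]
    simp only [ContinuousLinearMap.mulLeftRight_apply]
    rw [pow_succ' a, pow_succ b]
    noncomm_ring

theorem isUnit_stein_of_tendsto [CompleteSpace R] {a b : R}
    (h : Tendsto (fun k : ℕ => ‖a ^ k‖ * ‖b ^ k‖) atTop (𝓝 0)) :
    IsUnit (1 - ContinuousLinearMap.mulLeftRight ℝ R a b) := by
  obtain ⟨k, hk⟩ := (h.eventually_lt_const one_pos).exists
  set T := ContinuousLinearMap.mulLeftRight ℝ R a b
  have h4 : ‖T ^ k‖ < 1 := by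
    refine lt_of_le_of_lt ?_ hk
    rw [mulLeftRight_pow]
    exact ContinuousLinearMap.opNorm_mulLeftRight_apply_apply_le ℝ _ _ _
  have h6 : IsUnit ((1 - T) * ∑ i ∈ Finset.range k, T ^ i) := by
    rw [mul_neg_geom_sum]
    exact isUnit_one_sub_of_norm_lt_one h4
  have hcomm : Commute (1 - T) (∑ i ∈ Finset.range k, T ^ i) :=
    Commute.sum_right _ _ _ fun i _ =>
      ((Commute.one_left _).sub_left (Commute.refl _)).pow_right i
  exact (hcomm.isUnit_mul_iff.1 h6).1

theorem stein_spec {a b : R} (h : IsUnit (1 - ContinuousLinearMap.mulLeftRight ℝ R a b)) (c : R) :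
    stein a b c = a * stein a b c * b + c := by
  have h2 := congrArg (fun T => T c) (Ring.mul_inverse_cancel _ h)
  simp only [mul_apply_eq_comp, one_apply_eq_self, sub_apply,
    ContinuousLinearMap.mulLeftRight_apply] at h2
  change stein a b c - a * stein a b c * b = c at h2
  rw [← sub_eq_iff_eq_add', h2]

theorem eq_stein {a b : R} (h : IsUnit (1 - ContinuousLinearMap.mulLeftRight ℝ R a b)) {x c : R}
    (hx : x = a * x * b + c) : x = stein a b c := by
  have h2 := congrArg (fun T => T x) (Ring.inverse_mul_cancel _ h)
  simp only [mul_apply_eq_comp, one_apply_eq_self, sub_apply,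
    ContinuousLinearMap.mulLeftRight_apply] at h2
  have h3 : x - a * x * b = c := by rw [sub_eq_iff_eq_add', ← hx]
  rw [h3] at h2
  exact h2.symm

theorem contDiffAt_stein [CompleteSpace R] {V : Type*} [NormedAddCommGroup V] [NormedSpace ℝ V]
    {k : WithTop ℕ∞} {f g e : V → R} {v : V} (hf : ContDiffAt ℝ k f v) (hg : ContDiffAt ℝ k g v)
    (he : ContDiffAt ℝ k e v)
    (h : IsUnit (1 - ContinuousLinearMap.mulLeftRight ℝ R (f v) (g v))) :
    ContDiffAt ℝ k (fun w => stein (f w) (g w) (e w)) v := by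
  obtain ⟨u, hu⟩ := h
  have h1 : ContDiffAt ℝ k
      (fun w => 1 - ContinuousLinearMap.mulLeftRight ℝ R (f w) (g w)) v := by
    have h0 : ContDiff ℝ k (fun y : R => ContinuousLinearMap.mulLeftRight ℝ R y) :=
      ContinuousLinearMap.contDiff (𝕜 := ℝ) (E := R) (F := R →L[ℝ] R →L[ℝ] R)
        (ContinuousLinearMap.mulLeftRight ℝ R)
    have h2 : ContDiffAt ℝ k (fun w => ContinuousLinearMap.mulLeftRight ℝ R (f w)) v :=
      h0.contDiffAt.comp v hf
    exact contDiffAt_const.sub (h2.clm_apply hg)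
  have h3 := contDiffAt_ringInverse ℝ (n := k) u
  rw [hu] at h3
  exact (h3.comp v h1).clm_apply he

end Stein

section Schur

open Filter Topology
open scoped Matrix.Norms.Operator

variable {n : ℕ}

theorem norm_map_ofReal (M : Matrix (Fin n) (Fin n) ℝ) :
    ‖M.map (algebraMap ℝ ℂ)‖ = ‖M‖ := by
  simp [Matrix.linfty_opNorm_def]

theorem map_ofReal_pow (M : Matrix (Fin n) (Fin n) ℝ) (k : ℕ) :
    M.map (algebraMap ℝ ℂ) ^ k = (M ^ k).map (algebraMap ℝ ℂ) :=
  (map_pow (algebraMap ℝ ℂ).mapMatrix M k).symm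

theorem schurStable_of_norm_pow_lt_one {M : Matrix (Fin n) (Fin n) ℝ} {k : ℕ}
    (h : ‖M ^ (k + 1)‖ < 1) : SchurStable M := by
  have h1 := spectrum.spectralRadius_le_pow_nnnorm_pow_one_div ℂ (M.map (algebraMap ℝ ℂ)) k
  refine lt_of_le_of_lt h1 ?_
  have hk : (0 : ℝ) < 1 / (k + 1) := by positivity
  have h2 : (‖M.map (algebraMap ℝ ℂ) ^ (k + 1)‖₊ : ℝ≥0∞) ^ (1 / (k + 1) : ℝ) < 1 := by
    refine ENNReal.rpow_lt_one ?_ hk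
    rw [map_ofReal_pow]
    have : ‖(M ^ (k + 1)).map (algebraMap ℝ ℂ)‖₊ < 1 := by
      rw [← NNReal.coe_lt_coe, coe_nnnorm, norm_map_ofReal]
      exact h
    exact_mod_cast this
  have h3 : (‖(1 : Matrix (Fin n) (Fin n) ℂ)‖₊ : ℝ≥0∞) ^ (1 / (k + 1) : ℝ) ≤ 1 := by
    refine ENNReal.rpow_le_one ?_ hk.le
    rcases Nat.eq_zero_or_pos n with rfl | hn
    · have : (1 : Matrix (Fin 0) (Fin 0) ℂ) = 0 := Subsingleton.elim _ _
      rw [this]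
      simp
    · have : Nonempty (Fin n) := ⟨⟨0, hn⟩⟩
      simp
  exact (mul_le_of_le_one_right' h3).trans_lt h2

theorem SchurStable.eventually_norm_pow_le {M : Matrix (Fin n) (Fin n) ℝ} (h : SchurStable M) :
    ∃ q : ℝ, 0 < q ∧ q < 1 ∧ ∀ᶠ k : ℕ in atTop, ‖M ^ k‖ ≤ q ^ k := by
  obtain ⟨q, hq1, hq2⟩ := ENNReal.lt_iff_exists_nnreal_btwn.1 h
  have hq0 : 0 < (q : ℝ) := by
    have : (0 : ℝ≥0∞) < q := pos_of_gt hq1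
    exact_mod_cast this
  refine ⟨q, hq0, by exact_mod_cast hq2, ?_⟩
  have hg := spectrum.pow_nnnorm_pow_one_div_tendsto_nhds_spectralRadius (M.map (algebraMap ℝ ℂ))
  filter_upwards [hg.eventually_lt_const hq1, eventually_ge_atTop 1] with k hk hk1
  have hk0 : (0 : ℝ) < k := by exact_mod_cast hk1
  rw [one_div] at hk
  have h2 : (‖M.map (algebraMap ℝ ℂ) ^ k‖₊ : ℝ≥0∞) ≤ (q : ℝ≥0∞) ^ (k : ℝ) :=
    (ENNReal.rpow_inv_le_iff hk0).1 hk.le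
  rw [ENNReal.rpow_natCast] at h2
  have h3 : ‖M.map (algebraMap ℝ ℂ) ^ k‖₊ ≤ q ^ k := by exact_mod_cast h2
  rw [map_ofReal_pow] at h3
  have h4 : ‖(M ^ k).map (algebraMap ℝ ℂ)‖ ≤ (q : ℝ) ^ k := by exact_mod_cast h3
  rwa [norm_map_ofReal] at h4

theorem SchurStable.summable_norm_pow {M : Matrix (Fin n) (Fin n) ℝ} (h : SchurStable M) :
    Summable fun k : ℕ => ‖M ^ k‖ := by
  obtain ⟨q, hq0, hq1, hq⟩ := h.eventually_norm_pow_le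
  refine Summable.of_norm_bounded_eventually (summable_geometric_of_lt_one hq0.le hq1) ?_
  rw [Nat.cofinite_eq_atTop]
  filter_upwards [hq] with k hk
  rwa [norm_norm]

theorem SchurStable.tendsto_pow {M : Matrix (Fin n) (Fin n) ℝ} (h : SchurStable M) :
    Tendsto (fun k : ℕ => M ^ k) atTop (𝓝 0) :=
  tendsto_zero_iff_norm_tendsto_zero.2 h.summable_norm_pow.tendsto_atTop_zero

theorem schurStable_of_tendsto_pow {M : Matrix (Fin n) (Fin n) ℝ}
    (h : Tendsto (fun k : ℕ => M ^ k) atTop (𝓝 0)) : SchurStable M := by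
  have h1 := (tendsto_zero_iff_norm_tendsto_zero.1 h).eventually_lt_const one_pos
  obtain ⟨k, hk1, hk⟩ := (h1.and (eventually_ge_atTop 1)).exists
  obtain ⟨j, rfl⟩ : ∃ j, k = j + 1 := ⟨k - 1, by omega⟩
  exact schurStable_of_norm_pow_lt_one hk1

theorem SchurStable.transpose {M : Matrix (Fin n) (Fin n) ℝ} (h : SchurStable M) :
    SchurStable Mᵀ := by
  refine schurStable_of_tendsto_pow ?_
  have h1 : Tendsto (fun k : ℕ => (M ^ k)ᵀ) atTop (𝓝 (0 : Matrix (Fin n) (Fin n) ℝ)ᵀ) :=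
    (Continuous.matrix_transpose continuous_id).continuousAt.tendsto.comp h.tendsto_pow
  simpa [Matrix.transpose_pow] using h1

theorem isOpen_schurStable : IsOpen {M : Matrix (Fin n) (Fin n) ℝ | SchurStable M} := by
  have : {M : Matrix (Fin n) (Fin n) ℝ | SchurStable M} = ⋃ k : ℕ, {M | ‖M ^ (k + 1)‖ < 1} := by
    ext M
    simp only [Set.mem_ofPred_eq, Set.mem_iUnion]
    refine ⟨fun h => ?_, fun ⟨k, hk⟩ => schurStable_of_norm_pow_lt_one hk⟩
    have h1 := (tendsto_zero_iff_norm_tendsto_zero.1 h.tendsto_pow).eventually_lt_const one_pos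
    obtain ⟨k, hk1, hk⟩ := (h1.and (eventually_ge_atTop 1)).exists
    exact ⟨k - 1, by rwa [Nat.sub_add_cancel hk]⟩
  rw [this]
  exact isOpen_iUnion fun k => isOpen_lt (by fun_prop) continuous_const

theorem tendsto_zero_of_le_mul_add {a b : ℕ → ℝ} {q : ℝ} (ha : ∀ t, 0 ≤ a t) (hq0 : 0 ≤ q)
    (hq1 : q < 1) (hab : ∀ t, a (t + 1) ≤ q * a t + b t) (hb : Tendsto b atTop (𝓝 0)) :
    Tendsto a atTop (𝓝 0) := by
  refine Metric.tendsto_atTop.2 fun ε hε => ?_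
  have h1 : ∀ᶠ t in atTop, b t < (1 - q) * (ε / 2) :=
    hb.eventually_lt_const (mul_pos (by linarith) (by linarith))
  obtain ⟨T, hT⟩ := eventually_atTop.1 h1
  have h2 : ∀ k, a (T + k) ≤ q ^ k * a T + ε / 2 := by
    intro k
    induction k with
    | zero => simp; linarith
    | succ k ih =>
      have h3 := hab (T + k)
      have h4 := hT (T + k) (by omega)
      have h5 := mul_le_mul_of_nonneg_left ih hq0
      rw [← add_assoc, pow_succ]
      nlinarith
  have h6 : Tendsto (fun k : ℕ => q ^ k * a T) atTop (𝓝 0) := by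
    simpa using (tendsto_pow_atTop_nhds_zero_of_lt_one hq0 hq1).mul_const (a T)
  obtain ⟨N, hN⟩ := eventually_atTop.1 (h6.eventually_lt_const (half_pos hε))
  refine ⟨T + N, fun t ht => ?_⟩
  obtain ⟨k, rfl⟩ : ∃ k, t = T + k := ⟨t - T, by omega⟩
  rw [Real.dist_eq, sub_zero, abs_of_nonneg (ha _)]
  have := hN k (by omega)
  linarith [h2 k]

/-- A stable linear system driven by a vanishing input converges to the origin. -/
theorem SchurStable.tendsto_of_input {M : Matrix (Fin n) (Fin n) ℝ} (h : SchurStable M)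
    {x u : ℕ → Fin n → ℝ} (hx : ∀ t, x (t + 1) = M *ᵥ x t + u t)
    (hu : Tendsto u atTop (𝓝 0)) : Tendsto x atTop (𝓝 0) := by
  -- the adapted norm `Σ ‖Mᵏ y‖`, for which `M` is a strict contraction
  have hs := h.summable_norm_pow
  set S : ℝ := ∑' k : ℕ, ‖M ^ k‖ + 1 with hS
  have hS1 : 1 ≤ S := by
    have : 0 ≤ ∑' k : ℕ, ‖M ^ k‖ := tsum_nonneg fun k => norm_nonneg _
    linarith
  have hle : ∀ y : Fin n → ℝ, ∀ k, ‖(M ^ k) *ᵥ y‖ ≤ ‖M ^ k‖ * ‖y‖ := fun y k =>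
    Matrix.linfty_opNorm_mulVec _ _
  have hsum : ∀ y : Fin n → ℝ, Summable fun k : ℕ => ‖(M ^ k) *ᵥ y‖ := fun y =>
    Summable.of_nonneg_of_le (fun k => norm_nonneg _) (hle y) (hs.mul_right _)
  set N : (Fin n → ℝ) → ℝ := fun y => ∑' k : ℕ, ‖(M ^ k) *ᵥ y‖ with hN
  have hN0 : ∀ y, 0 ≤ N y := fun y => tsum_nonneg fun k => norm_nonneg _
  have hNS : ∀ y, N y ≤ S * ‖y‖ := by
    intro y
    have h1 : N y ≤ ∑' k : ℕ, ‖M ^ k‖ * ‖y‖ := (hsum y).tsum_le_tsum (hle y) (hs.mul_right _)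
    rw [tsum_mul_right] at h1
    have := norm_nonneg y
    nlinarith
  have hNlow : ∀ y, ‖y‖ ≤ N y := fun y => by
    have := (hsum y).le_tsum 0 fun k _ => norm_nonneg _
    simpa using this
  have hNM : ∀ y, N (M *ᵥ y) = N y - ‖y‖ := fun y => by
    have h1 := (hsum y).tsum_eq_zero_add
    simp only [pow_zero, Matrix.one_mulVec] at h1
    simp only [hN, Matrix.mulVec_mulVec, ← pow_succ]
    linarith
  have hadd : ∀ y z, N (y + z) ≤ N y + N z := fun y z => by
    rw [hN]
    simp only
    rw [← (hsum y).tsum_add (hsum z)]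
    refine (hsum (y + z)).tsum_le_tsum (fun k => ?_) ((hsum y).add (hsum z))
    rw [Matrix.mulVec_add]
    exact norm_add_le _ _
  have hNt : Tendsto (fun t => N (x t)) atTop (𝓝 0) := by
    refine tendsto_zero_of_le_mul_add (q := 1 - 1 / S) (b := fun t => S * ‖u t‖)
      (fun t => hN0 _) ?_ ?_ (fun t => ?_) ?_
    · rw [sub_nonneg, div_le_one (by linarith)]
      exact hS1
    · have : 0 < 1 / S := by positivity
      linarith
    · rw [hx]
      refine (hadd _ _).trans ?_
      rw [hNM]
      have h1 : N (x t) / S ≤ ‖x t‖ := by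
        rw [div_le_iff₀ (by linarith), mul_comm]
        exact hNS _
      have h2 := hNS (u t)
      have h3 : (1 - 1 / S) * N (x t) = N (x t) - N (x t) / S := by ring
      linarith
    · simpa using (tendsto_zero_iff_norm_tendsto_zero.1 hu).const_mul S
  exact squeeze_zero_norm (fun t => hNlow (x t)) hNt

/-- The solution `X` of the Lyapunov equation `X = Mᵀ X M + N`, for Schur stable `M`. -/
noncomputable def lyap (M N : Matrix (Fin n) (Fin n) ℝ) : Matrix (Fin n) (Fin n) ℝ :=
  stein Mᵀ M N

theorem SchurStable.isUnit_stein {M : Matrix (Fin n) (Fin n) ℝ} (h : SchurStable M) :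
    IsUnit (1 - ContinuousLinearMap.mulLeftRight ℝ (Matrix (Fin n) (Fin n) ℝ) Mᵀ M) := by
  refine isUnit_stein_of_tendsto ?_
  have h2 := tendsto_zero_iff_norm_tendsto_zero.1 h.transpose.tendsto_pow
  have h3 := tendsto_zero_iff_norm_tendsto_zero.1 h.tendsto_pow
  simpa using h2.mul h3

theorem lyap_spec {M : Matrix (Fin n) (Fin n) ℝ} (h : SchurStable M)
    (N : Matrix (Fin n) (Fin n) ℝ) : lyap M N = Mᵀ * lyap M N * M + N :=
  stein_spec h.isUnit_stein N

theorem eq_lyap {M : Matrix (Fin n) (Fin n) ℝ} (h : SchurStable M)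
    {X N : Matrix (Fin n) (Fin n) ℝ} (hX : X = Mᵀ * X * M + N) : X = lyap M N :=
  eq_stein h.isUnit_stein hX

theorem contDiffAt_lyap {V : Type*} [NormedAddCommGroup V] [NormedSpace ℝ V] {k : WithTop ℕ∞}
    {f g : V → Matrix (Fin n) (Fin n) ℝ} {v : V} (hf : ContDiffAt ℝ k f v)
    (hg : ContDiffAt ℝ k g v) (hM : SchurStable (f v)) :
    ContDiffAt ℝ k (fun w => lyap (f w) (g w)) v := by
  have hT : ContDiffAt ℝ k (fun w => (f w)ᵀ) v :=
    (LinearMap.toContinuousLinearMap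
      (Matrix.transposeLinearEquiv (Fin n) (Fin n) ℝ ℝ).toLinearMap).contDiff.contDiffAt.comp v hf
  exact contDiffAt_stein hT hf hg hM.isUnit_stein

/-- Unrolling the Lyapunov equation along a trajectory. -/
theorem dotProduct_lyap_unroll {M X N : Matrix (Fin n) (Fin n) ℝ} (hX : X = Mᵀ * X * M + N)
    (x : Fin n → ℝ) (t : ℕ) :
    x ⬝ᵥ X *ᵥ x = ((M ^ t) *ᵥ x) ⬝ᵥ X *ᵥ ((M ^ t) *ᵥ x) +
      ∑ s ∈ Finset.range t, ((M ^ s) *ᵥ x) ⬝ᵥ N *ᵥ ((M ^ s) *ᵥ x) := by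
  induction t with
  | zero => simp
  | succ t ih =>
    have h1 : ∀ y : Fin n → ℝ, y ⬝ᵥ X *ᵥ y = (M *ᵥ y) ⬝ᵥ X *ᵥ (M *ᵥ y) + y ⬝ᵥ N *ᵥ y := by
      intro y
      conv_lhs => rw [hX]
      rw [Matrix.add_mulVec, dotProduct_add, ← Matrix.mulVec_mulVec, ← Matrix.mulVec_mulVec,
        Matrix.dotProduct_mulVec y, Matrix.vecMul_transpose]
    rw [ih, Finset.sum_range_succ, h1 ((M ^ t) *ᵥ x), Matrix.mulVec_mulVec, ← pow_succ']
    ring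

theorem SchurStable.tendsto_quadratic {M : Matrix (Fin n) (Fin n) ℝ} (h : SchurStable M)
    (X : Matrix (Fin n) (Fin n) ℝ) (x : Fin n → ℝ) :
    Tendsto (fun t : ℕ => ((M ^ t) *ᵥ x) ⬝ᵥ X *ᵥ ((M ^ t) *ᵥ x)) atTop (𝓝 0) := by
  have h1 : Continuous fun T : Matrix (Fin n) (Fin n) ℝ => (T *ᵥ x) ⬝ᵥ X *ᵥ (T *ᵥ x) := by
    fun_prop
  have h2 := (h1.tendsto 0).comp h.tendsto_pow
  simpa [Function.comp_def] using h2

theorem hasSum_dotProduct_lyap {M : Matrix (Fin n) (Fin n) ℝ} (h : SchurStable M)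
    {N : Matrix (Fin n) (Fin n) ℝ} (hN : ∀ x, 0 ≤ x ⬝ᵥ N *ᵥ x) (x : Fin n → ℝ) :
    HasSum (fun t : ℕ => ((M ^ t) *ᵥ x) ⬝ᵥ N *ᵥ ((M ^ t) *ᵥ x)) (x ⬝ᵥ lyap M N *ᵥ x) := by
  rw [hasSum_iff_tendsto_nat_of_nonneg fun t => hN _]
  have h1 := h.tendsto_quadratic (lyap M N) x
  have h2 : ∀ t : ℕ, ∑ s ∈ Finset.range t, ((M ^ s) *ᵥ x) ⬝ᵥ N *ᵥ ((M ^ s) *ᵥ x) =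
      x ⬝ᵥ lyap M N *ᵥ x - ((M ^ t) *ᵥ x) ⬝ᵥ lyap M N *ᵥ ((M ^ t) *ᵥ x) := fun t => by
    rw [dotProduct_lyap_unroll (lyap_spec h N) x t]
    ring
  simp only [h2]
  simpa using h1.const_sub (x ⬝ᵥ lyap M N *ᵥ x)

theorem transpose_lyap {M : Matrix (Fin n) (Fin n) ℝ} (h : SchurStable M)
    (N : Matrix (Fin n) (Fin n) ℝ) : (lyap M N)ᵀ = lyap M Nᵀ := by
  refine eq_lyap h ?_
  conv_lhs => rw [lyap_spec h N]
  simp [Matrix.mul_assoc]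

theorem posSemidef_lyap {M : Matrix (Fin n) (Fin n) ℝ} (h : SchurStable M)
    {N : Matrix (Fin n) (Fin n) ℝ} (hN : N.PosSemidef) : (lyap M N).PosSemidef := by
  have hN' : ∀ x, 0 ≤ x ⬝ᵥ N *ᵥ x := fun x => by simpa using hN.dotProduct_mulVec_nonneg x
  refine Matrix.PosSemidef.of_dotProduct_mulVec_nonneg ?_ fun x => ?_
  · rw [Matrix.IsHermitian, Matrix.conjTranspose_eq_transpose_of_trivial, transpose_lyap h]
    have := hN.1
    rw [Matrix.IsHermitian, Matrix.conjTranspose_eq_transpose_of_trivial] at this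
    rw [this]
  · rw [star_trivial]
    exact (hasSum_dotProduct_lyap h hN' x).nonneg fun t => hN' _

/-- Duality between the Lyapunov equation and its adjoint. -/
theorem trace_lyap {M : Matrix (Fin n) (Fin n) ℝ} (h : SchurStable M)
    (N : Matrix (Fin n) (Fin n) ℝ) : (lyap M N).trace = (N * lyap Mᵀ 1).trace := by
  have hX := lyap_spec h N
  have hY := lyap_spec h.transpose 1
  rw [Matrix.transpose_transpose] at hY
  set X := lyap M N
  set Y := lyap Mᵀ 1
  have h1 : (1 : Matrix (Fin n) (Fin n) ℝ) = Y - M * Y * Mᵀ := by rw [eq_sub_iff_add_eq', ← hY]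
  have h2 : N = X - Mᵀ * X * M := by rw [eq_sub_iff_add_eq', ← hX]
  calc X.trace = (X * 1).trace := by rw [mul_one]
    _ = (X * Y).trace - (X * (M * Y * Mᵀ)).trace := by
      rw [h1, mul_sub, Matrix.trace_sub]
    _ = (X * Y).trace - (Mᵀ * X * M * Y).trace := by
      congr 1
      rw [← Matrix.mul_assoc, Matrix.trace_mul_comm]
      simp only [Matrix.mul_assoc]
    _ = _ := by rw [h2, sub_mul, Matrix.trace_sub]

end Schur

/-! ### Positive semidefinite matrices and smooth matrix functions -/

section PosSemidef

variable {n m : ℕ}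

theorem dotProduct_transpose_mul_mul (M X : Matrix (Fin n) (Fin n) ℝ) (x : Fin n → ℝ) :
    x ⬝ᵥ (Mᵀ * X * M) *ᵥ x = (M *ᵥ x) ⬝ᵥ X *ᵥ (M *ᵥ x) := by
  rw [← Matrix.mulVec_mulVec, ← Matrix.mulVec_mulVec, Matrix.dotProduct_mulVec x,
    Matrix.vecMul_transpose]

theorem Matrix.PosSemidef.exists_transpose_mul_self {X : Matrix (Fin n) (Fin n) ℝ}
    (hX : X.PosSemidef) : ∃ C : Matrix (Fin n) (Fin n) ℝ, X = Cᵀ * C := by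
  refine ⟨CFC.sqrt X, ?_⟩
  have h1 := (Matrix.nonneg_iff_posSemidef.1 (CFC.sqrt_nonneg X)).1
  rw [Matrix.IsHermitian, Matrix.conjTranspose_eq_transpose_of_trivial] at h1
  rw [h1, CFC.sqrt_mul_sqrt_self X hX.nonneg]

theorem Matrix.PosSemidef.dotProduct_nonneg {X : Matrix (Fin n) (Fin n) ℝ} (hX : X.PosSemidef)
    (x : Fin n → ℝ) : 0 ≤ x ⬝ᵥ X *ᵥ x := by
  simpa using hX.dotProduct_mulVec_nonneg x

theorem Matrix.PosSemidef.trace_mul_nonneg {X Y : Matrix (Fin n) (Fin n) ℝ} (hX : X.PosSemidef)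
    (hY : Y.PosSemidef) : 0 ≤ (X * Y).trace := by
  obtain ⟨C, rfl⟩ := hX.exists_transpose_mul_self
  rw [Matrix.mul_assoc, Matrix.trace_mul_comm]
  have := (hY.mul_mul_conjTranspose_same C).trace_nonneg
  rwa [Matrix.conjTranspose_eq_transpose_of_trivial] at this

theorem Matrix.PosSemidef.dotProduct_le_trace {X : Matrix (Fin n) (Fin n) ℝ} (hX : X.PosSemidef)
    (x : Fin n → ℝ) : x ⬝ᵥ X *ᵥ x ≤ X.trace * (x ⬝ᵥ x) := by
  obtain ⟨C, rfl⟩ := hX.exists_transpose_mul_self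
  rw [← Matrix.mulVec_mulVec, Matrix.dotProduct_mulVec, Matrix.vecMul_transpose]
  have h1 : (Cᵀ * C).trace = ∑ i, ∑ j, C i j ^ 2 := by
    rw [Matrix.trace_mul_comm]
    simp only [Matrix.trace, Matrix.diag, Matrix.mul_apply, Matrix.transpose_apply, sq]
  rw [h1, Finset.sum_mul, dotProduct]
  refine Finset.sum_le_sum fun i _ => ?_
  rw [← sq]
  have := Finset.sum_mul_sq_le_sq_mul_sq Finset.univ (C i) x
  simpa [Matrix.mulVec, dotProduct, sq] using this

theorem Matrix.PosSemidef.trace_mul_le {X Y : Matrix (Fin n) (Fin n) ℝ} (hX : X.PosSemidef)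
    (hY : Y.PosSemidef) : (X * Y).trace ≤ X.trace * Y.trace := by
  have h1 : (X.trace • (1 : Matrix (Fin n) (Fin n) ℝ) - X).PosSemidef := by
    refine Matrix.PosSemidef.of_dotProduct_mulVec_nonneg ?_ fun x => ?_
    · refine Matrix.IsHermitian.sub ?_ hX.1
      simp [Matrix.IsHermitian]
    · have := hX.dotProduct_le_trace x
      rw [star_trivial, Matrix.sub_mulVec, dotProduct_sub, Matrix.smul_mulVec, Matrix.one_mulVec,
        dotProduct_smul, smul_eq_mul]
      linarith
  have h2 := h1.trace_mul_nonneg hY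
  rw [sub_mul, Matrix.trace_sub, smul_mul_assoc, one_mul, Matrix.trace_smul, smul_eq_mul] at h2
  linarith

theorem Matrix.PosDef.exists_pos_mul_le {R : Matrix (Fin m) (Fin m) ℝ} (hR : R.PosDef) :
    ∃ ρ : ℝ, 0 < ρ ∧ ∀ z : Fin m → ℝ, ρ * (z ⬝ᵥ z) ≤ z ⬝ᵥ R *ᵥ z := by
  have hpos : ∀ z : Fin m → ℝ, z ≠ 0 → 0 < z ⬝ᵥ R *ᵥ z := fun z hz => by
    simpa using hR.dotProduct_mulVec_pos hz
  have hcomp : IsCompact {z : Fin m → ℝ | ‖z‖ = 1} := by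
    have : {z : Fin m → ℝ | ‖z‖ = 1} = Metric.sphere 0 1 := by ext; simp
    rw [this]
    exact isCompact_sphere _ _
  rcases Set.eq_empty_or_nonempty {z : Fin m → ℝ | ‖z‖ = 1} with he | hne
  · refine ⟨1, one_pos, fun z => ?_⟩
    have hz : z = 0 := by
      by_contra hz
      have : ‖z‖⁻¹ • z ∈ {z : Fin m → ℝ | ‖z‖ = 1} := by
        simp [norm_smul, norm_ne_zero_iff.2 hz]
      rw [he] at this
      exact this
    simp [hz]
  · obtain ⟨z0, hz0, hmin⟩ := hcomp.exists_isMinOn hne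
      (f := fun z : Fin m → ℝ => z ⬝ᵥ R *ᵥ z) (by fun_prop)
    have hz0' : ‖z0‖ = 1 := hz0
    have hc : 0 < z0 ⬝ᵥ R *ᵥ z0 := hpos z0 (by rintro rfl; simp at hz0')
    set c := z0 ⬝ᵥ R *ᵥ z0 with hcdef
    have hm : (0 : ℝ) < m + 1 := by positivity
    refine ⟨c / (m + 1), by positivity, fun z => ?_⟩
    rcases eq_or_ne z 0 with rfl | hz
    · simp
    · have hzn : 0 < ‖z‖ := norm_pos_iff.2 hz
      have h1 : c ≤ (‖z‖⁻¹ • z) ⬝ᵥ R *ᵥ (‖z‖⁻¹ • z) :=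
        hmin (show ‖‖z‖⁻¹ • z‖ = 1 by rw [norm_smul, norm_inv, norm_norm,
          inv_mul_cancel₀ hzn.ne'])
      have h2 : (‖z‖⁻¹ • z) ⬝ᵥ R *ᵥ (‖z‖⁻¹ • z) = (‖z‖ ^ 2)⁻¹ * (z ⬝ᵥ R *ᵥ z) := by
        rw [Matrix.mulVec_smul, dotProduct_smul, smul_dotProduct, smul_eq_mul, smul_eq_mul]
        ring
      have h3 : c * ‖z‖ ^ 2 ≤ z ⬝ᵥ R *ᵥ z := by
        rw [h2, inv_mul_eq_div, le_div_iff₀ (by positivity)] at h1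
        exact h1
      have h4 : z ⬝ᵥ z ≤ m * ‖z‖ ^ 2 := by
        rw [dotProduct]
        calc ∑ i, z i * z i ≤ ∑ _i : Fin m, ‖z‖ ^ 2 := by
              refine Finset.sum_le_sum fun i _ => ?_
              rw [← sq, ← sq_abs, ← Real.norm_eq_abs]
              have := norm_le_pi_norm z i
              gcongr
          _ = m * ‖z‖ ^ 2 := by simp
      rw [div_mul_eq_mul_div, div_le_iff₀ hm]
      nlinarith [mul_le_mul_of_nonneg_left h4 hc.le, sq_nonneg ‖z‖]

end PosSemidef

section SmoothMatrix

open scoped Matrix.Norms.Operator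

variable {n : ℕ} {V : Type*} [NormedAddCommGroup V] [NormedSpace ℝ V]

theorem contDiffAt_matrix {k : WithTop ℕ∞} {f : V → Matrix (Fin n) (Fin n) ℝ} {v : V}
    (h : ∀ i j, ContDiffAt ℝ k (fun w => f w i j) v) : ContDiffAt ℝ k f v := by
  have h1 : ContDiffAt ℝ k (fun w => fun i j => f w i j) v :=
    contDiffAt_pi.2 fun i => contDiffAt_pi.2 fun j => h i j
  exact (LinearMap.toContinuousLinearMap
    (Matrix.ofLinearEquiv ℝ : (Fin n → Fin n → ℝ) ≃ₗ[ℝ] Matrix (Fin n) (Fin n) ℝ).toLinearMap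
      ).contDiff.contDiffAt.comp v h1

theorem ContDiffAt.linear_matrix {k : WithTop ℕ∞} {f : V → Matrix (Fin n) (Fin n) ℝ} {v : V}
    (hf : ContDiffAt ℝ k f v) (l : Matrix (Fin n) (Fin n) ℝ →ₗ[ℝ] ℝ) :
    ContDiffAt ℝ k (fun w => l (f w)) v :=
  (LinearMap.toContinuousLinearMap l).contDiff.contDiffAt.comp v hf

end SmoothMatrix

/-! ### The cost of a gain -/

namespace LQR

open Filter Topology

variable {n m : ℕ} (L : LQR n m)

/-- The matrix `Q + Kᵀ R K` of the stage cost under the policy `u = -K x`. -/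
def stageMat (K : Gain m n) : Matrix (Fin n) (Fin n) ℝ := L.Q + K.matᵀ * L.R * K.mat

/-- The matrix `P_K` of the cost-to-go of a stabilizing gain, `J₁(K; x) = xᵀ P_K x`. -/
noncomputable def costMat (K : Gain m n) : Matrix (Fin n) (Fin n) ℝ :=
  lyap (L.closedLoop K) (L.stageMat K)

/-- The state correlation matrix `Σ_K = ∑ₜ Mᵗ (Mᵗ)ᵀ` of a stabilizing gain, `M = A - B K`. -/
noncomputable def corrMat (K : Gain m n) : Matrix (Fin n) (Fin n) ℝ :=
  lyap (L.closedLoop K)ᵀ 1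

theorem stageCost_policy (K : Gain m n) (y : Fin n → ℝ) :
    L.stageCost y (-(K.mat *ᵥ y)) = y ⬝ᵥ L.stageMat K *ᵥ y := by
  rw [stageCost, stageMat, Matrix.add_mulVec, dotProduct_add, Matrix.mulVec_neg,
    neg_dotProduct_neg, ← Matrix.mulVec_mulVec, ← Matrix.mulVec_mulVec,
    Matrix.dotProduct_mulVec y K.matᵀ, Matrix.vecMul_transpose]

theorem continuous_mat : Continuous (fun K : Gain m n => K.mat) := by
  unfold Gain.mat
  fun_prop

theorem continuous_closedLoop : Continuous L.closedLoop := by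
  unfold closedLoop
  have := continuous_mat (m := m) (n := n)
  fun_prop

theorem isOpen_stab : IsOpen L.stab := isOpen_schurStable.preimage L.continuous_closedLoop

variable {L} {Cm : ℝ}

theorem Standing.posSemidef_stageMat (hL : L.Standing Cm) (K : Gain m n) :
    (L.stageMat K).PosSemidef := by
  have := hL.posDef_R.posSemidef.conjTranspose_mul_mul_same K.mat
  rw [Matrix.conjTranspose_eq_transpose_of_trivial] at this
  exact hL.posSemidef_Q.add this

theorem Standing.costFrom_eq (hL : L.Standing Cm) {K : Gain m n} (hK : K ∈ L.stab)
    (x : Fin n → ℝ) : L.costFrom K x = ENNReal.ofReal (x ⬝ᵥ L.costMat K *ᵥ x) := by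
  have hN := (hL.posSemidef_stageMat K).dotProduct_nonneg
  have h := hasSum_dotProduct_lyap hK hN x
  rw [costMat, ← h.tsum_eq, ENNReal.ofReal_tsum_of_nonneg (fun t => hN _) h.summable]
  simp only [costFrom, stageCost_policy, state]

theorem Standing.posSemidef_costMat (hL : L.Standing Cm) {K : Gain m n} (hK : K ∈ L.stab) :
    (L.costMat K).PosSemidef := posSemidef_lyap hK (hL.posSemidef_stageMat K)

theorem Standing.J₁_eq (hL : L.Standing Cm) {K : Gain m n} (hK : K ∈ L.stab)
    (x : Fin n → ℝ) : L.J₁ K x = x ⬝ᵥ L.costMat K *ᵥ x := by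
  rw [J₁, hL.costFrom_eq hK, ENNReal.toReal_ofReal ((hL.posSemidef_costMat hK).dotProduct_nonneg x)]

theorem abs_mul_le_dotProduct_self (v : Fin n → ℝ) (i j : Fin n) : |v i * v j| ≤ v ⬝ᵥ v := by
  have h1 : ∀ k, v k ^ 2 ≤ v ⬝ᵥ v := fun k => by
    rw [dotProduct, sq]
    exact Finset.single_le_sum (f := fun k => v k * v k) (fun k _ => mul_self_nonneg _)
      (Finset.mem_univ k)
  rw [abs_le]
  constructor <;> nlinarith [h1 i, h1 j, sq_nonneg (v i + v j), sq_nonneg (v i - v j)]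

theorem Standing.integrable_mul (hL : L.Standing Cm) (i j : Fin n) :
    Integrable (fun v : Fin n → ℝ => v i * v j) L.init := by
  have := hL.isProb
  refine Integrable.of_bound (C := Cm) (by fun_prop) ?_
  filter_upwards [hL.bounded] with v hv
  exact (abs_mul_le_dotProduct_self v i j).trans hv

theorem dotProduct_mulVec_eq_sum (X : Matrix (Fin n) (Fin n) ℝ) (v : Fin n → ℝ) :
    v ⬝ᵥ X *ᵥ v = ∑ i, ∑ j, X i j * (v i * v j) := by
  simp only [dotProduct, Matrix.mulVec, Finset.mul_sum]
  exact Finset.sum_congr rfl fun i _ => Finset.sum_congr rfl fun j _ => by ring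

theorem Standing.integrable_quadratic (hL : L.Standing Cm) (X : Matrix (Fin n) (Fin n) ℝ) :
    Integrable (fun v : Fin n → ℝ => v ⬝ᵥ X *ᵥ v) L.init := by
  simp only [dotProduct_mulVec_eq_sum]
  exact integrable_finsetSum _ fun i _ => integrable_finsetSum _ fun j _ =>
    (hL.integrable_mul i j).const_mul _

theorem Standing.integral_quadratic (hL : L.Standing Cm) (X : Matrix (Fin n) (Fin n) ℝ) :
    ∫ v, v ⬝ᵥ X *ᵥ v ∂L.init = X.trace := by
  simp only [dotProduct_mulVec_eq_sum]
  have h1 : ∀ i, Integrable (fun v : Fin n → ℝ => ∑ j, X i j * (v i * v j)) L.init := fun i =>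
    integrable_finsetSum _ fun j _ => (hL.integrable_mul i j).const_mul (X i j)
  refine (integral_finsetSum _ fun i _ => h1 i).trans ?_
  rw [Matrix.trace]
  refine Finset.sum_congr rfl fun i _ => ?_
  refine (integral_finsetSum _ fun j _ => (hL.integrable_mul i j).const_mul (X i j)).trans ?_
  simp [integral_const_mul, hL.covariance, Matrix.one_apply]

theorem Standing.lintegral_quadratic (hL : L.Standing Cm) {X : Matrix (Fin n) (Fin n) ℝ}
    (hX : ∀ v, 0 ≤ v ⬝ᵥ X *ᵥ v) :
    ∫⁻ v, ENNReal.ofReal (v ⬝ᵥ X *ᵥ v) ∂L.init = ENNReal.ofReal X.trace := by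
  rw [← ofReal_integral_eq_lintegral_ofReal (hL.integrable_quadratic X) (ae_of_all _ hX),
    hL.integral_quadratic]

theorem Standing.cost_eq_tsum (hL : L.Standing Cm) (K : Gain m n) :
    L.cost K = ∑' t : ℕ, ENNReal.ofReal
      ((L.closedLoop K ^ t)ᵀ * L.stageMat K * L.closedLoop K ^ t).trace := by
  have hN := (hL.posSemidef_stageMat K).dotProduct_nonneg
  have h1 : ∀ (t : ℕ) (v : Fin n → ℝ), L.stageCost (L.state K v t) (-(K.mat *ᵥ L.state K v t)) =
      v ⬝ᵥ ((L.closedLoop K ^ t)ᵀ * L.stageMat K * L.closedLoop K ^ t) *ᵥ v := fun t v => by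
    rw [stageCost_policy, state, dotProduct_transpose_mul_mul]
  simp only [cost, costFrom, h1]
  rw [lintegral_tsum fun t => Measurable.aemeasurable (by fun_prop)]
  refine tsum_congr fun t => hL.lintegral_quadratic fun v => ?_
  rw [dotProduct_transpose_mul_mul]
  exact hN _

theorem Standing.cost_eq (hL : L.Standing Cm) {K : Gain m n} (hK : K ∈ L.stab) :
    L.cost K = ENNReal.ofReal (L.costMat K).trace := by
  simp only [cost, hL.costFrom_eq hK]
  exact hL.lintegral_quadratic (hL.posSemidef_costMat hK).dotProduct_nonneg

theorem Standing.J_eq (hL : L.Standing Cm) {K : Gain m n} (hK : K ∈ L.stab) :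
    L.J K = (L.costMat K).trace := by
  rw [J, hL.cost_eq hK, ENNReal.toReal_ofReal (hL.posSemidef_costMat hK).trace_nonneg]

theorem tendsto_zero_of_dotProduct_self {p : ℕ} {y : ℕ → Fin p → ℝ}
    (h : Tendsto (fun t => y t ⬝ᵥ y t) atTop (𝓝 0)) : Tendsto y atTop (𝓝 0) := by
  refine tendsto_pi_nhds.2 fun i => ?_
  have h1 : Tendsto (fun t => y t i ^ 2) atTop (𝓝 0) := by
    refine squeeze_zero (fun t => sq_nonneg _) (fun t => ?_) h
    rw [dotProduct, sq]
    exact Finset.single_le_sum (f := fun k => y t k * y t k) (fun k _ => mul_self_nonneg _)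
      (Finset.mem_univ i)
  have h2 := h1.sqrt
  simp only [Real.sqrt_sq_eq_abs, Real.sqrt_zero] at h2
  exact (tendsto_zero_iff_abs_tendsto_zero _).2 h2

/-- By detectability, a gain of finite cost is stabilizing: the outputs `Q^{1/2} xₜ` and `K xₜ` of
every trajectory vanish asymptotically, and they are the input of a stable observer. -/
theorem Standing.mem_stab_of_cost_ne_top (hL : L.Standing Cm) {K : Gain m n}
    (h : L.cost K ≠ ⊤) : K ∈ L.stab := by
  obtain ⟨F, hF⟩ := hL.detectable
  obtain ⟨ρ, hρ, hR⟩ := hL.posDef_R.exists_pos_mul_le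
  set M := L.closedLoop K with hM
  have hNp := hL.posSemidef_stageMat K
  have hN := hNp.dotProduct_nonneg
  have hstage : ∀ y : Fin n → ℝ, y ⬝ᵥ L.stageMat K *ᵥ y =
      (CFC.sqrt L.Q *ᵥ y) ⬝ᵥ (CFC.sqrt L.Q *ᵥ y) + (K.mat *ᵥ y) ⬝ᵥ L.R *ᵥ (K.mat *ᵥ y) := by
    intro y
    rw [← stageCost_policy, stageCost, Matrix.mulVec_neg, neg_dotProduct_neg]
    congr 1
    have h1 := (Matrix.nonneg_iff_posSemidef.1 (CFC.sqrt_nonneg L.Q)).1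
    rw [Matrix.IsHermitian, Matrix.conjTranspose_eq_transpose_of_trivial] at h1
    conv_lhs => rw [← CFC.sqrt_mul_sqrt_self L.Q hL.posSemidef_Q.nonneg]
    rw [← Matrix.mulVec_mulVec, Matrix.dotProduct_mulVec, ← h1, Matrix.vecMul_transpose, h1]
  rw [hL.cost_eq_tsum] at h
  have htr : Tendsto (fun t : ℕ => ((M ^ t)ᵀ * L.stageMat K * M ^ t).trace) atTop (𝓝 0) := by
    have h1 := ENNReal.tendsto_atTop_zero_of_tsum_ne_top h
    have h2 := (ENNReal.tendsto_toReal ENNReal.zero_ne_top).comp h1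
    simp only [Function.comp_def, ENNReal.toReal_zero] at h2
    refine h2.congr fun t => ENNReal.toReal_ofReal ?_
    have := hNp.conjTranspose_mul_mul_same (M ^ t)
    rw [Matrix.conjTranspose_eq_transpose_of_trivial] at this
    exact this.trace_nonneg
  have hcol : ∀ i : Fin n, Tendsto (fun t : ℕ => (M ^ t) *ᵥ Pi.single i 1) atTop (𝓝 0) := by
    intro i
    have hq : Tendsto (fun t : ℕ => ((M ^ t) *ᵥ Pi.single i 1) ⬝ᵥ
        L.stageMat K *ᵥ ((M ^ t) *ᵥ Pi.single i 1)) atTop (𝓝 0) := by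
      refine squeeze_zero (fun t => hN _) (fun t => ?_) htr
      have h1 : ∀ j : Fin n, ((M ^ t)ᵀ * L.stageMat K * M ^ t) j j =
          ((M ^ t) *ᵥ Pi.single j 1) ⬝ᵥ L.stageMat K *ᵥ ((M ^ t) *ᵥ Pi.single j 1) := fun j => by
        rw [← dotProduct_transpose_mul_mul]
        simp
      rw [← h1 i]
      refine Finset.single_le_sum (f := fun j => ((M ^ t)ᵀ * L.stageMat K * M ^ t) j j)
        (fun j _ => ?_) (Finset.mem_univ i)
      rw [h1]
      exact hN _
    have hQ : Tendsto (fun t : ℕ => CFC.sqrt L.Q *ᵥ ((M ^ t) *ᵥ Pi.single i 1)) atTop (𝓝 0) := by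
      refine tendsto_zero_of_dotProduct_self (squeeze_zero (fun t => ?_) (fun t => ?_) hq)
      · exact Finset.sum_nonneg fun _ _ => mul_self_nonneg _
      · rw [hstage]
        have := hL.posDef_R.posSemidef.dotProduct_nonneg (K.mat *ᵥ ((M ^ t) *ᵥ Pi.single i 1))
        linarith
    have hK : Tendsto (fun t : ℕ => K.mat *ᵥ ((M ^ t) *ᵥ Pi.single i 1)) atTop (𝓝 0) := by
      have hq' := hq.const_mul ρ⁻¹
      rw [mul_zero] at hq'
      refine tendsto_zero_of_dotProduct_self (squeeze_zero (fun t => ?_) (fun t => ?_) hq')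
      · exact Finset.sum_nonneg fun _ _ => mul_self_nonneg _
      · rw [hstage, inv_mul_eq_div, le_div_iff₀ hρ, mul_comm]
        have h1 := hR (K.mat *ᵥ ((M ^ t) *ᵥ Pi.single i 1))
        have h2 : 0 ≤ (CFC.sqrt L.Q *ᵥ ((M ^ t) *ᵥ Pi.single i 1)) ⬝ᵥ
          (CFC.sqrt L.Q *ᵥ ((M ^ t) *ᵥ Pi.single i 1)) :=
            Finset.sum_nonneg fun _ _ => mul_self_nonneg _
        linarith
    refine hF.tendsto_of_input (u := fun t => F *ᵥ (CFC.sqrt L.Q *ᵥ ((M ^ t) *ᵥ Pi.single i 1)) -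
      L.B *ᵥ (K.mat *ᵥ ((M ^ t) *ᵥ Pi.single i 1))) (fun t => ?_) ?_
    · rw [pow_succ', ← Matrix.mulVec_mulVec]
      generalize (M ^ t) *ᵥ Pi.single i 1 = y
      simp only [hM, closedLoop, Matrix.sub_mulVec, Matrix.mulVec_mulVec]
      abel
    · have h1 : Continuous fun p : (Fin n → ℝ) × (Fin m → ℝ) => F *ᵥ p.1 - L.B *ᵥ p.2 := by
        fun_prop
      have h2 := (h1.tendsto (0, 0)).comp (hQ.prodMk_nhds hK)
      simpa [Function.comp_def] using h2
  refine schurStable_of_tendsto_pow (tendsto_pi_nhds.2 fun i => tendsto_pi_nhds.2 fun j => ?_)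
  have := (tendsto_pi_nhds.1 (hcol j)) i
  simpa using this

end LQR

/-! ### The policy gradient -/

section Frobenius

variable {n m : ℕ}

@[simp] theorem Gain.mat_ofMat (M : Matrix (Fin m) (Fin n) ℝ) : (Gain.ofMat M).mat = M := rfl

@[simp] theorem Gain.ofMat_mat (K : Gain m n) : Gain.ofMat K.mat = K := rfl

theorem Gain.mat_add (K K' : Gain m n) : (K + K').mat = K.mat + K'.mat := rfl

theorem Gain.mat_smul (c : ℝ) (K : Gain m n) : (c • K).mat = c • K.mat := rfl

theorem Gain.inner_eq_trace (K K' : Gain m n) : inner ℝ K K' = (K.matᵀ * K'.mat).trace := by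
  rw [PiLp.inner_apply, Fintype.sum_prod_type_right]
  simp only [Matrix.trace, Matrix.diag, Matrix.mul_apply, Matrix.transpose_apply, Gain.mat,
    Matrix.of_apply, RCLike.inner_apply, conj_trivial]
  exact Finset.sum_congr rfl fun i _ => Finset.sum_congr rfl fun j _ => mul_comm _ _

theorem Gain.norm_sq_eq_trace (K : Gain m n) : ‖K‖ ^ 2 = (K.matᵀ * K.mat).trace := by
  rw [← Gain.inner_eq_trace, real_inner_self_eq_norm_sq]

theorem posSemidef_transpose_mul_self (C : Matrix (Fin m) (Fin n) ℝ) : (Cᵀ * C).PosSemidef := by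
  have := Matrix.posSemidef_conjTranspose_mul_self C
  rwa [Matrix.conjTranspose_eq_transpose_of_trivial] at this

end Frobenius

namespace LQR

open Filter Topology

variable {n m : ℕ} (L : LQR n m)

/-- The matrix `(Bᵀ P B + R) K - Bᵀ P A`, half of the gradient of the one-step Bellman cost
`K ↦ (A - B K)ᵀ P (A - B K) + Q + Kᵀ R K`. -/
def bellmanGrad (P : Matrix (Fin n) (Fin n) ℝ) (K : Gain m n) : Matrix (Fin m) (Fin n) ℝ :=
  (L.Bᵀ * P * L.B + L.R) * K.mat - L.Bᵀ * P * L.A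

/-- The one-step Bellman cost is quadratic in the gain. -/
theorem bellman_expand {P : Matrix (Fin n) (Fin n) ℝ} (hP : Pᵀ = P) (hR : L.Rᵀ = L.R)
    (K D : Gain m n) :
    (L.closedLoop (K + D))ᵀ * P * L.closedLoop (K + D) + L.stageMat (K + D) =
      (L.closedLoop K)ᵀ * P * L.closedLoop K + L.stageMat K +
        (D.matᵀ * L.bellmanGrad P K + (L.bellmanGrad P K)ᵀ * D.mat +
          D.matᵀ * (L.Bᵀ * P * L.B + L.R) * D.mat) := by
  simp only [closedLoop, stageMat, bellmanGrad, Gain.mat_add, Matrix.transpose_sub,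
    Matrix.transpose_add, Matrix.transpose_mul, hP, hR, Matrix.transpose_transpose,
    Matrix.mul_add, Matrix.add_mul, Matrix.mul_sub, Matrix.sub_mul, Matrix.mul_assoc]
  abel

variable {L} {Cm : ℝ}

theorem Standing.transpose_R (hL : L.Standing Cm) : L.Rᵀ = L.R := by
  have := hL.posDef_R.1
  rwa [Matrix.IsHermitian, Matrix.conjTranspose_eq_transpose_of_trivial] at this

theorem Standing.transpose_costMat (hL : L.Standing Cm) {K : Gain m n} (hK : K ∈ L.stab) :
    (L.costMat K)ᵀ = L.costMat K := by
  have := (hL.posSemidef_costMat hK).1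
  rwa [Matrix.IsHermitian, Matrix.conjTranspose_eq_transpose_of_trivial] at this

theorem costMat_spec {K : Gain m n} (hK : K ∈ L.stab) : L.costMat K =
    (L.closedLoop K)ᵀ * L.costMat K * L.closedLoop K + L.stageMat K := lyap_spec hK _

theorem corrMat_spec {K : Gain m n} (hK : K ∈ L.stab) : L.corrMat K =
    L.closedLoop K * L.corrMat K * (L.closedLoop K)ᵀ + 1 := by
  have := lyap_spec (SchurStable.transpose hK) 1
  rwa [Matrix.transpose_transpose] at this

theorem posSemidef_corrMat {K : Gain m n} (hK : K ∈ L.stab) : (L.corrMat K).PosSemidef :=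
  posSemidef_lyap (SchurStable.transpose hK) Matrix.PosSemidef.one

theorem posSemidef_corrMat_sub_one {K : Gain m n} (hK : K ∈ L.stab) :
    (L.corrMat K - 1).PosSemidef := by
  have h := (posSemidef_corrMat hK).mul_mul_conjTranspose_same (L.closedLoop K)
  rw [Matrix.conjTranspose_eq_transpose_of_trivial] at h
  rwa [sub_eq_iff_eq_add.2 (corrMat_spec hK)]

/-- The exact cost difference of two stabilizing gains. -/
theorem Standing.J_add_sub (hL : L.Standing Cm) {K D : Gain m n} (hK : K ∈ L.stab)
    (hK' : K + D ∈ L.stab) :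
    L.J (K + D) - L.J K =
      ((D.matᵀ * L.bellmanGrad (L.costMat K) K + (L.bellmanGrad (L.costMat K) K)ᵀ * D.mat +
        D.matᵀ * (L.Bᵀ * L.costMat K * L.B + L.R) * D.mat) * L.corrMat (K + D)).trace := by
  rw [hL.J_eq hK, hL.J_eq hK', corrMat, ← trace_lyap hK', ← Matrix.trace_sub]
  congr 1
  refine eq_lyap hK' ?_
  have h1 := L.bellman_expand (hL.transpose_costMat hK) hL.transpose_R K D
  rw [← costMat_spec hK] at h1
  rw [← sub_eq_iff_eq_add'] at h1
  rw [← h1]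
  conv_lhs => rw [costMat_spec hK']
  simp only [Matrix.mul_sub, Matrix.sub_mul]
  abel

section Smooth

open scoped Matrix.Norms.Operator

theorem contDiff_coord (p : Fin m × Fin n) {k : WithTop ℕ∞} :
    ContDiff ℝ k (fun K : Gain m n => K p) :=
  (EuclideanSpace.proj p : Gain m n →L[ℝ] ℝ).contDiff

theorem contDiffAt_closedLoop {k : WithTop ℕ∞} (K : Gain m n) :
    ContDiffAt ℝ k L.closedLoop K := by
  refine contDiffAt_matrix fun i j => ?_
  simp only [closedLoop, Gain.mat, Matrix.sub_apply, Matrix.mul_apply, Matrix.of_apply]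
  exact contDiffAt_const.sub (ContDiffAt.sum fun l _ =>
    contDiffAt_const.mul (contDiff_coord (l, j)).contDiffAt)

theorem contDiffAt_stageMat {k : WithTop ℕ∞} (K : Gain m n) :
    ContDiffAt ℝ k L.stageMat K := by
  refine contDiffAt_matrix fun i j => ?_
  simp only [stageMat, Gain.mat, Matrix.add_apply, Matrix.mul_apply, Matrix.of_apply,
    Matrix.transpose_apply]
  exact contDiffAt_const.add (ContDiffAt.sum fun l _ =>
    (ContDiffAt.sum fun l' _ => (contDiff_coord (l', i)).contDiffAt.mul contDiffAt_const).mul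
      (contDiff_coord (l, j)).contDiffAt)

theorem contDiffAt_costMat {k : WithTop ℕ∞} {K : Gain m n} (hK : K ∈ L.stab) :
    ContDiffAt ℝ k L.costMat K :=
  contDiffAt_lyap (contDiffAt_closedLoop K) (contDiffAt_stageMat K) hK

theorem Standing.contDiffAt_J (hL : L.Standing Cm) {k : WithTop ℕ∞} {K : Gain m n}
    (hK : K ∈ L.stab) : ContDiffAt ℝ k L.J K := by
  refine ((contDiffAt_costMat hK).linear_matrix (Matrix.traceLinearMap (Fin n) ℝ ℝ)
    ).congr_of_eventuallyEq ?_
  filter_upwards [L.isOpen_stab.mem_nhds hK] with K' hK'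
  exact hL.J_eq hK'

theorem Standing.contDiffAt_J₁ (hL : L.Standing Cm) (x : Fin n → ℝ) {k : WithTop ℕ∞}
    {K : Gain m n} (hK : K ∈ L.stab) : ContDiffAt ℝ k (fun K' => L.J₁ K' x) K := by
  have h : ContDiffAt ℝ k (fun K' => x ⬝ᵥ L.costMat K' *ᵥ x) K :=
    (contDiffAt_costMat hK).linear_matrix
      { toFun := fun X => x ⬝ᵥ X *ᵥ x
        map_add' := fun X Y => by rw [Matrix.add_mulVec, dotProduct_add]
        map_smul' := fun c X => by
          rw [Matrix.smul_mulVec, dotProduct_smul, RingHom.id_apply] }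
  refine h.congr_of_eventuallyEq ?_
  filter_upwards [L.isOpen_stab.mem_nhds hK] with K' hK'
  exact hL.J₁_eq hK' x

theorem continuousAt_corrMat {K : Gain m n} (hK : K ∈ L.stab) : ContinuousAt L.corrMat K := by
  have hT : ContDiffAt ℝ 0 (fun K => (L.closedLoop K)ᵀ) K := by
    refine contDiffAt_matrix fun i j => ?_
    simp only [closedLoop, Gain.mat, Matrix.sub_apply, Matrix.mul_apply, Matrix.of_apply,
      Matrix.transpose_apply]
    exact contDiffAt_const.sub (ContDiffAt.sum fun l _ =>
      contDiffAt_const.mul (contDiff_coord (l, i)).contDiffAt)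
  exact (contDiffAt_lyap hT contDiffAt_const (SchurStable.transpose hK)).continuousAt

end Smooth

/-- The policy gradient `∇J(K) = 2 ((Bᵀ P B + R) K - Bᵀ P A) Σ`. -/
theorem Standing.gradient_J (hL : L.Standing Cm) {K : Gain m n} (hK : K ∈ L.stab) :
    gradient L.J K =
      (2 : ℝ) • Gain.ofMat (L.bellmanGrad (L.costMat K) K * L.corrMat K) := by
  have hd : DifferentiableAt ℝ L.J K := (hL.contDiffAt_J (k := 1) hK).differentiableAt (by simp)
  refine ext_inner_right ℝ fun D => ?_
  rw [gradient, InnerProductSpace.toDual_symm_apply]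
  set G := L.bellmanGrad (L.costMat K) K
  set H := L.Bᵀ * L.costMat K * L.B + L.R
  have hline : HasDerivAt (fun t : ℝ => L.J (K + t • D)) (fderiv ℝ L.J K D) 0 :=
    hd.hasFDerivAt.hasLineDerivAt D
  have hK0 : K + (0 : ℝ) • D = K := by simp
  have hc : ContinuousAt (fun t : ℝ => K + t • D) 0 := by fun_prop
  have hS : ContinuousAt (fun t : ℝ => L.corrMat (K + t • D)) 0 :=
    ContinuousAt.comp (g := L.corrMat) (by rw [hK0]; exact continuousAt_corrMat hK) hc
  have hq : ContinuousAt (fun t : ℝ => ((D.matᵀ * G + Gᵀ * D.mat + t • (D.matᵀ * H * D.mat)) *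
      L.corrMat (K + t • D)).trace) 0 := by
    have h1 : Continuous fun p : ℝ × Matrix (Fin n) (Fin n) ℝ =>
        ((D.matᵀ * G + Gᵀ * D.mat + p.1 • (D.matᵀ * H * D.mat)) * p.2).trace := by fun_prop
    exact h1.continuousAt.comp (f := fun t : ℝ => (t, L.corrMat (K + t • D)))
      (continuousAt_id.prodMk hS)
  have hline2 : HasDerivAt (fun t : ℝ => L.J (K + t • D))
      (((D.matᵀ * G + Gᵀ * D.mat) * L.corrMat K).trace) 0 := by
    rw [hasDerivAt_iff_tendsto_slope_zero]
    have h2 := hq.tendsto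
    simp only [zero_smul, add_zero] at h2
    refine (h2.mono_left nhdsWithin_le_nhds).congr' ?_
    have h3 : ∀ᶠ t : ℝ in 𝓝[≠] 0, K + t • D ∈ L.stab :=
      nhdsWithin_le_nhds (hc.eventually (by
        change ∀ᶠ y in 𝓝 (K + (0 : ℝ) • D), y ∈ L.stab
        rw [hK0]
        exact L.isOpen_stab.mem_nhds hK))
    filter_upwards [h3, self_mem_nhdsWithin] with t ht ht0
    have ht0' : t ≠ 0 := ht0
    rw [zero_add, zero_smul, add_zero, hL.J_add_sub hK ht, smul_eq_mul, ← div_eq_inv_mul,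
      eq_div_iff ht0', mul_comm _ t, ← smul_eq_mul, ← Matrix.trace_smul]
    congr 1
    rw [← Matrix.smul_mul, Gain.mat_smul]
    congr 1
    simp only [Matrix.transpose_smul, Matrix.smul_mul, Matrix.mul_smul, smul_add, G, H]
  rw [hline.unique hline2, inner_smul_left, Gain.inner_eq_trace, Gain.mat_ofMat]
  have hSt : (L.corrMat K)ᵀ = L.corrMat K := by
    have := (posSemidef_corrMat hK).1
    rwa [Matrix.IsHermitian, Matrix.conjTranspose_eq_transpose_of_trivial] at this
  rw [Matrix.add_mul, Matrix.trace_add, Matrix.transpose_mul, hSt, Matrix.mul_assoc (L.corrMat K),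
    Matrix.trace_mul_comm (L.corrMat K)]
  have h5 : (D.matᵀ * G * L.corrMat K).trace = (Gᵀ * D.mat * L.corrMat K).trace := by
    rw [← Matrix.trace_transpose]
    simp only [Matrix.transpose_mul, hSt, Matrix.transpose_transpose]
    rw [Matrix.trace_mul_comm]
  rw [h5]
  simp
  ring

/-- Since `Σ ≥ I`, the gradient dominates the Bellman residual. -/
theorem Standing.norm_bellmanGrad_le (hL : L.Standing Cm) {K : Gain m n} (hK : K ∈ L.stab) :
    4 * ‖Gain.ofMat (L.bellmanGrad (L.costMat K) K)‖ ^ 2 ≤ ‖gradient L.J K‖ ^ 2 := by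
  rw [hL.gradient_J hK, norm_smul, mul_pow, Real.norm_ofNat, Gain.norm_sq_eq_trace,
    Gain.norm_sq_eq_trace, Gain.mat_ofMat, Gain.mat_ofMat]
  set G := L.bellmanGrad (L.costMat K) K
  have hW := posSemidef_corrMat_sub_one hK
  set W := L.corrMat K - 1 with hWdef
  have hSW : L.corrMat K = 1 + W := by rw [hWdef]; abel
  have hWt : Wᵀ = W := by
    have := hW.1
    rwa [Matrix.IsHermitian, Matrix.conjTranspose_eq_transpose_of_trivial] at this
  have hGG := posSemidef_transpose_mul_self G
  have h1 := hGG.trace_mul_nonneg hW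
  have h2 : 0 ≤ (Gᵀ * G * (W * W)).trace := by
    have := hGG.trace_mul_nonneg (posSemidef_transpose_mul_self W)
    rwa [hWt] at this
  have h3 : ((G * L.corrMat K)ᵀ * (G * L.corrMat K)).trace =
      (Gᵀ * G).trace + 2 * (Gᵀ * G * W).trace + (Gᵀ * G * (W * W)).trace := by
    have h4 : (W * (Gᵀ * G * W)).trace = (Gᵀ * G * (W * W)).trace := by
      rw [Matrix.trace_mul_comm]
      simp only [Matrix.mul_assoc]
    have h5 : (W * (Gᵀ * G)).trace = (Gᵀ * G * W).trace := Matrix.trace_mul_comm _ _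
    rw [← h4, two_mul]
    nth_rewrite 2 [← h5]
    rw [← Matrix.trace_add, ← Matrix.trace_add, ← Matrix.trace_add, hSW]
    congr 1
    simp only [Matrix.transpose_mul, Matrix.transpose_add, hWt, Matrix.mul_add, Matrix.add_mul,
      Matrix.mul_assoc, Matrix.mul_one]
    abel
  rw [h3]
  linarith

end LQR

/-! ### The Riccati equation and the Polyak–Łojasiewicz inequality -/

namespace LQR

open Filter Topology

variable {n m : ℕ} {L : LQR n m} {Cm : ℝ}

theorem Standing.posDef_hessian (hL : L.Standing Cm) {P : Matrix (Fin n) (Fin n) ℝ}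
    (hP : P.PosSemidef) : (L.Bᵀ * P * L.B + L.R).PosDef := by
  have h := hP.conjTranspose_mul_mul_same L.B
  rw [Matrix.conjTranspose_eq_transpose_of_trivial] at h
  exact hL.posDef_R.posSemidef_add h

theorem bellmanGrad_eq_zero_iff (hL : L.Standing Cm) {P : Matrix (Fin n) (Fin n) ℝ}
    (hP : P.PosSemidef) (K : Gain m n) : L.bellmanGrad P K = 0 ↔
      K = Gain.ofMat ((L.Bᵀ * P * L.B + L.R)⁻¹ * L.Bᵀ * P * L.A) := by
  have hu : IsUnit (L.Bᵀ * P * L.B + L.R).det :=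
    (Matrix.isUnit_iff_isUnit_det _).1 (hL.posDef_hessian hP).isUnit
  rw [bellmanGrad, sub_eq_zero]
  constructor
  · intro h
    rw [← Gain.ofMat_mat K]
    congr 1
    rw [Matrix.mul_assoc, Matrix.mul_assoc, ← Matrix.mul_assoc L.Bᵀ, ← h, ← Matrix.mul_assoc,
      Matrix.nonsing_inv_mul _ hu, Matrix.one_mul]
  · rintro rfl
    rw [Gain.mat_ofMat, ← Matrix.mul_assoc, ← Matrix.mul_assoc, ← Matrix.mul_assoc,
      Matrix.mul_nonsing_inv _ hu, Matrix.one_mul]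

/-- For a critical gain of the Bellman cost of `P`, the Riccati equation is the fixed-point equation
of the cost-to-go. -/
theorem isDARE_iff_of_bellmanGrad_eq_zero (hL : L.Standing Cm)
    {P : Matrix (Fin n) (Fin n) ℝ} (hP : P.PosSemidef) {K : Gain m n}
    (hK : L.bellmanGrad P K = 0) : L.IsDARE P ↔
      P = (L.closedLoop K)ᵀ * P * L.closedLoop K + L.stageMat K := by
  have hPt : Pᵀ = P := by
    have := hP.1
    rwa [Matrix.IsHermitian, Matrix.conjTranspose_eq_transpose_of_trivial] at this
  have h1 := (bellmanGrad_eq_zero_iff hL hP K).1 hK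
  rw [IsDARE, and_iff_right hP]
  have h2 : L.Aᵀ * P * L.A + L.Q - L.Aᵀ * P * L.B * (L.Bᵀ * P * L.B + L.R)⁻¹ * L.Bᵀ * P * L.A =
      (L.closedLoop K)ᵀ * P * L.closedLoop K + L.stageMat K := by
    have h3 : L.Aᵀ * P * L.B * (L.Bᵀ * P * L.B + L.R)⁻¹ * L.Bᵀ * P * L.A =
        L.Aᵀ * P * L.B * K.mat := by
      rw [h1, Gain.mat_ofMat]
      simp only [Matrix.mul_assoc]
    have h4 : K.matᵀ * ((L.Bᵀ * P * L.B + L.R) * K.mat) = K.matᵀ * (L.Bᵀ * P * L.A) := by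
      rw [sub_eq_zero.1 hK]
    simp only [Matrix.mul_add, Matrix.add_mul, Matrix.mul_assoc] at h4
    rw [h3]
    simp only [closedLoop, stageMat, Matrix.transpose_sub, Matrix.transpose_mul,
      Matrix.mul_sub, Matrix.sub_mul, Matrix.mul_assoc, ← h4]
    abel
  rw [h2]

/-- A positive semidefinite solution of the cost-to-go equation bounds the cost, whether or not the
gain is known to be stabilizing. -/
theorem Standing.cost_le_of_fixedPoint (hL : L.Standing Cm) {P : Matrix (Fin n) (Fin n) ℝ}
    (hP : P.PosSemidef) {K : Gain m n}
    (h : P = (L.closedLoop K)ᵀ * P * L.closedLoop K + L.stageMat K) :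
    L.cost K ≤ ENNReal.ofReal P.trace := by
  rw [← hL.lintegral_quadratic hP.dotProduct_nonneg]
  refine lintegral_mono fun x => ?_
  have hN := (hL.posSemidef_stageMat K).dotProduct_nonneg
  refine ENNReal.tsum_le_of_sum_range_le fun t => ?_
  simp only [stageCost_policy, state]
  rw [← ENNReal.ofReal_sum_of_nonneg fun s _ => hN _]
  refine ENNReal.ofReal_le_ofReal ?_
  rw [dotProduct_lyap_unroll h x t]
  linarith [hP.dotProduct_nonneg ((L.closedLoop K ^ t) *ᵥ x)]

/-- Every positive semidefinite solution of the Riccati equation is the cost-to-go of a stabilizing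
gain. -/
theorem Standing.stab_of_isDARE (hL : L.Standing Cm) {P : Matrix (Fin n) (Fin n) ℝ}
    (hP : L.IsDARE P) {K : Gain m n} (hK : L.bellmanGrad P K = 0) :
    K ∈ L.stab ∧ L.costMat K = P := by
  have h := (isDARE_iff_of_bellmanGrad_eq_zero hL hP.1 hK).1 hP
  have hs : K ∈ L.stab := hL.mem_stab_of_cost_ne_top
    (ne_top_of_le_ne_top ENNReal.ofReal_ne_top (hL.cost_le_of_fixedPoint hP.1 h))
  exact ⟨hs, (eq_lyap hs h).symm⟩

/-- Coercivity of the cost: the first stage alone costs at least `E ‖u₀‖_R²`, and the initial state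
has the identity as its second moment. -/
theorem Standing.exists_norm_sq_le_cost (hL : L.Standing Cm) :
    ∃ ρ : ℝ, 0 < ρ ∧ (∀ z : Fin m → ℝ, ρ * (z ⬝ᵥ z) ≤ z ⬝ᵥ L.R *ᵥ z) ∧
      ∀ K : Gain m n, ENNReal.ofReal (ρ * ‖K‖ ^ 2) ≤ L.cost K := by
  obtain ⟨ρ, hρ, hR⟩ := hL.posDef_R.exists_pos_mul_le
  refine ⟨ρ, hρ, hR, fun K => ?_⟩
  rw [hL.cost_eq_tsum]
  refine le_trans (ENNReal.ofReal_le_ofReal ?_) (ENNReal.le_tsum 0)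
  rw [pow_zero, Matrix.transpose_one, Matrix.one_mul, Matrix.mul_one, stageMat, Matrix.trace_add,
    Gain.norm_sq_eq_trace]
  have h1 := hL.posSemidef_Q.trace_nonneg
  have h2 : ρ * (K.matᵀ * K.mat).trace ≤ (K.matᵀ * L.R * K.mat).trace := by
    rw [Matrix.trace, Matrix.trace, Finset.mul_sum]
    refine Finset.sum_le_sum fun i _ => ?_
    have h3 := hR (fun j => K.mat j i)
    refine h3.trans (le_of_eq ?_)
    rw [Matrix.diag_apply, dotProduct_mulVec_eq_sum, Matrix.mul_apply]
    simp only [Matrix.mul_apply, Matrix.transpose_apply, Finset.sum_mul]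
    rw [Finset.sum_comm]
    exact Finset.sum_congr rfl fun _ _ => Finset.sum_congr rfl fun _ _ => by ring
  linarith

/-- As a series of nonnegative continuous functions, the extended cost is lower semicontinuous on
all gains, not only on the stabilizing ones. -/
theorem Standing.lowerSemicontinuous_cost (hL : L.Standing Cm) :
    LowerSemicontinuous L.cost := by
  have : L.cost = fun K => ∑' t : ℕ, ENNReal.ofReal
      ((L.closedLoop K ^ t)ᵀ * L.stageMat K * L.closedLoop K ^ t).trace :=
    funext hL.cost_eq_tsum
  rw [this]
  refine lowerSemicontinuous_tsum fun t => Continuous.lowerSemicontinuous ?_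
  have h1 := L.continuous_closedLoop
  have h2 := continuous_mat (m := m) (n := n)
  unfold stageMat
  exact ENNReal.continuous_ofReal.comp (by fun_prop)

/-- Sublevel sets of the cost are compact: the cost is coercive, and infinite off the stabilizing
gains. -/
theorem Standing.isCompact_sublevel (hL : L.Standing Cm) (c : ℝ) :
    IsCompact {K | K ∈ L.stab ∧ L.J K ≤ c} := by
  rcases lt_or_ge c 0 with hc | hc
  · have : {K | K ∈ L.stab ∧ L.J K ≤ c} = ∅ := by
      ext K
      simp only [Set.mem_ofPred_eq, Set.mem_empty_iff_false, iff_false, not_and, not_le]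
      exact fun _ => hc.trans_le ENNReal.toReal_nonneg
    rw [this]
    exact isCompact_empty
  · have h1 : {K | K ∈ L.stab ∧ L.J K ≤ c} = L.cost ⁻¹' Set.Iic (ENNReal.ofReal c) := by
      ext K
      simp only [Set.mem_ofPred_eq, Set.mem_preimage, Set.mem_Iic]
      constructor
      · rintro ⟨hK, h⟩
        rw [hL.cost_eq hK, ← hL.J_eq hK]
        exact ENNReal.ofReal_le_ofReal h
      · intro h
        have hne := ne_top_of_le_ne_top ENNReal.ofReal_ne_top h
        exact ⟨hL.mem_stab_of_cost_ne_top hne, ENNReal.toReal_le_of_le_ofReal hc h⟩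
    obtain ⟨ρ, hρ, -, hco⟩ := hL.exists_norm_sq_le_cost
    rw [h1]
    refine Metric.isCompact_of_isClosed_isBounded
      (hL.lowerSemicontinuous_cost.isClosed_preimage _) ?_
    refine (Metric.isBounded_closedBall (x := (0 : Gain m n)) (r := √(c / ρ))).subset
      fun K hK => ?_
    rw [mem_closedBall_zero_iff]
    refine Real.le_sqrt_of_sq_le ?_
    rw [le_div_iff₀ hρ, mul_comm]
    exact (ENNReal.ofReal_le_ofReal_iff hc).1 ((hco K).trans hK)

theorem Standing.exists_isMinOn (hL : L.Standing Cm) :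
    ∃ K ∈ L.stab, ∀ K' ∈ L.stab, L.J K ≤ L.J K' := by
  obtain ⟨F, hF⟩ := hL.stabilizable
  have hF' : Gain.ofMat F ∈ L.stab := hF
  have hcont : ContinuousOn L.J {K | K ∈ L.stab ∧ L.J K ≤ L.J (Gain.ofMat F)} := fun K hK =>
    (hL.contDiffAt_J (k := 0) hK.1).continuousAt.continuousWithinAt
  obtain ⟨K, hK, hmin⟩ := (hL.isCompact_sublevel (L.J (Gain.ofMat F))).exists_isMinOn
    ⟨_, hF', le_rfl⟩ hcont
  refine ⟨K, hK.1, fun K' hK' => ?_⟩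
  rcases le_total (L.J K') (L.J (Gain.ofMat F)) with h | h
  · exact hmin ⟨hK', h⟩
  · exact hK.2.trans h

/-- The Riccati equation has a positive semidefinite solution: the cost-to-go of a minimizer of the
cost, whose first-order condition is the vanishing of `bellmanGrad`. -/
theorem Standing.isDARE_Pstar (hL : L.Standing Cm) : L.IsDARE L.Pstar := by
  obtain ⟨K, hK, hmin⟩ := hL.exists_isMinOn
  have hloc : IsLocalMin L.J K := by
    filter_upwards [L.isOpen_stab.mem_nhds hK] with K' hK'
    exact hmin K' hK'
  have hg : gradient L.J K = 0 := by
    rw [gradient, hloc.fderiv_eq_zero, map_zero]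
  have h1 := hL.norm_bellmanGrad_le hK
  rw [hg, norm_zero] at h1
  have h2 : Gain.ofMat (L.bellmanGrad (L.costMat K) K) = 0 := by
    rw [← norm_eq_zero]
    nlinarith [norm_nonneg (Gain.ofMat (L.bellmanGrad (L.costMat K) K))]
  have h3 : L.bellmanGrad (L.costMat K) K = 0 := by
    have := congrArg Gain.mat h2
    rwa [Gain.mat_ofMat] at this
  refine Classical.epsilon_spec (p := L.IsDARE) ⟨L.costMat K, ?_⟩
  exact (isDARE_iff_of_bellmanGrad_eq_zero hL (hL.posSemidef_costMat hK) h3).2 (costMat_spec hK)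

theorem Standing.bellmanGrad_Kstar (hL : L.Standing Cm) : L.bellmanGrad L.Pstar L.Kstar = 0 :=
  (bellmanGrad_eq_zero_iff hL hL.isDARE_Pstar.1 _).2 rfl

theorem Standing.Kstar_mem_stab (hL : L.Standing Cm) : L.Kstar ∈ L.stab :=
  (hL.stab_of_isDARE hL.isDARE_Pstar hL.bellmanGrad_Kstar).1

theorem Standing.gap_nonneg (hL : L.Standing Cm) {K : Gain m n} (hK : K ∈ L.stab) :
    0 ≤ L.gap K := by
  have hs := hL.Kstar_mem_stab
  obtain ⟨D, rfl⟩ : ∃ D, K = L.Kstar + D := ⟨K - L.Kstar, by abel⟩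
  rw [gap, hL.J_add_sub hs hK, (hL.stab_of_isDARE hL.isDARE_Pstar hL.bellmanGrad_Kstar).2,
    hL.bellmanGrad_Kstar]
  rw [Matrix.mul_zero, Matrix.transpose_zero, Matrix.zero_mul, add_zero, zero_add]
  have h := (hL.posDef_hessian hL.isDARE_Pstar.1).posSemidef.conjTranspose_mul_mul_same D.mat
  rw [Matrix.conjTranspose_eq_transpose_of_trivial] at h
  exact h.trace_mul_nonneg (posSemidef_corrMat hK)

/-- The Polyak–Łojasiewicz inequality, by completing the square in the cost difference of `K` and
`K⋆`. -/
theorem Standing.exists_isPL (hL : L.Standing Cm) : ∃ mu, L.IsPL mu := by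
  obtain ⟨ρ, hρ, hR, -⟩ := hL.exists_norm_sq_le_cost
  have hs := hL.Kstar_mem_stab
  have hS := posSemidef_corrMat hs
  set S := L.corrMat L.Kstar with hSdef
  have hS0 := hS.trace_nonneg
  refine ⟨4 * ρ / (S.trace + 1), by positivity, fun K hK => ?_⟩
  obtain ⟨D, hD⟩ : ∃ D, L.Kstar = K + D := ⟨L.Kstar - K, by abel⟩
  have hJ := hL.J_add_sub (D := D) hK (hD ▸ hs)
  rw [← hD, ← hSdef] at hJ
  have hP := hL.posSemidef_costMat hK
  set G := L.bellmanGrad (L.costMat K) K with hG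
  set H := L.Bᵀ * L.costMat K * L.B + L.R with hH
  have hHp := hL.posDef_hessian hP
  rw [← hH] at hHp
  have hHt : Hᵀ = H := by
    have := hHp.1
    rwa [Matrix.IsHermitian, Matrix.conjTranspose_eq_transpose_of_trivial] at this
  have hHlow : ∀ z : Fin m → ℝ, ρ * (z ⬝ᵥ z) ≤ z ⬝ᵥ H *ᵥ z := fun z => by
    have h1 := hP.conjTranspose_mul_mul_same L.B
    rw [Matrix.conjTranspose_eq_transpose_of_trivial] at h1
    have h2 := h1.dotProduct_nonneg z
    rw [hH, Matrix.add_mulVec, dotProduct_add]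
    linarith [hR z]
  have hpsd : ((D.matᵀ * G + Gᵀ * D.mat + D.matᵀ * H * D.mat) + ρ⁻¹ • (Gᵀ * G)).PosSemidef := by
    refine Matrix.PosSemidef.of_dotProduct_mulVec_nonneg ?_ fun z => ?_
    · rw [Matrix.IsHermitian, Matrix.conjTranspose_eq_transpose_of_trivial]
      simp only [Matrix.transpose_add, Matrix.transpose_mul, Matrix.transpose_transpose,
        Matrix.transpose_smul, hHt, Matrix.mul_assoc]
      abel
    · have e1 : ∀ X Y : Matrix (Fin m) (Fin n) ℝ, z ⬝ᵥ (Xᵀ * Y) *ᵥ z = (X *ᵥ z) ⬝ᵥ (Y *ᵥ z) := by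
        intro X Y
        rw [← Matrix.mulVec_mulVec, Matrix.dotProduct_mulVec, Matrix.vecMul_transpose]
      rw [star_trivial, Matrix.add_mulVec, Matrix.add_mulVec, Matrix.add_mulVec, dotProduct_add,
        dotProduct_add, dotProduct_add, Matrix.smul_mulVec, dotProduct_smul, Matrix.mul_assoc,
        e1, e1, e1, e1, smul_eq_mul, ← Matrix.mulVec_mulVec]
      have h1 := hHlow (D.mat *ᵥ z)
      set p := D.mat *ᵥ z
      set q := G *ᵥ z
      have h2 : 0 ≤ (ρ • p + q) ⬝ᵥ (ρ • p + q) := Finset.sum_nonneg fun _ _ => mul_self_nonneg _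
      have h3 : (ρ • p + q) ⬝ᵥ (ρ • p + q) =
          ρ * (ρ * (p ⬝ᵥ p) + 2 * (p ⬝ᵥ q) + ρ⁻¹ * (q ⬝ᵥ q)) := by
        rw [add_dotProduct, dotProduct_add, dotProduct_add, smul_dotProduct, smul_dotProduct,
          dotProduct_smul, dotProduct_smul, dotProduct_comm q p]
        simp only [smul_eq_mul]
        field_simp
        ring
      rw [h3] at h2
      have h4 := nonneg_of_mul_nonneg_right h2 hρ
      rw [dotProduct_comm q p]
      linarith
  have h5 := hpsd.trace_mul_nonneg hS
  rw [Matrix.add_mul, Matrix.trace_add, ← hJ, Matrix.smul_mul, Matrix.trace_smul,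
    smul_eq_mul] at h5
  have h6 := (posSemidef_transpose_mul_self G).trace_mul_le hS
  have h7 := hL.norm_bellmanGrad_le hK
  rw [Gain.norm_sq_eq_trace, Gain.mat_ofMat] at h7
  have h8 := (posSemidef_transpose_mul_self G).trace_nonneg
  have h9 : L.gap K ≤ ρ⁻¹ * ((Gᵀ * G).trace * S.trace) := by
    rw [gap]
    have := mul_le_mul_of_nonneg_left h6 (inv_pos.2 hρ).le
    linarith
  have h10 : 4 * ρ / (S.trace + 1) * L.gap K ≤
      4 * ρ / (S.trace + 1) * (ρ⁻¹ * ((Gᵀ * G).trace * S.trace)) :=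
    mul_le_mul_of_nonneg_left h9 (by positivity)
  refine h10.trans (le_trans ?_ h7)
  have h11 : 4 * ρ / (S.trace + 1) * (ρ⁻¹ * ((Gᵀ * G).trace * S.trace)) =
      4 * (Gᵀ * G).trace * (S.trace / (S.trace + 1)) := by
    field_simp
  rw [h11]
  have h12 : S.trace / (S.trace + 1) ≤ 1 := by
    rw [div_le_one (by positivity)]
    linarith
  nlinarith

end LQR

/-! ### Existence of the constants -/

section CompactLipschitz

theorem exists_lipschitz_const_of_isCompact {V F : Type*} [NormedAddCommGroup V] [NormedSpace ℝ V]
    [NormedAddCommGroup F] [NormedSpace ℝ F] {f : V → F} {T : Set V} (hT : IsCompact T)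
    (hf : ∀ v ∈ T, ContDiffAt ℝ 1 f v) :
    ∃ C : ℝ, 0 < C ∧ ∀ v c, Metric.closedBall v c ⊆ T → ∀ w, ‖w - v‖ ≤ c →
      ‖f w - f v‖ ≤ C * ‖w - v‖ := by
  have hcont : ContinuousOn (fderiv ℝ f) T := fun v hv =>
    ((hf v hv).fderiv_right (m := 0) (by simp)).continuousAt.continuousWithinAt
  obtain ⟨C, hC⟩ := (hT.image_of_continuousOn hcont).isBounded.exists_norm_le
  refine ⟨max C 1, by positivity, fun v c hvc w hw => ?_⟩
  refine (convex_closedBall v c).norm_image_sub_le_of_norm_fderiv_le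
    (fun u hu => (hf u (hvc hu)).differentiableAt (by simp))
    (fun u hu => (hC _ ⟨u, hvc hu, rfl⟩).trans (le_max_left _ _)) ?_ ?_
  · rw [Metric.mem_closedBall, dist_self]
    exact (norm_nonneg _).trans hw
  · rwa [mem_closedBall_iff_norm]

end CompactLipschitz

namespace LQR

variable {n m : ℕ} {L : LQR n m} {Cm : ℝ}

theorem Standing.contDiffAt_gradient_J (hL : L.Standing Cm) {K : Gain m n} (hK : K ∈ L.stab) :
    ContDiffAt ℝ 1 (gradient L.J) K :=
  (InnerProductSpace.toDual ℝ (Gain m n)).symm.contDiff.contDiffAt.comp K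
    ((hL.contDiffAt_J (k := 2) hK).fderiv_right (by norm_num))

theorem contDiffAt_costMat_coord {k : WithTop ℕ∞} {K : Gain m n} (hK : K ∈ L.stab) :
    ContDiffAt ℝ k (fun K' (i j : Fin n) => L.costMat K' i j) K := by
  open scoped Matrix.Norms.Operator in
  refine contDiffAt_pi.2 fun i => contDiffAt_pi.2 fun j => ?_
  exact (contDiffAt_costMat hK).linear_matrix
    { toFun := fun X => X i j
      map_add' := fun _ _ => rfl
      map_smul' := fun _ _ => rfl }

/-- Uniform local constants on a compact set of stabilizing gains, from a compact neighbourhood of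
it on which the smooth functions `J`, `∇J` and `K ↦ P_K` have bounded derivatives. -/
theorem Standing.exists_uniform_constants (hL : L.Standing Cm) {S : Set (Gain m n)}
    (hS : IsCompact S) (hSs : S ⊆ L.stab) :
    ∃ lam lamT phi c : ℝ, (0 < lam ∧ 0 < lamT ∧ 0 < phi ∧ 0 < c) ∧
      ∀ K ∈ S, ∀ K', ‖K' - K‖ ≤ c → K' ∈ L.stab ∧ |L.J K' - L.J K| ≤ lam * ‖K' - K‖ ∧
        (∀ x : Fin n → ℝ, x ⬝ᵥ x ≤ Cm → |L.J₁ K' x - L.J₁ K x| ≤ lamT * ‖K' - K‖) ∧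
        ‖gradient L.J K' - gradient L.J K‖ ≤ phi * ‖K' - K‖ := by
  obtain ⟨c, hc, hcs⟩ := hS.exists_cthickening_subset_open L.isOpen_stab hSs
  have hT : IsCompact (Metric.cthickening c S) := hS.cthickening
  obtain ⟨C₁, hC₁, h₁⟩ := exists_lipschitz_const_of_isCompact hT
    fun K hK => hL.contDiffAt_J (hcs hK)
  obtain ⟨C₂, hC₂, h₂⟩ := exists_lipschitz_const_of_isCompact hT
    fun K hK => contDiffAt_costMat_coord (hcs hK)
  obtain ⟨C₃, hC₃, h₃⟩ := exists_lipschitz_const_of_isCompact hT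
    fun K hK => hL.contDiffAt_gradient_J (hcs hK)
  have hCm := hL.Cm_pos
  refine ⟨C₁, n * n * (C₂ * Cm) + 1, C₃, c, ⟨hC₁, by positivity, hC₃, hc⟩,
    fun K hK K' hK' => ?_⟩
  have hball : Metric.closedBall K c ⊆ Metric.cthickening c S :=
    Metric.closedBall_subset_cthickening hK c
  have hKs := hSs hK
  have hK's : K' ∈ L.stab := hcs (hball (mem_closedBall_iff_norm.2 hK'))
  refine ⟨hK's, h₁ K c hball K' hK', fun x hx => ?_, h₃ K c hball K' hK'⟩
  have h4 := h₂ K c hball K' hK'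
  rw [hL.J₁_eq hKs, hL.J₁_eq hK's, ← dotProduct_sub, ← Matrix.sub_mulVec, dotProduct_mulVec_eq_sum]
  have h5 : ∀ i j, |(L.costMat K' - L.costMat K) i j * (x i * x j)| ≤
      C₂ * ‖K' - K‖ * Cm := fun i j => by
    rw [abs_mul]
    have h6 : |(L.costMat K' - L.costMat K) i j| ≤ C₂ * ‖K' - K‖ := by
      refine le_trans ?_ h4
      refine le_trans ?_ (norm_le_pi_norm _ i)
      exact norm_le_pi_norm (fun j => (L.costMat K' - L.costMat K) i j) j
    exact mul_le_mul h6 ((abs_mul_le_dotProduct_self x i j).trans hx) (abs_nonneg _) (by positivity)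
  calc _ ≤ ∑ _i : Fin n, ∑ _j : Fin n, C₂ * ‖K' - K‖ * Cm :=
        (Finset.abs_sum_le_sum_abs _ _).trans (Finset.sum_le_sum fun i _ =>
          (Finset.abs_sum_le_sum_abs _ _).trans (Finset.sum_le_sum fun j _ => h5 i j))
    _ = n * n * (C₂ * Cm) * ‖K' - K‖ := by
      simp
      ring
    _ ≤ _ := by nlinarith [norm_nonneg (K' - K)]

theorem Standing.isCompact_sublevel_gap (hL : L.Standing Cm) (K₀ : Gain m n) :
    IsCompact (L.sublevel K₀) := by
  convert hL.isCompact_sublevel (L.J L.Kstar + 10 * L.gap K₀) using 1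
  ext K
  simp only [sublevel, gap, Set.mem_ofPred_eq]
  exact and_congr_right fun _ => ⟨fun h => by linarith, fun h => by linarith⟩

theorem Standing.mem_sublevel_self (hL : L.Standing Cm) {K₀ : Gain m n} (hK₀ : K₀ ∈ L.stab) :
    K₀ ∈ L.sublevel K₀ := ⟨hK₀, by linarith [hL.gap_nonneg hK₀]⟩

theorem Standing.exists_regularityConstants (hL : L.Standing Cm) {K₀ : Gain m n}
    (hK₀ : K₀ ∈ L.stab) : ∃ mu lam0 lamT0 phi0 rho0 : ℝ,
      L.RegularityConstants K₀ mu lam0 lamT0 phi0 rho0 ∧ 0 < rho0 := by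
  obtain ⟨mu, hmu⟩ := hL.exists_isPL
  obtain ⟨a, b, p, c, hpos, hu⟩ := hL.exists_uniform_constants
    (hL.isCompact_sublevel_gap K₀) fun K hK => hK.1
  -- the uniform constants on the compact sublevel set, arbitrary ones at the other gains
  have hloc : ∀ K, ∃ lam lamT phi z : ℝ, (K ∈ L.stab →
      (0 < lam ∧ 0 < lamT ∧ 0 < phi ∧ 0 < z) ∧
      (∀ K', ‖K' - K‖ ≤ z → K' ∈ L.stab ∧ |L.J K' - L.J K| ≤ lam * ‖K' - K‖ ∧
        (∀ x : Fin n → ℝ, x ⬝ᵥ x ≤ Cm → |L.J₁ K' x - L.J₁ K x| ≤ lamT * ‖K' - K‖) ∧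
        ‖gradient L.J K' - gradient L.J K‖ ≤ phi * ‖K' - K‖)) ∧
      (K ∈ L.sublevel K₀ → lam = a ∧ lamT = b ∧ phi = p ∧ z = c) := by
    intro K
    by_cases hK : K ∈ L.sublevel K₀
    · exact ⟨a, b, p, c, fun _ => ⟨hpos, hu K hK⟩, fun _ => ⟨rfl, rfl, rfl, rfl⟩⟩
    by_cases hKs : K ∈ L.stab
    · obtain ⟨a', b', p', c', hpos', hu'⟩ := hL.exists_uniform_constants
        (isCompact_singleton (x := K)) (Set.singleton_subset_iff.2 hKs)
      exact ⟨a', b', p', c', fun _ => ⟨hpos', hu' K rfl⟩, fun h => absurd h hK⟩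
    · exact ⟨1, 1, 1, 1, fun h => absurd h hKs, fun h => absurd h hK⟩
  choose lam lamT phi z hloc heq using hloc
  have himage : ∀ (f : Gain m n → ℝ) (v : ℝ), (∀ K ∈ L.sublevel K₀, f K = v) →
      f '' L.sublevel K₀ = {v} := fun f v h => by
    rw [Set.image_congr h]
    exact Set.Nonempty.image_const ⟨K₀, hL.mem_sublevel_self hK₀⟩ v
  refine ⟨mu, a, b, p, c, ⟨hmu, lam, lamT, z, phi, z, ⟨fun K hK => ?_, fun K hK K' hK' => ?_,
    fun K hK => ?_, fun K hK K' hK' => ?_⟩, ?_, ?_, ?_, ?_⟩, hpos.2.2.2⟩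
  · obtain ⟨⟨h1, h2, h3, h4⟩, -⟩ := hloc K hK
    exact ⟨h1, h2, h4, h3, h4⟩
  · obtain ⟨h1, h2, -⟩ := (hloc K hK).2 K' hK'
    exact ⟨h1, h2⟩
  · filter_upwards [hL.bounded] with x hx K' hK'
    exact ((hloc K hK).2 K' hK').2.2.1 x hx
  · obtain ⟨h1, -, -, h2⟩ := (hloc K hK).2 K' hK'
    exact ⟨h1, h2⟩
  · rw [himage lam a fun K hK => (heq K hK).1]
    exact isLUB_singleton
  · rw [himage lamT b fun K hK => (heq K hK).2.1]
    exact isLUB_singleton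
  · rw [himage phi p fun K hK => (heq K hK).2.2.1]
    exact isLUB_singleton
  · rw [himage _ c fun K hK => by rw [min_self]; exact (heq K hK).2.2.2]
    exact isGLB_singleton

end LQR

/-! ### Descent on the sublevel set -/

section Descent

variable {V : Type*} [NormedAddCommGroup V] [InnerProductSpace ℝ V] [CompleteSpace V]

/-- The descent inequality along a segment on which the gradient is Lipschitz relative to the base
point. -/
theorem le_add_inner_gradient_of_lipschitz {f : V → ℝ} {v w : V} {φ T : ℝ}
    (hd : ∀ t ∈ Set.Icc 0 T, DifferentiableAt ℝ f (v + t • w))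
    (hg : ∀ t ∈ Set.Icc 0 T, ‖gradient f (v + t • w) - gradient f v‖ ≤ φ * (t * ‖w‖))
    {t : ℝ} (ht : t ∈ Set.Icc 0 T) :
    f (v + t • w) ≤ f v + t * inner ℝ (gradient f v) w + φ * t ^ 2 / 2 * ‖w‖ ^ 2 := by
  have hder : ∀ s ∈ Set.Icc 0 T, HasDerivAt (fun s : ℝ =>
      f (v + s • w) - (s * inner ℝ (gradient f v) w + φ * s ^ 2 / 2 * ‖w‖ ^ 2))
      (inner ℝ (gradient f (v + s • w)) w -
        (inner ℝ (gradient f v) w + φ * s * ‖w‖ ^ 2)) s := by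
    intro s hs
    have h1 : HasDerivAt (fun s : ℝ => v + s • w) w s := by
      simpa using ((hasDerivAt_id s).smul_const w).const_add v
    have h2 := (hd s hs).hasFDerivAt.comp_hasDerivAt s h1
    have h3 : fderiv ℝ f (v + s • w) w = inner ℝ (gradient f (v + s • w)) w := by
      rw [gradient, InnerProductSpace.toDual_symm_apply]
    rw [h3] at h2
    have h4 : HasDerivAt (fun s : ℝ => s * inner ℝ (gradient f v) w + φ * s ^ 2 / 2 * ‖w‖ ^ 2)
        (inner ℝ (gradient f v) w + φ * s * ‖w‖ ^ 2) s := by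
      have h5 := (((hasDerivAt_pow 2 s).const_mul φ).div_const 2).mul_const (‖w‖ ^ 2)
      have h6 := ((hasDerivAt_id s).mul_const (inner ℝ (gradient f v) w)).add h5
      have h7 : inner ℝ (gradient f v) w + φ * s * ‖w‖ ^ 2 =
          1 * inner ℝ (gradient f v) w + φ * ((2 : ℕ) * s ^ (2 - 1)) / 2 * ‖w‖ ^ 2 := by
        push_cast
        ring
      rw [h7]
      exact h6
    exact h2.sub h4
  have hanti := antitoneOn_of_deriv_nonpos (convex_Icc 0 T)
    (fun s hs => (hder s hs).continuousAt.continuousWithinAt)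
    (fun s hs => (hder s (interior_subset hs)).differentiableAt.differentiableWithinAt)
    (fun s hs => by
      rw [(hder s (interior_subset hs)).deriv, ← sub_sub, ← inner_sub_left]
      have h1 := real_inner_le_norm (gradient f (v + s • w) - gradient f v) w
      have h2 := mul_le_mul_of_nonneg_right (hg s (interior_subset hs)) (norm_nonneg w)
      nlinarith)
  have h := hanti (Set.left_mem_Icc.2 (ht.1.trans ht.2)) ht ht.1
  simp only [zero_smul, add_zero, zero_mul, ne_eq, OfNat.ofNat_ne_zero, not_false_eq_true,
    zero_pow, mul_zero, zero_div, sub_zero] at h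
  linarith

end Descent

namespace LQR

variable {n m : ℕ} {L : LQR n m} {Cm : ℝ} {K₀ : Gain m n} {mu lam0 lamT0 phi0 rho0 : ℝ}

namespace RegularityConstants

theorem phi_pos (hR : L.RegularityConstants K₀ mu lam0 lamT0 phi0 rho0) {K : Gain m n}
    (hK : K ∈ L.sublevel K₀) : 0 < phi0 := by
  obtain ⟨-, lam, lamT, zeta, phi, beta, hloc, -, -, h, -⟩ := hR
  exact (hloc.pos K hK.1).2.2.2.1.trans_le (h.1 ⟨K, hK, rfl⟩)

theorem lamT_pos (hR : L.RegularityConstants K₀ mu lam0 lamT0 phi0 rho0) {K : Gain m n}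
    (hK : K ∈ L.sublevel K₀) : 0 < lamT0 := by
  obtain ⟨-, lam, lamT, zeta, phi, beta, hloc, -, h, -, -⟩ := hR
  exact (hloc.pos K hK.1).2.1.trans_le (h.1 ⟨K, hK, rfl⟩)

theorem smooth (hR : L.RegularityConstants K₀ mu lam0 lamT0 phi0 rho0) {K K' : Gain m n}
    (hK : K ∈ L.sublevel K₀) (h : ‖K' - K‖ ≤ rho0) :
    K' ∈ L.stab ∧ ‖gradient L.J K' - gradient L.J K‖ ≤ phi0 * ‖K' - K‖ := by
  obtain ⟨-, lam, lamT, zeta, phi, beta, hloc, -, -, hphi, hrho⟩ := hR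
  have h1 : rho0 ≤ beta K := (hrho.1 ⟨K, hK, rfl⟩).trans (min_le_left _ _)
  obtain ⟨h2, h3⟩ := hloc.smooth K hK.1 K' (h.trans h1)
  exact ⟨h2, h3.trans (mul_le_mul_of_nonneg_right (hphi.1 ⟨K, hK, rfl⟩) (norm_nonneg _))⟩

theorem lipschitz_from (hR : L.RegularityConstants K₀ mu lam0 lamT0 phi0 rho0) {K : Gain m n}
    (hK : K ∈ L.sublevel K₀) : ∀ᵐ x ∂L.init, ∀ K', ‖K' - K‖ ≤ rho0 →
      |L.J₁ K' x - L.J₁ K x| ≤ lamT0 * ‖K' - K‖ := by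
  obtain ⟨-, lam, lamT, zeta, phi, beta, hloc, -, hlam, -, hrho⟩ := hR
  have h1 : rho0 ≤ zeta K := (hrho.1 ⟨K, hK, rfl⟩).trans (min_le_right _ _)
  filter_upwards [hloc.lipschitz_from K hK.1] with x hx K' hK'
  exact (hx K' (hK'.trans h1)).trans
    (mul_le_mul_of_nonneg_right (hlam.1 ⟨K, hK, rfl⟩) (norm_nonneg _))

theorem descent (hL : L.Standing Cm) (hR : L.RegularityConstants K₀ mu lam0 lamT0 phi0 rho0)
    {K D : Gain m n} (hK : K ∈ L.sublevel K₀) (h : ‖D‖ ≤ rho0) :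
    L.gap (K + D) ≤ L.gap K + inner ℝ (gradient L.J K) D + phi0 / 2 * ‖D‖ ^ 2 := by
  have hle : ∀ t ∈ Set.Icc (0 : ℝ) 1, ‖K + t • D - K‖ ≤ t * ‖D‖ := fun t ht => by
    rw [add_sub_cancel_left, norm_smul, Real.norm_of_nonneg ht.1]
  have hle' : ∀ t ∈ Set.Icc (0 : ℝ) 1, ‖K + t • D - K‖ ≤ rho0 := fun t ht =>
    ((hle t ht).trans (mul_le_of_le_one_left (norm_nonneg _) ht.2)).trans h
  have h1 := le_add_inner_gradient_of_lipschitz (f := L.J) (v := K) (w := D) (φ := phi0) (T := 1)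
    (fun t ht => (hL.contDiffAt_J (k := 1) (hR.smooth hK (hle' t ht)).1).differentiableAt
      (by simp))
    (fun t ht => (hR.smooth hK (hle' t ht)).2.trans
      (mul_le_mul_of_nonneg_left (hle t ht) (hR.phi_pos hK).le))
    (t := 1) (by simp)
  rw [one_smul, one_mul, one_pow, mul_one] at h1
  rw [gap, gap]
  linarith

/-- A gradient step of length `1 / φ` decreases the cost by `‖∇J‖² / (2 φ)`, even if it is longer
than the radius `ρ₀` of the local bounds: it is made of short steps, along which the iterates remain
in the sublevel set. Hence the gap dominates the squared gradient. -/
theorem norm_gradient_sq_le (hL : L.Standing Cm)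
    (hR : L.RegularityConstants K₀ mu lam0 lamT0 phi0 rho0) (hrho : 0 < rho0) {K : Gain m n}
    (hK : K ∈ L.sublevel K₀) : ‖gradient L.J K‖ ^ 2 ≤ 2 * phi0 * L.gap K := by
  have hφ := hR.phi_pos hK
  set v := gradient L.J K with hv
  have hin : inner ℝ v (-v) = -‖v‖ ^ 2 := by rw [inner_neg_right, real_inner_self_eq_norm_sq]
  obtain ⟨h, hh, hhg⟩ : ∃ h : ℝ, 0 < h ∧ h * ‖v‖ ≤ rho0 := by
    refine ⟨rho0 / (‖v‖ + 1), by positivity, ?_⟩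
    rw [div_mul_eq_mul_div, div_le_iff₀ (by positivity)]
    nlinarith [norm_nonneg v]
  have hdesc : ∀ T : ℝ, (∀ t ∈ Set.Icc 0 T, K + t • -v ∈ L.stab ∧
      ‖gradient L.J (K + t • -v) - v‖ ≤ phi0 * (t * ‖v‖)) → 0 ≤ T →
      L.J (K + T • -v) ≤ L.J K - T * ‖v‖ ^ 2 + phi0 * T ^ 2 / 2 * ‖v‖ ^ 2 := by
    intro T hT hT0
    have h1 := le_add_inner_gradient_of_lipschitz (f := L.J) (v := K) (w := -v) (φ := phi0) (T := T)
      (fun t ht => (hL.contDiffAt_J (k := 1) (hT t ht).1).differentiableAt (by simp))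
      (fun t ht => by rw [norm_neg]; exact (hT t ht).2) (t := T) ⟨hT0, le_rfl⟩
    rw [← hv, hin, norm_neg] at h1
    linarith
  have hind : ∀ j : ℕ, ∀ t : ℝ, 0 ≤ t → t ≤ j * h → t * phi0 ≤ 1 →
      K + t • -v ∈ L.sublevel K₀ ∧ ‖gradient L.J (K + t • -v) - v‖ ≤ phi0 * (t * ‖v‖) := by
    intro j
    induction j with
    | zero =>
      intro t ht0 ht1 _
      have : t = 0 := le_antisymm (by simpa using ht1) ht0
      subst this
      simpa [← hv] using hK
    | succ j ih =>
      intro t ht0 ht1 ht2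
      rcases le_total t (j * h) with htj | htj
      · exact ih t ht0 htj ht2
      have hj0 : (0 : ℝ) ≤ j * h := by positivity
      obtain ⟨hS, hSg⟩ := ih (j * h) hj0 le_rfl
        ((mul_le_mul_of_nonneg_right htj hφ.le).trans ht2)
      have hall : ∀ s ∈ Set.Icc 0 t, K + s • -v ∈ L.stab ∧
          ‖gradient L.J (K + s • -v) - v‖ ≤ phi0 * (s * ‖v‖) := by
        intro s hs
        rcases le_total s (j * h) with hsj | hsj
        · obtain ⟨h1, h2⟩ := ih s hs.1 hsj ((mul_le_mul_of_nonneg_right hs.2 hφ.le).trans ht2)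
          exact ⟨h1.1, h2⟩
        have hd : ‖K + s • -v - (K + (j * h) • -v)‖ = (s - j * h) * ‖v‖ := by
          rw [add_sub_add_left_eq_sub, ← sub_smul, norm_smul, norm_neg,
            Real.norm_of_nonneg (sub_nonneg.2 hsj)]
        have hd' : ‖K + s • -v - (K + (j * h) • -v)‖ ≤ rho0 := by
          rw [hd]
          refine le_trans (mul_le_mul_of_nonneg_right ?_ (norm_nonneg _)) hhg
          push_cast at ht1
          linarith [hs.2]
        obtain ⟨h1, h2⟩ := hR.smooth hS hd'
        refine ⟨h1, ?_⟩
        rw [hd] at h2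
        have h3 := norm_sub_le_norm_sub_add_norm_sub (gradient L.J (K + s • -v))
          (gradient L.J (K + (j * h) • -v)) v
        linarith
      have hJ := hdesc t hall ht0
      refine ⟨⟨(hall t ⟨ht0, le_rfl⟩).1, ?_⟩, (hall t ⟨ht0, le_rfl⟩).2⟩
      have h1 : phi0 * t ^ 2 / 2 * ‖v‖ ^ 2 ≤ t * ‖v‖ ^ 2 := by
        refine mul_le_mul_of_nonneg_right ?_ (sq_nonneg _)
        nlinarith
      have h2 := hK.2
      rw [gap] at h2 ⊢
      linarith
  obtain ⟨N, hN⟩ := exists_nat_ge (1 / phi0 / h)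
  rw [div_le_iff₀ hh] at hN
  have h1 : 1 / phi0 * phi0 = 1 := by field_simp
  have hall : ∀ t ∈ Set.Icc 0 (1 / phi0), K + t • -v ∈ L.sublevel K₀ ∧
      ‖gradient L.J (K + t • -v) - v‖ ≤ phi0 * (t * ‖v‖) := fun t ht =>
    hind N t ht.1 (ht.2.trans hN) ((mul_le_mul_of_nonneg_right ht.2 hφ.le).trans h1.le)
  have h2 := hdesc (1 / phi0) (fun t ht => ⟨(hall t ht).1.1, (hall t ht).2⟩) (by positivity)
  have h3 := hL.gap_nonneg (hall (1 / phi0) ⟨by positivity, le_rfl⟩).1.1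
  rw [gap] at h3
  have h4 : 1 / phi0 * ‖v‖ ^ 2 - phi0 * (1 / phi0) ^ 2 / 2 * ‖v‖ ^ 2 = ‖v‖ ^ 2 / (2 * phi0) := by
    field_simp
    ring
  have h5 : ‖v‖ ^ 2 / (2 * phi0) ≤ L.gap K := by
    rw [gap]
    linarith
  rw [div_le_iff₀ (by positivity)] at h5
  linarith

theorem mu_le (hL : L.Standing Cm) (hR : L.RegularityConstants K₀ mu lam0 lamT0 phi0 rho0)
    (hrho : 0 < rho0) {K : Gain m n} (hK : K ∈ L.sublevel K₀) (hgap : 0 < L.gap K) :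
    mu ≤ 2 * phi0 :=
  le_of_mul_le_mul_right ((hR.1.2 K hK.1).trans (hR.norm_gradient_sq_le hL hrho hK)) hgap

/-- Perturbing a gain by a step of length `r` increases the square root of its gap by at most
`r √(φ / 2)`. -/
theorem gap_add_le (hL : L.Standing Cm) (hR : L.RegularityConstants K₀ mu lam0 lamT0 phi0 rho0)
    {K D : Gain m n} (hK : K ∈ L.sublevel K₀) (hD : ‖D‖ ≤ rho0) {c : ℝ} (hc : 0 ≤ c)
    (hDc : phi0 / 2 * ‖D‖ ^ 2 ≤ c ^ 2) : L.gap (K + D) ≤ (√(L.gap K) + c) ^ 2 := by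
  have h1 := hR.descent hL hK hD
  rcases eq_or_ne D 0 with rfl | hD0
  · have h2 := Real.sq_sqrt (hL.gap_nonneg hK.1)
    have h3 := Real.sqrt_nonneg (L.gap K)
    rw [add_zero]
    nlinarith
  have hrho : 0 < rho0 := (norm_pos_iff.2 hD0).trans_le hD
  have h2 := hR.norm_gradient_sq_le hL hrho hK
  have ha := hL.gap_nonneg hK.1
  have h3 := real_inner_le_norm (gradient L.J K) D
  have h4 : ‖gradient L.J K‖ * ‖D‖ ≤ 2 * (√(L.gap K) * c) := by
    refine abs_le_of_sq_le_sq' ?_ (by positivity) |>.2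
    have h5 : (2 * (√(L.gap K) * c)) ^ 2 = 4 * (L.gap K * c ^ 2) := by
      rw [mul_pow, mul_pow, Real.sq_sqrt ha]
      ring
    rw [h5, mul_pow]
    calc ‖gradient L.J K‖ ^ 2 * ‖D‖ ^ 2 ≤ 2 * phi0 * L.gap K * ‖D‖ ^ 2 :=
          mul_le_mul_of_nonneg_right h2 (sq_nonneg _)
      _ = 4 * (L.gap K * (phi0 / 2 * ‖D‖ ^ 2)) := by ring
      _ ≤ _ := by gcongr
  have h6 := Real.sq_sqrt ha
  nlinarith

end RegularityConstants

end LQR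

/-! ### The gradient estimators -/

namespace LQR

open Filter Topology

variable {n m : ℕ} {L : LQR n m} {Cm : ℝ} {K₀ : Gain m n} {mu lam0 lamT0 phi0 rho0 : ℝ}

section Measurability

variable (L)

theorem measurable_costFrom :
    Measurable fun p : Gain m n × (Fin n → ℝ) => L.costFrom p.1 p.2 := by
  have h1 := L.continuous_closedLoop
  have h2 := continuous_mat (m := m) (n := n)
  unfold costFrom stageCost state
  refine Measurable.tsum fun t => (ENNReal.continuous_ofReal.comp ?_).measurable
  fun_prop

theorem measurable_J₁ : Measurable fun p : Gain m n × (Fin n → ℝ) => L.J₁ p.1 p.2 :=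
  L.measurable_costFrom.ennreal_toReal

theorem measurable_J (hL : L.Standing Cm) : Measurable L.J :=
  hL.lowerSemicontinuous_cost.measurable.ennreal_toReal

theorem measurable_onePoint (r : ℝ) : Measurable
    fun p : Gain m n × ((Fin n → ℝ) × Gain m n) => L.onePoint r p.1 p.2.2 p.2.1 := by
  have h : Measurable fun p : Gain m n × ((Fin n → ℝ) × Gain m n) =>
      L.J₁ (p.1 + r • p.2.2) p.2.1 :=
    L.measurable_J₁.comp (g := fun q : Gain m n × (Fin n → ℝ) => L.J₁ q.1 q.2)
      (f := fun p : Gain m n × ((Fin n → ℝ) × Gain m n) => (p.1 + r • p.2.2, p.2.1))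
      (by fun_prop)
  exact (h.mul_const _).smul (by fun_prop)

theorem measurable_twoPoint (r : ℝ) : Measurable
    fun p : Gain m n × ((Fin n → ℝ) × Gain m n) => L.twoPoint r p.1 p.2.2 p.2.1 := by
  have h : ∀ s : ℝ, Measurable fun p : Gain m n × ((Fin n → ℝ) × Gain m n) =>
      L.J₁ (p.1 + s • p.2.2) p.2.1 := fun s =>
    L.measurable_J₁.comp (g := fun q : Gain m n × (Fin n → ℝ) => L.J₁ q.1 q.2)
      (f := fun p : Gain m n × ((Fin n → ℝ) × Gain m n) => (p.1 + s • p.2.2, p.2.1))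
      (by fun_prop)
  have h' := h (-r)
  simp only [neg_smul, ← sub_eq_add_neg] at h'
  exact (((h r).sub h').mul_const _).smul (by fun_prop)

end Measurability

theorem finrank_gain : Module.finrank ℝ (Gain m n) = m * n := by simp [Gain]

theorem unifSphere_eq : unifSphere m n = sphereUnif (volume : Measure (Gain m n)) := rfl

theorem Standing.integral_J₁ (hL : L.Standing Cm) {K : Gain m n} (hK : K ∈ L.stab) :
    ∫ x, L.J₁ K x ∂L.init = L.J K := by
  simp only [hL.J₁_eq hK]
  rw [hL.integral_quadratic, hL.J_eq hK]

theorem J₁_nonneg (K : Gain m n) (x : Fin n → ℝ) : 0 ≤ L.J₁ K x := ENNReal.toReal_nonneg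

theorem Standing.J₁_le (hL : L.Standing Cm) {K : Gain m n} (hK : K ∈ L.stab) {x : Fin n → ℝ}
    (hx : x ⬝ᵥ x ≤ Cm) : L.J₁ K x ≤ Cm * L.J K := by
  have h1 := (hL.posSemidef_costMat hK).dotProduct_le_trace x
  rw [hL.J₁_eq hK, hL.J_eq hK]
  refine h1.trans ?_
  rw [mul_comm]
  exact mul_le_mul_of_nonneg_right hx (hL.posSemidef_costMat hK).trace_nonneg

theorem Standing.ae_sample (hL : L.Standing Cm) [Nontrivial (Gain m n)] :
    ∀ᵐ z ∂(L.init.prod (unifSphere m n)), z.1 ⬝ᵥ z.1 ≤ Cm ∧ ‖z.2‖ = 1 := by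
  have := hL.isProb
  have h2 : IsProbabilityMeasure (unifSphere m n) := isProbabilityMeasure_sphereUnif volume
  have h3 := Measure.quasiMeasurePreserving_fst.ae (μa := L.init.prod (unifSphere m n)) hL.bounded
  have h4 := Measure.quasiMeasurePreserving_snd.ae (μa := L.init.prod (unifSphere m n))
    (ae_norm_eq_one_sphereUnif (volume : Measure (Gain m n)))
  filter_upwards [h3, h4] with z h5 h6 using ⟨h5, h6⟩

/-- The mean of the raw estimate `J(K + s D; x) D` over both the initial state and the direction. -/
theorem Standing.integral_J₁_smul (hL : L.Standing Cm) [Nontrivial (Gain m n)] {K : Gain m n}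
    {s C : ℝ} (hs : ∀ D : Gain m n, ‖D‖ = 1 → K + s • D ∈ L.stab ∧ L.J (K + s • D) ≤ C) :
    Integrable (fun z : (Fin n → ℝ) × Gain m n => L.J₁ (K + s • z.2) z.1 • z.2)
      (L.init.prod (unifSphere m n)) ∧
    ∫ z, L.J₁ (K + s • z.2) z.1 • z.2 ∂(L.init.prod (unifSphere m n)) =
      ∫ D, L.J (K + s • D) • D ∂(unifSphere m n) := by
  have := hL.isProb
  have h2 : IsProbabilityMeasure (unifSphere m n) := isProbabilityMeasure_sphereUnif volume
  have hm : Measurable fun z : (Fin n → ℝ) × Gain m n => L.J₁ (K + s • z.2) z.1 :=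
    L.measurable_J₁.comp (g := fun q : Gain m n × (Fin n → ℝ) => L.J₁ q.1 q.2)
      (f := fun z : (Fin n → ℝ) × Gain m n => (K + s • z.2, z.1)) (by fun_prop)
  have hint : Integrable (fun z : (Fin n → ℝ) × Gain m n => L.J₁ (K + s • z.2) z.1 • z.2)
      (L.init.prod (unifSphere m n)) := by
    refine Integrable.of_bound (C := Cm * C) (hm.smul measurable_snd).aestronglyMeasurable ?_
    filter_upwards [hL.ae_sample] with z hz
    rw [norm_smul, hz.2, mul_one, Real.norm_of_nonneg (J₁_nonneg _ _)]
    exact (hL.J₁_le (hs _ hz.2).1 hz.1).trans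
      (mul_le_mul_of_nonneg_left (hs _ hz.2).2 hL.Cm_pos.le)
  refine ⟨hint, ?_⟩
  rw [integral_prod_symm _ hint]
  refine integral_congr_ae ?_
  filter_upwards [ae_norm_eq_one_sphereUnif (volume : Measure (Gain m n))] with D hD
  rw [integral_smul_const, hL.integral_J₁ (hs D hD).1]

theorem Standing.norm_sphere_gradient_le (hL : L.Standing Cm) [Nontrivial (Gain m n)]
    {K : Gain m n} {r φ : ℝ} (hr : 0 < r) (hφ : 0 ≤ φ) (hs : ∀ D : Gain m n, ‖D‖ ≤ r →
      K + D ∈ L.stab ∧ ‖gradient L.J (K + D) - gradient L.J K‖ ≤ φ * ‖D‖) :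
    ‖((m * n : ℝ) / r) • ∫ D, L.J (K + r • D) • D ∂(unifSphere m n) - gradient L.J K‖ ≤ φ * r := by
  have hgrad : ∀ D, gradient (fun D => L.J (K + D)) D = gradient L.J (K + D) := fun D => by
    rw [gradient, gradient, fderiv_comp_add_left]
  have h := norm_sphere_estimator_sub_gradient_le (volume : Measure (Gain m n))
    (f := fun D => L.J (K + D)) (r := r) (φ := φ) hr
    ((L.measurable_J hL).comp (measurable_const_add K))
    (fun D hD => by
      have h1 := (hL.contDiffAt_J (k := 1)
        (hs D (mem_closedBall_zero_iff.1 hD)).1).differentiableAt (by simp)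
      exact h1.comp D (by fun_prop))
    (fun D hD => by
      rw [hgrad, hgrad, add_zero]
      exact (hs D (mem_closedBall_zero_iff.1 hD)).2) hφ
  rw [hgrad, add_zero, finrank_gain] at h
  push_cast at h
  exact h

/-- What the descent argument uses of a stochastic gradient estimator at the gain `K`: it is bounded
by `B`, its bias is at most `b`, and its second moment is at most `V`. -/
structure IsEstimator (L : LQR n m) (G : Gain m n → Gain m n → (Fin n → ℝ) → Gain m n)
    (K : Gain m n) (B b V : ℝ) : Prop where
  bound : ∀ᵐ z ∂(L.init.prod (unifSphere m n)), ‖G K z.2 z.1‖ ≤ B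
  bias : ‖∫ z, G K z.2 z.1 ∂(L.init.prod (unifSphere m n)) - gradient L.J K‖ ≤ b
  second_moment : ∫ z, ‖G K z.2 z.1‖ ^ 2 ∂(L.init.prod (unifSphere m n)) ≤ V

theorem isEstimator_onePoint (hL : L.Standing Cm) [Nontrivial (Gain m n)] {K : Gain m n}
    {r φ C : ℝ} (hr : 0 < r) (hφ : 0 ≤ φ) (hs : ∀ D : Gain m n, ‖D‖ ≤ r →
      K + D ∈ L.stab ∧ ‖gradient L.J (K + D) - gradient L.J K‖ ≤ φ * ‖D‖ ∧ L.J (K + D) ≤ C) :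
    L.IsEstimator (L.onePoint r) K (Cm * C * (m * n) / r) (φ * r)
      ((Cm * C * (m * n) / r) ^ 2) := by
  have := hL.isProb
  have h2 : IsProbabilityMeasure (unifSphere m n) := isProbabilityMeasure_sphereUnif volume
  have hs1 : ∀ D : Gain m n, ‖D‖ = 1 → K + r • D ∈ L.stab ∧ L.J (K + r • D) ≤ C := fun D hD => by
    have h := hs (r • D) (by rw [norm_smul, hD, mul_one, Real.norm_of_nonneg hr.le])
    exact ⟨h.1, h.2.2⟩
  have hb : ∀ᵐ z ∂(L.init.prod (unifSphere m n)),
      ‖L.onePoint r K z.2 z.1‖ ≤ Cm * C * (m * n) / r := by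
    filter_upwards [hL.ae_sample] with z hz
    rw [onePoint, norm_smul, hz.2, mul_one, norm_mul, Real.norm_of_nonneg (J₁_nonneg _ _),
      Real.norm_of_nonneg (by positivity : (0 : ℝ) ≤ m * n / r), mul_div_assoc (Cm * C)]
    refine mul_le_mul_of_nonneg_right ?_ (by positivity : (0 : ℝ) ≤ m * n / r)
    exact (hL.J₁_le (hs1 _ hz.2).1 hz.1).trans
      (mul_le_mul_of_nonneg_left (hs1 _ hz.2).2 hL.Cm_pos.le)
  refine ⟨hb, ?_, ?_⟩
  · have h3 : ∀ z : (Fin n → ℝ) × Gain m n, L.onePoint r K z.2 z.1 =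
        ((m * n : ℝ) / r) • (L.J₁ (K + r • z.2) z.1 • z.2) := fun z => by
      rw [onePoint, smul_smul, mul_comm]
    simp only [h3]
    rw [integral_smul, (hL.integral_J₁_smul hs1).2]
    exact hL.norm_sphere_gradient_le hr hφ fun D hD => ⟨(hs D hD).1, (hs D hD).2.1⟩
  · have h3 := norm_integral_le_of_norm_le_const (μ := L.init.prod (unifSphere m n))
      (f := fun z : (Fin n → ℝ) × Gain m n => ‖L.onePoint r K z.2 z.1‖ ^ 2)
      (C := (Cm * C * (m * n) / r) ^ 2) (by
        filter_upwards [hb] with z hz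
        rw [norm_pow, norm_norm]
        gcongr)
    rw [probReal_univ, mul_one] at h3
    exact (le_abs_self _).trans h3

/-- For almost every initial state `x`, the gradient of `J(·; x)` is bounded by the Lipschitz
constant on the whole interior of the sublevel set at once: it is so on a countable dense set, and
the gradient is continuous. -/
theorem RegularityConstants.ae_norm_fderiv_J₁_le (hL : L.Standing Cm)
    (hR : L.RegularityConstants K₀ mu lam0 lamT0 phi0 rho0) (hrho : 0 < rho0) :
    ∀ᵐ x ∂L.init, ∀ K ∈ L.stab, L.gap K < 10 * L.gap K₀ →
      ‖fderiv ℝ (fun K' => L.J₁ K' x) K‖ ≤ lamT0 := by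
  set U : Set (Gain m n) := {K | K ∈ L.stab ∧ L.gap K < 10 * L.gap K₀} with hU
  have hUo : IsOpen U := by
    have hc : ContinuousOn L.gap L.stab := fun K hK =>
      ((hL.contDiffAt_J (k := 0) hK).continuousAt.sub continuousAt_const).continuousWithinAt
    exact hc.isOpen_inter_preimage L.isOpen_stab isOpen_Iio
  obtain ⟨t, htc, htd⟩ := TopologicalSpace.exists_countable_dense (Gain m n)
  have hae : ∀ᵐ x ∂L.init, ∀ K ∈ U ∩ t, ∀ K', ‖K' - K‖ ≤ rho0 →
      |L.J₁ K' x - L.J₁ K x| ≤ lamT0 * ‖K' - K‖ :=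
    (ae_ball_iff (htc.mono Set.inter_subset_right)).2 fun K hK =>
      hR.lipschitz_from ⟨hK.1.1, hK.1.2.le⟩
  filter_upwards [hae] with x hx K hK hgap
  by_contra! hlt
  have hcont : ContinuousAt (fun K => ‖fderiv ℝ (fun K' => L.J₁ K' x) K‖) K :=
    ((hL.contDiffAt_J₁ x (k := 1) hK).fderiv_right (m := 0) (by simp)).continuousAt.norm
  have hev := hcont.eventually (lt_mem_nhds hlt)
  obtain ⟨K₁, h1, h2⟩ := mem_closure_iff_nhds.1
    (htd.open_subset_closure_inter hUo (⟨hK, hgap⟩ : K ∈ U)) _ hev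
  have h3 : ‖fderiv ℝ (fun K' => L.J₁ K' x) K₁‖ ≤ lamT0 := by
    refine norm_fderiv_le_of_lip' ℝ (hR.lamT_pos (K := K₁) ⟨h2.1.1, h2.1.2.le⟩).le ?_
    filter_upwards [Metric.closedBall_mem_nhds K₁ hrho] with K' hK'
    exact hx K₁ h2 K' (mem_closedBall_iff_norm.1 hK')
  exact absurd h1 (not_lt.2 h3)

/-- The symmetric difference has the mean of the one-point estimate, as `D` and `-D` have the same
law, but a second moment of the order `d λ̃²` instead of `d² / r²`, by the Poincaré inequality on
the sphere. -/
theorem isEstimator_twoPoint (hL : L.Standing Cm)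
    (hR : L.RegularityConstants K₀ mu lam0 lamT0 phi0 rho0) [Nontrivial (Gain m n)] {K : Gain m n}
    (hK : K ∈ L.sublevel K₀) {r : ℝ} (hr : 0 < r) (hrho : r ≤ rho0)
    (hs : ∀ D : Gain m n, ‖D‖ ≤ r → L.gap (K + D) < 10 * L.gap K₀) :
    L.IsEstimator (L.twoPoint r) K (m * n * lamT0) (phi0 * r) (2 * (m * n) * lamT0 ^ 2) := by
  have := hL.isProb
  have h2 : IsProbabilityMeasure (unifSphere m n) := isProbabilityMeasure_sphereUnif volume
  have hlam := hR.lamT_pos hK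
  have hsm : ∀ D : Gain m n, ‖D‖ ≤ r →
      K + D ∈ L.stab ∧ ‖gradient L.J (K + D) - gradient L.J K‖ ≤ phi0 * ‖D‖ := fun D hD => by
    have := hR.smooth hK (K' := K + D) (by rw [add_sub_cancel_left]; exact hD.trans hrho)
    rwa [add_sub_cancel_left] at this
  have hnr : ∀ D : Gain m n, ‖D‖ = 1 → ‖r • D‖ = r ∧ ‖(-r) • D‖ = r := fun D hD => by
    constructor <;> rw [norm_smul, hD, mul_one] <;> simp [abs_of_pos hr]
  set C := 10 * L.gap K₀ + L.J L.Kstar with hC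
  have hs1 : ∀ D : Gain m n, ‖D‖ = 1 → K + r • D ∈ L.stab ∧ L.J (K + r • D) ≤ C := fun D hD => by
    have h := hs (r • D) (hnr D hD).1.le
    rw [gap] at h
    exact ⟨(hsm _ (hnr D hD).1.le).1, by linarith⟩
  have hs2 : ∀ D : Gain m n, ‖D‖ = 1 → K + (-r) • D ∈ L.stab ∧ L.J (K + (-r) • D) ≤ C :=
    fun D hD => by
      have h := hs ((-r) • D) (hnr D hD).2.le
      rw [gap] at h
      exact ⟨(hsm _ (hnr D hD).2.le).1, by linarith⟩
  have hdef : ∀ z : (Fin n → ℝ) × Gain m n, L.twoPoint r K z.2 z.1 =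
      ((m * n : ℝ) / (2 * r)) • (L.J₁ (K + r • z.2) z.1 • z.2 - L.J₁ (K + (-r) • z.2) z.1 • z.2) :=
    fun z => by
      rw [twoPoint, ← sub_smul, smul_smul, mul_comm, neg_smul, ← sub_eq_add_neg]
  have hlip : ∀ᵐ x ∂L.init, ∀ D : Gain m n, ‖D‖ = 1 →
      |L.J₁ (K + r • D) x - L.J₁ (K - r • D) x| ≤ 2 * (r * lamT0) := by
    filter_upwards [hR.lipschitz_from hK] with x hx D hD
    have h3 := hx (K + r • D) (by rw [add_sub_cancel_left, (hnr D hD).1]; exact hrho)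
    have h4 := hx (K - r • D) (by
      rw [sub_sub_cancel_left, norm_neg, (hnr D hD).1]; exact hrho)
    rw [add_sub_cancel_left, (hnr D hD).1] at h3
    rw [sub_sub_cancel_left, norm_neg, (hnr D hD).1] at h4
    rw [abs_le] at h3 h4 ⊢
    constructor <;> linarith [h3.1, h3.2, h4.1, h4.2]
  have hb : ∀ᵐ z ∂(L.init.prod (unifSphere m n)), ‖L.twoPoint r K z.2 z.1‖ ≤ m * n * lamT0 := by
    have h5 := Measure.quasiMeasurePreserving_fst.ae (μa := L.init.prod (unifSphere m n)) hlip
    filter_upwards [h5, hL.ae_sample] with z hz hz2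
    rw [twoPoint, norm_smul, hz2.2, mul_one, norm_mul, Real.norm_eq_abs,
      Real.norm_of_nonneg (by positivity : (0 : ℝ) ≤ m * n / (2 * r))]
    calc _ ≤ 2 * (r * lamT0) * (m * n / (2 * r)) :=
          mul_le_mul_of_nonneg_right (hz _ hz2.2) (by positivity)
      _ = m * n * lamT0 := by field_simp
  refine ⟨hb, ?_, ?_⟩
  · simp only [hdef]
    rw [integral_smul, integral_sub (hL.integral_J₁_smul hs1).1 (hL.integral_J₁_smul hs2).1,
      (hL.integral_J₁_smul hs1).2, (hL.integral_J₁_smul hs2).2]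
    have h6 : ∫ D, L.J (K + (-r) • D) • D ∂(unifSphere m n) =
        -∫ D, L.J (K + r • D) • D ∂(unifSphere m n) := by
      have h7 := (measurePreserving_neg_sphereUnif (volume : Measure (Gain m n))).integral_comp
        (MeasurableEquiv.neg (Gain m n)).measurableEmbedding (fun D => L.J (K + (-r) • D) • D)
      rw [unifSphere_eq, ← h7, ← integral_neg]
      simp
    rw [h6, sub_neg_eq_add, ← two_smul ℝ, smul_smul]
    have h8 : (m * n : ℝ) / (2 * r) * 2 = m * n / r := by field_simp
    rw [h8]
    exact hL.norm_sphere_gradient_le hr (hR.phi_pos hK).le hsm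
  · have hmeas : Measurable fun z : (Fin n → ℝ) × Gain m n => L.twoPoint r K z.2 z.1 :=
      (L.measurable_twoPoint r).comp
        (g := fun p : Gain m n × ((Fin n → ℝ) × Gain m n) => L.twoPoint r p.1 p.2.2 p.2.1)
        (f := fun z => (K, z)) (measurable_const.prodMk measurable_id)
    have hint : Integrable (fun z : (Fin n → ℝ) × Gain m n => ‖L.twoPoint r K z.2 z.1‖ ^ 2)
        (L.init.prod (unifSphere m n)) := by
      refine Integrable.of_bound (C := (m * n * lamT0) ^ 2)
        (hmeas.norm.pow_const 2).aestronglyMeasurable ?_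
      filter_upwards [hb] with z hz
      rw [norm_pow, norm_norm]
      gcongr
    rw [integral_prod _ hint]
    have hx : ∀ᵐ x ∂L.init, ∫ D, ‖L.twoPoint r K D x‖ ^ 2 ∂(unifSphere m n) ≤
        2 * (m * n) * lamT0 ^ 2 := by
      filter_upwards [hlip, hR.ae_norm_fderiv_J₁_le hL (hr.trans_le hrho)] with x hx1 hx2
      have hf : ∀ D ∈ {D : Gain m n | K + r • D ∈ L.stab},
          ContDiffAt ℝ 1 (fun D => L.J₁ (K + r • D) x) D := fun D hD =>
        ContDiffAt.comp (g := fun K' => L.J₁ K' x) (f := fun D => K + r • D) D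
          (hL.contDiffAt_J₁ x hD) (by fun_prop)
      have h9 := integral_sq_symmetric_difference_le (volume : Measure (Gain m n))
        (f := fun D => L.J₁ (K + r • D) x) (U := {D : Gain m n | K + r • D ∈ L.stab})
        (L := r * lamT0)
        (L.measurable_J₁.comp (g := fun q : Gain m n × (Fin n → ℝ) => L.J₁ q.1 q.2)
          (f := fun D : Gain m n => (K + r • D, x)) (by fun_prop))
        (L.isOpen_stab.preimage (by fun_prop))
        (fun D hD => (hs1 D (mem_sphere_zero_iff_norm.1 hD)).1)
        (fun D hD => (hf D hD).contDiffWithinAt)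
        (fun D hD => by
          have hst := (hs1 D hD).1
          have h10 : fderiv ℝ (fun D => L.J₁ (K + r • D) x) D =
              r • fderiv ℝ (fun K' => L.J₁ K' x) (K + r • D) := by
            have h11 : HasFDerivAt (fun D : Gain m n => K + r • D)
                (r • ContinuousLinearMap.id ℝ (Gain m n)) D :=
              ((hasFDerivAt_id D).const_smul r).const_add K
            have h12 := HasFDerivAt.comp (g := fun K' => L.J₁ K' x) (f := fun D => K + r • D) D
              ((hL.contDiffAt_J₁ x (k := 1) hst).differentiableAt (by simp)).hasFDerivAt h11
            refine h12.fderiv.trans ?_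
            ext y
            simp
          rw [gradient, LinearIsometryEquiv.norm_map, h10, norm_smul, Real.norm_of_nonneg hr.le]
          exact mul_le_mul_of_nonneg_left (hx2 _ hst (hs _ (hnr D hD).1.le)) hr.le)
        (fun D hD => by
          have := hx1 D hD
          rwa [smul_neg, ← sub_eq_add_neg])
      rw [finrank_gain] at h9
      push_cast at h9
      have h13 : ∫ D, ‖L.twoPoint r K D x‖ ^ 2 ∂(unifSphere m n) =
          ∫ D, (1 / (2 * r)) ^ 2 * ((m * n) ^ 2 *
            (L.J₁ (K + r • D) x - L.J₁ (K + r • -D) x) ^ 2) ∂(unifSphere m n) := by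
        refine integral_congr_ae ?_
        filter_upwards [ae_norm_eq_one_sphereUnif (volume : Measure (Gain m n))] with D hD
        rw [twoPoint, norm_smul, hD, mul_one, Real.norm_eq_abs, sq_abs, smul_neg,
          ← sub_eq_add_neg]
        field_simp
      rw [h13, integral_const_mul, integral_const_mul, unifSphere_eq]
      calc _ ≤ (1 / (2 * r)) ^ 2 * (8 * (m * n) * (r * lamT0) ^ 2) :=
            mul_le_mul_of_nonneg_left h9 (by positivity)
        _ = 2 * (m * n) * lamT0 ^ 2 := by
          field_simp
          ring
    have h14 := integral_mono_of_nonneg (μ := L.init)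
      (ae_of_all _ fun x => integral_nonneg fun D => sq_nonneg ‖L.twoPoint r K D x‖)
      (integrable_const _) hx
    simpa using h14

end LQR

/-! ### One step of the iteration -/

namespace LQR

variable {n m : ℕ} {L : LQR n m} {Cm : ℝ} {K₀ : Gain m n} {mu lam0 lamT0 phi0 rho0 : ℝ}

/-- A bound for the gap after a step of size `η` from `K` along the gradient estimate `g`, valid for
every perturbation of norm at most `δ`. -/
noncomputable def descentBound (L : LQR n m) (φ η δ : ℝ) (K g : Gain m n) : ℝ :=
  L.gap K + η / 2 * ‖gradient L.J K‖ ^ 2 - η * (1 + φ * η) * inner ℝ (gradient L.J K) g +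
    η / 2 * (1 + φ * η) * (δ ^ 2 + φ * η * ‖g‖ ^ 2)

theorem RegularityConstants.gap_step_le (hL : L.Standing Cm)
    (hR : L.RegularityConstants K₀ mu lam0 lamT0 phi0 rho0) {K g e : Gain m n}
    (hK : K ∈ L.sublevel K₀) {η δ B : ℝ} (hη : 0 ≤ η) (hg : ‖g‖ ≤ B) (he : ‖e‖ ≤ δ)
    (hstep : η * (B + δ) ≤ rho0) :
    K - η • g + η • e ∈ L.stab ∧
      L.gap (K - η • g + η • e) ≤ L.descentBound phi0 η δ K g := by
  have hφ := hR.phi_pos hK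
  have hD : K - η • g + η • e = K + η • (e - g) := by
    rw [smul_sub]
    abel
  have hn : ‖η • (e - g)‖ ≤ rho0 := by
    rw [norm_smul, Real.norm_of_nonneg hη]
    refine le_trans (mul_le_mul_of_nonneg_left ?_ hη) hstep
    linarith [norm_sub_le e g]
  rw [hD]
  refine ⟨(hR.smooth hK (K' := K + η • (e - g)) (by rwa [add_sub_cancel_left])).1, ?_⟩
  refine (hR.descent hL hK hn).trans ?_
  rw [descentBound]
  set v := gradient L.J K
  have h1 : inner ℝ v (η • (e - g)) = η * (inner ℝ v e - inner ℝ v g) := by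
    rw [inner_smul_right, inner_sub_right]
  have h2 : ‖η • (e - g)‖ ^ 2 = η ^ 2 * (‖e‖ ^ 2 - 2 * inner ℝ g e + ‖g‖ ^ 2) := by
    rw [norm_smul, mul_pow, norm_sub_sq_real, Real.norm_eq_abs, sq_abs, real_inner_comm]
  -- Young's inequality for the inner product of `e` with `∇J - φ η g`
  have h3 : 0 ≤ ‖v‖ ^ 2 - 2 * (phi0 * η) * inner ℝ v g + (phi0 * η) ^ 2 * ‖g‖ ^ 2 -
      2 * (inner ℝ v e - phi0 * η * inner ℝ g e) + ‖e‖ ^ 2 := by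
    have h4 : 0 ≤ ‖(v - (phi0 * η) • g) - e‖ ^ 2 := sq_nonneg _
    rw [norm_sub_sq_real, norm_sub_sq_real, inner_sub_left, inner_smul_right, inner_smul_left,
      norm_smul, mul_pow, Real.norm_eq_abs, sq_abs] at h4
    simp only [conj_trivial] at h4
    linarith
  have h5 : ‖e‖ ^ 2 ≤ δ ^ 2 := by gcongr
  have h6 : η / 2 * (1 + phi0 * η) * ‖e‖ ^ 2 ≤ η / 2 * (1 + phi0 * η) * δ ^ 2 :=
    mul_le_mul_of_nonneg_left h5 (by positivity)
  have h7 := mul_nonneg (by positivity : 0 ≤ η / 2) h3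
  rw [h1, h2]
  linear_combination h7 + h6

/-- Expected change of the gap in one step. Young's inequality with weight `1` for the bias absorbs
the whole of `‖∇J‖²`, and the gap grows by at most `η μ ε / 96`; with weight `1 / 2` a part of
`‖∇J‖²` remains, which contracts the gap by the Polyak–Łojasiewicz inequality, at the price of a
larger additive error. -/
theorem RegularityConstants.lintegral_descentBound_le (hL : L.Standing Cm)
    (hR : L.RegularityConstants K₀ mu lam0 lamT0 phi0 rho0) [Nontrivial (Gain m n)]
    {G : Gain m n → Gain m n → (Fin n → ℝ) → Gain m n} (hG : Measurable
      fun p : Gain m n × ((Fin n → ℝ) × Gain m n) => G p.1 p.2.2 p.2.1)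
    {K : Gain m n} (hK : K ∈ L.sublevel K₀) {η r δ ε B V : ℝ} (hη : 0 < η) (hδ : 0 ≤ δ)
    (hstep : η * (B + δ) ≤ rho0) (hest : L.IsEstimator G K B (phi0 * r) V)
    (hηφ : phi0 * η ≤ 1 / 4) (hδ2 : δ ^ 2 ≤ mu * ε / 120) (hr2 : (phi0 * r) ^ 2 ≤ mu * ε / 240)
    (hV : phi0 * η * V ≤ mu * ε / 240) :
    ∫⁻ z, ENNReal.ofReal (L.descentBound phi0 η δ K (G K z.2 z.1))
        ∂(L.init.prod (unifSphere m n)) ≤ ENNReal.ofReal (L.gap K + η * mu * ε / 96) ∧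
    ∫⁻ z, ENNReal.ofReal (L.descentBound phi0 η δ K (G K z.2 z.1))
        ∂(L.init.prod (unifSphere m n)) ≤
      ENNReal.ofReal ((1 - η * mu / 4) * L.gap K + 5 * (η * mu * ε) / 384) := by
  have := hL.isProb
  have h2 : IsProbabilityMeasure (unifSphere m n) := isProbabilityMeasure_sphereUnif volume
  have hφ := hR.phi_pos hK
  have hpl := hR.1.2 K hK.1
  set ν := L.init.prod (unifSphere m n)
  set g : (Fin n → ℝ) × Gain m n → Gain m n := fun z => G K z.2 z.1 with hg
  have hgm : Measurable g := hG.comp (f := fun z => (K, z)) (measurable_const.prodMk measurable_id)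
  have hgi : Integrable g ν := Integrable.of_bound hgm.aestronglyMeasurable B hest.bound
  have hgi2 : Integrable (fun z => ‖g z‖ ^ 2) ν := by
    refine Integrable.of_bound (C := B ^ 2) (hgm.norm.pow_const 2).aestronglyMeasurable ?_
    filter_upwards [hest.bound] with z hz
    rw [norm_pow, norm_norm]
    exact pow_le_pow_left₀ (norm_nonneg _) hz 2
  have hnonneg : ∀ᵐ z ∂ν, 0 ≤ L.descentBound phi0 η δ K (g z) := by
    filter_upwards [hest.bound] with z hz
    obtain ⟨h3, h4⟩ := hR.gap_step_le hL hK (e := 0) hη.le hz (by simpa using hδ) hstep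
    exact (hL.gap_nonneg h3).trans h4
  set v := gradient L.J K with hv
  set c := phi0 * η with hc
  have hc0 : 0 < c := by positivity
  have hi1 : Integrable (fun z => η * (1 + c) * inner ℝ v (g z)) ν :=
    (hgi.const_inner v).const_mul _
  have hi2 : Integrable (fun z => η / 2 * (1 + c) * (δ ^ 2 + c * ‖g z‖ ^ 2)) ν :=
    ((integrable_const _).add (hgi2.const_mul _)).const_mul _
  have hi0 : Integrable (fun z => L.gap K + η / 2 * ‖v‖ ^ 2 - η * (1 + c) * inner ℝ v (g z)) ν :=
    (integrable_const _).sub hi1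
  have hint : Integrable (fun z => L.descentBound phi0 η δ K (g z)) ν := hi0.add hi2
  rw [← ofReal_integral_eq_lintegral_ofReal hint hnonneg]
  have hval : ∫ z, L.descentBound phi0 η δ K (g z) ∂ν = L.gap K + η / 2 * ‖v‖ ^ 2 -
      η * (1 + c) * inner ℝ v (∫ z, g z ∂ν) +
        η / 2 * (1 + c) * (δ ^ 2 + c * ∫ z, ‖g z‖ ^ 2 ∂ν) := by
    simp only [descentBound, ← hv, ← hc]
    rw [integral_add hi0 hi2, integral_sub (integrable_const _) hi1, integral_const_mul,
      integral_const_mul, integral_add (integrable_const _) (hgi2.const_mul _),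
      integral_const_mul, integral_inner hgi]
    simp
  have hinner : ‖v‖ ^ 2 - phi0 * r * ‖v‖ ≤ inner ℝ v (∫ z, g z ∂ν) := by
    have h3 : inner ℝ v (∫ z, g z ∂ν) = ‖v‖ ^ 2 + inner ℝ v (∫ z, g z ∂ν - v) := by
      rw [inner_sub_right, real_inner_self_eq_norm_sq]
      ring
    have h4 := (abs_le.1 (abs_real_inner_le_norm v (∫ z, g z ∂ν - v))).1
    have h5 := mul_le_mul_of_nonneg_left hest.bias (norm_nonneg v)
    rw [h3]
    linarith
  have hV' : c * ∫ z, ‖g z‖ ^ 2 ∂ν ≤ mu * ε / 240 :=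
    (mul_le_mul_of_nonneg_left hest.second_moment hc0.le).trans hV
  -- `κ` is the weight of Young's inequality applied to the bias term
  have hyoung : ∀ κ : ℝ, 0 < κ → 2 * (phi0 * r * ‖v‖) ≤ κ * ‖v‖ ^ 2 + (mu * ε / 240) / κ := by
    intro κ hκ
    have h3 : (phi0 * r) ^ 2 / κ ≤ (mu * ε / 240) / κ := by gcongr
    have h4 : κ * ‖v‖ ^ 2 + (phi0 * r) ^ 2 / κ - 2 * (phi0 * r * ‖v‖) =
        (κ * ‖v‖ - phi0 * r) ^ 2 / κ := by
      field_simp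
      ring
    have h5 : 0 ≤ (κ * ‖v‖ - phi0 * r) ^ 2 / κ := by positivity
    linarith
  set I := inner ℝ v (∫ z, g z ∂ν)
  set W := ∫ z, ‖g z‖ ^ 2 ∂ν
  have hmain : ∀ κ : ℝ, 0 < κ → κ ≤ 1 → L.gap K + η / 2 * ‖v‖ ^ 2 - η * (1 + c) * I +
      η / 2 * (1 + c) * (δ ^ 2 + c * W) ≤
        L.gap K - η / 2 * (1 - κ) * ‖v‖ ^ 2 +
          η / 2 * (5 / 4) * (mu * ε / 240 / κ + mu * ε / 120 + mu * ε / 240) := by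
    intro κ hκ hκ1
    have h3 := hyoung κ hκ
    have h4 : 0 ≤ η / 2 * (1 + c) := by positivity
    have h5 := mul_le_mul_of_nonneg_left
      (show δ ^ 2 + c * W - 2 * I ≤ -(2 - κ) * ‖v‖ ^ 2 +
        (mu * ε / 240 / κ + mu * ε / 120 + mu * ε / 240) by linarith) h4
    have h6 : 0 ≤ mu * ε / 240 / κ + mu * ε / 120 + mu * ε / 240 := by
      have h7 : 0 ≤ mu * ε / 240 := (sq_nonneg _).trans hr2
      have h8 : 0 ≤ mu * ε / 240 / κ := by positivity
      linarith
    have h7 : η / 2 * (1 + c) * (mu * ε / 240 / κ + mu * ε / 120 + mu * ε / 240) ≤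
        η / 2 * (5 / 4) * (mu * ε / 240 / κ + mu * ε / 120 + mu * ε / 240) := by
      gcongr
      linarith
    have h8 : 0 ≤ η / 2 * c * (2 - κ) * ‖v‖ ^ 2 := by
      have : 0 ≤ 2 - κ := by linarith
      positivity
    linarith
  constructor
  · refine ENNReal.ofReal_le_ofReal (hval.trans_le ((hmain 1 one_pos le_rfl).trans ?_))
    linarith
  · refine ENNReal.ofReal_le_ofReal (hval.trans_le ((hmain (1 / 2) (by norm_num)
      (by norm_num)).trans ?_))
    have h3 := mul_le_mul_of_nonneg_left hpl hη.le
    linarith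

end LQR

/-! ### Conditioning on the past -/

section Conditioning

variable {Ω X Z : Type*} [MeasurableSpace X] [MeasurableSpace Z] {m₁ mΩ : MeasurableSpace Ω}
  {P : Measure Ω} [IsProbabilityMeasure P] {κ : Ω → X} {ζ : Ω → Z} {A : Set Ω}

/-- On an event `A` of the past, a past variable `κ` and a fresh sample `ζ` have a product law. -/
theorem map_restrict_prod_of_indep (hle : m₁ ≤ mΩ) (hζ : Measurable ζ) (hκ : Measurable[m₁] κ)
    (hind : Indep (MeasurableSpace.comap ζ inferInstance) m₁ P) (hA : MeasurableSet[m₁] A) :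
    (P.restrict A).map (fun ω => (κ ω, ζ ω)) = ((P.restrict A).map κ).prod (P.map ζ) := by
  have hκ' : Measurable κ := hκ.mono hle le_rfl
  have : IsProbabilityMeasure (P.map ζ) := Measure.isProbabilityMeasure_map hζ.aemeasurable
  refine (Measure.prod_eq fun s t hs ht => ?_).symm
  rw [Measure.map_apply (hκ'.prodMk hζ) (hs.prod ht), Measure.map_apply hκ' hs,
    Measure.map_apply hζ ht, Measure.restrict_apply ((hκ'.prodMk hζ) (hs.prod ht)),
    Measure.restrict_apply (hκ' hs)]
  have h1 : (fun ω => (κ ω, ζ ω)) ⁻¹' s ×ˢ t ∩ A = ζ ⁻¹' t ∩ (κ ⁻¹' s ∩ A) := by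
    ext ω
    simp only [Set.mem_inter_iff, Set.mem_preimage, Set.mem_prod]
    tauto
  rw [h1, mul_comm]
  exact (Indep_iff _ _ P).1 hind _ _ ⟨t, ht, rfl⟩ (MeasurableSet.inter (hκ hs) hA)

theorem setLIntegral_of_indep (hle : m₁ ≤ mΩ) (hζ : Measurable ζ) (hκ : Measurable[m₁] κ)
    (hind : Indep (MeasurableSpace.comap ζ inferInstance) m₁ P) (hA : MeasurableSet[m₁] A)
    {f : X × Z → ℝ≥0∞} (hf : Measurable f) :
    ∫⁻ ω in A, f (κ ω, ζ ω) ∂P = ∫⁻ ω in A, (∫⁻ z, f (κ ω, z) ∂(P.map ζ)) ∂P := by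
  have hκ' : Measurable κ := hκ.mono hle le_rfl
  have : IsProbabilityMeasure (P.map ζ) := Measure.isProbabilityMeasure_map hζ.aemeasurable
  have h1 := lintegral_map (μ := P.restrict A) hf (hκ'.prodMk hζ)
  rw [← h1, map_restrict_prod_of_indep hle hζ hκ hind hA, lintegral_prod _ hf.aemeasurable,
    lintegral_map hf.lintegral_prod_right' hκ']

theorem ae_of_indep (hle : m₁ ≤ mΩ) (hζ : Measurable ζ) (hκ : Measurable[m₁] κ)
    (hind : Indep (MeasurableSpace.comap ζ inferInstance) m₁ P) (hA : MeasurableSet[m₁] A)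
    {N : Set (X × Z)} (hN : MeasurableSet N)
    (h : ∀ ω ∈ A, ∀ᵐ z ∂(P.map ζ), (κ ω, z) ∈ N) : ∀ᵐ ω ∂P, ω ∈ A → (κ ω, ζ ω) ∈ N := by
  have hκ' : Measurable κ := hκ.mono hle le_rfl
  have h1 := setLIntegral_of_indep hle hζ hκ hind hA
    (f := Nᶜ.indicator 1) (measurable_one.indicator hN.compl)
  have h2 : ∫⁻ ω in A, (∫⁻ z, Nᶜ.indicator (1 : X × Z → ℝ≥0∞) (κ ω, z) ∂(P.map ζ)) ∂P = 0 := by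
    rw [setLIntegral_congr_fun (g := fun _ => 0) (hle _ hA) fun ω hω => ?_, lintegral_zero]
    refine (lintegral_eq_zero_iff (f := fun z => Nᶜ.indicator (1 : X × Z → ℝ≥0∞) (κ ω, z))
      ((measurable_one.indicator hN.compl).comp measurable_prodMk_left)).2 ?_
    filter_upwards [h ω hω] with z hz
    simp [hz]
  rw [h2] at h1
  replace h1 := (lintegral_eq_zero_iff (f := fun ω => Nᶜ.indicator (1 : X × Z → ℝ≥0∞) (κ ω, ζ ω))
    ((measurable_one.indicator hN.compl).comp (hκ'.prodMk hζ))).1 h1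
  rw [Filter.EventuallyEq, ae_restrict_iff' (hle _ hA)] at h1
  filter_upwards [h1] with ω hω hωA
  have h3 := hω hωA
  by_contra hn
  simp [hn] at h3

/-- One step of a process stopped on leaving the event that it is at most `M`: the mass that is
lost leaves with value at least `M`. -/
theorem stopped_step {A' : Set Ω} (hA : MeasurableSet A) (hA' : MeasurableSet A') (hsub : A' ⊆ A)
    {a a' : Ω → ℝ} (ha : Measurable a) (ha' : Measurable a') {M M₀ c₁ c₂ : ℝ} (hM : 0 ≤ M)
    (hc₁ : 0 ≤ c₁) (hc₂ : 0 ≤ c₂) (haM : ∀ ω ∈ A, 0 ≤ a ω ∧ a ω ≤ M₀)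
    (haM' : ∀ᵐ ω ∂P, ω ∈ A' → 0 ≤ a' ω ∧ a' ω ≤ M)
    (hout : ∀ᵐ ω ∂P, ω ∈ A → ω ∉ A' → M ≤ a' ω)
    (h : ∫⁻ ω in A, ENNReal.ofReal (a' ω) ∂P ≤
      ∫⁻ ω in A, ENNReal.ofReal (c₁ * a ω + c₂) ∂P) :
    M * (P.real A - P.real A') + ∫ ω in A', a' ω ∂P ≤ c₁ * ∫ ω in A, a ω ∂P + c₂ * P.real A := by
  have hai : Integrable a (P.restrict A) := by
    refine Integrable.of_bound (C := M₀) ha.aestronglyMeasurable ?_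
    filter_upwards [ae_restrict_mem hA] with ω hω
    rw [Real.norm_of_nonneg (haM ω hω).1]
    exact (haM ω hω).2
  have hae' : ∀ᵐ ω ∂(P.restrict A'), 0 ≤ a' ω ∧ a' ω ≤ M := (ae_restrict_iff' hA').2 haM'
  have hai' : Integrable a' (P.restrict A') := by
    refine Integrable.of_bound (C := M) ha'.aestronglyMeasurable ?_
    filter_upwards [hae'] with ω hω
    rw [Real.norm_of_nonneg hω.1]
    exact hω.2
  have hr : ∫⁻ ω in A, ENNReal.ofReal (c₁ * a ω + c₂) ∂P =
      ENNReal.ofReal (c₁ * ∫ ω in A, a ω ∂P + c₂ * P.real A) := by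
    have h1 : ∫ ω in A, (c₁ * a ω + c₂) ∂P = c₁ * ∫ ω in A, a ω ∂P + c₂ * P.real A := by
      rw [integral_add (hai.const_mul _) (integrable_const _), integral_const_mul, integral_const,
        smul_eq_mul, measureReal_restrict_apply_univ, mul_comm c₂]
    have h1' : Integrable (fun ω => c₁ * a ω + c₂) (P.restrict A) :=
      (hai.const_mul _).add (integrable_const _)
    rw [← h1, ofReal_integral_eq_lintegral_ofReal h1']
    filter_upwards [ae_restrict_mem hA] with ω hω
    have := (haM ω hω).1
    change 0 ≤ c₁ * a ω + c₂
    positivity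
  have hl : ENNReal.ofReal (M * (P.real A - P.real A') + ∫ ω in A', a' ω ∂P) ≤
      ∫⁻ ω in A, ENNReal.ofReal (a' ω) ∂P := by
    have h2 : A = A' ∪ (A \ A') := (Set.union_sdiff_cancel hsub).symm
    have h3 : ∫⁻ ω in A, ENNReal.ofReal (a' ω) ∂P = ∫⁻ ω in A', ENNReal.ofReal (a' ω) ∂P +
        ∫⁻ ω in A \ A', ENNReal.ofReal (a' ω) ∂P := by
      conv_lhs => rw [h2]
      exact lintegral_union (hA.diff hA') Set.disjoint_sdiff_right
    have h4 : ENNReal.ofReal (∫ ω in A', a' ω ∂P) = ∫⁻ ω in A', ENNReal.ofReal (a' ω) ∂P :=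
      ofReal_integral_eq_lintegral_ofReal hai' (hae'.mono fun ω hω => hω.1)
    have h5 : ENNReal.ofReal (M * (P.real A - P.real A')) ≤
        ∫⁻ ω in A \ A', ENNReal.ofReal (a' ω) ∂P := by
      rw [← measureReal_sdiff hsub hA', ENNReal.ofReal_mul hM, ofReal_measureReal,
        ← setLIntegral_const]
      refine setLIntegral_mono_ae' (hA.diff hA') ?_
      filter_upwards [hout] with ω hω hωA
      exact ENNReal.ofReal_le_ofReal (hω hωA.1 hωA.2)
    rw [h3, ← h4, add_comm (ENNReal.ofReal _)]
    exact ENNReal.ofReal_add_le.trans (add_le_add h5 le_rfl)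
  rw [hr] at h
  have h6 := hl.trans h
  have h7 : 0 ≤ c₁ * ∫ ω in A, a ω ∂P + c₂ * P.real A := by
    have : 0 ≤ ∫ ω in A, a ω ∂P := setIntegral_nonneg hA fun ω hω => (haM ω hω).1
    positivity
  exact (ENNReal.ofReal_le_ofReal_iff h7).1 h6

end Conditioning

/-! ### The stopped iteration -/

namespace LQR

variable {n m : ℕ} {L : LQR n m} {Cm : ℝ} {K₀ : Gain m n}

theorem measurable_gap (hL : L.Standing Cm) : Measurable L.gap :=
  (L.measurable_J hL).sub_const _

theorem measurable_descentBound (hL : L.Standing Cm) (φ η δ : ℝ) :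
    Measurable fun p : Gain m n × Gain m n => L.descentBound φ η δ p.1 p.2 := by
  have h1 : Measurable fun p : Gain m n × Gain m n => L.gap p.1 :=
    (measurable_gap hL).comp measurable_fst
  have h2 : Measurable fun p : Gain m n × Gain m n => gradient L.J p.1 :=
    (measurable_gradient L.J).comp measurable_fst
  have h3 : Measurable fun p : Gain m n × Gain m n => inner ℝ (gradient L.J p.1) p.2 :=
    h2.inner measurable_snd
  unfold descentBound
  fun_prop

/-- The stabilizing gains of gap at most `M`. -/
def gapSet (L : LQR n m) (M : ℝ) : Set (Gain m n) := {K | K ∈ L.stab ∧ L.gap K ≤ M}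

theorem measurableSet_gapSet (hL : L.Standing Cm) (M : ℝ) : MeasurableSet (L.gapSet M) :=
  L.isOpen_stab.measurableSet.inter (measurable_gap hL measurableSet_Iic)

section Iteration

variable {Ω : Type*} [MeasurableSpace Ω] {x : ℕ → Ω → Fin n → ℝ} {D E : ℕ → Ω → Gain m n}
  {G : Gain m n → Gain m n → (Fin n → ℝ) → Gain m n} {η : ℝ}

/-- The σ-algebra generated by the samples and perturbations of the rounds before `s`. -/
@[reducible] def past (x : ℕ → Ω → Fin n → ℝ) (D E : ℕ → Ω → Gain m n) (s : ℕ) :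
    MeasurableSpace Ω :=
  ⨆ j : Fin s, MeasurableSpace.comap (fun ω => (x j ω, D j ω, E j ω)) inferInstance

omit [MeasurableSpace Ω] in
theorem past_mono : Monotone (past x D E) := fun _ t hst =>
  iSup_le fun j => le_iSup (fun j : Fin t =>
    MeasurableSpace.comap (fun ω => (x j ω, D j ω, E j ω)) inferInstance) (Fin.castLE hst j)

omit [MeasurableSpace Ω] in
theorem measurable_past (s : ℕ) :
    Measurable[past x D E (s + 1)] fun ω => (x s ω, D s ω, E s ω) :=
  (comap_measurable _).mono (le_iSup (fun j : Fin (s + 1) =>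
    MeasurableSpace.comap (fun ω => (x j ω, D j ω, E j ω)) inferInstance) (Fin.last s)) le_rfl

omit [MeasurableSpace Ω] in
theorem measurable_iterate (hG : Measurable
    fun p : Gain m n × ((Fin n → ℝ) × Gain m n) => G p.1 p.2.2 p.2.1) (s : ℕ) :
    Measurable[past x D E s] fun ω =>
      perturbedIterate G η K₀ (fun s => x s ω) (fun s => D s ω) (fun s => E s ω) s := by
  induction s with
  | zero => exact measurable_const
  | succ s ih =>
    have h1 := ih.mono (past_mono (Nat.le_succ s)) le_rfl
    have h2 := measurable_past (x := x) (D := D) (E := E) s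
    have h3 := hG.comp (h1.prodMk (h2.fst.prodMk h2.snd.fst))
    exact (h1.sub (h3.const_smul η)).add (h2.snd.snd.const_smul η)

theorem Sampling.past_le {P : Measure Ω} {δ : ℝ} (hS : L.Sampling P δ x D E) (s : ℕ) :
    past x D E s ≤ ‹MeasurableSpace Ω› := iSup_le fun j =>
  ((hS.measurable_x j).prodMk ((hS.measurable_D j).prodMk (hS.measurable_E j))).comap_le

/-- The recursion satisfied by the iteration stopped when its gap exceeds `M`: `p s` is the
probability that it has not stopped by time `s`, and `e s` the expected gap on that event. The last
clause is Markov's inequality for the step from `s` to `s + 1`. -/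
theorem Sampling.exists_stopped_recursion (hL : L.Standing Cm) {P : Measure Ω}
    [IsProbabilityMeasure P] {δ : ℝ} (hS : L.Sampling P δ x D E) (hG : Measurable
      fun p : Gain m n × ((Fin n → ℝ) × Gain m n) => G p.1 p.2.2 p.2.1)
    {M c₁ c₂ ε B : ℝ} (hK₀ : K₀ ∈ L.gapSet M) (hc₁ : 0 ≤ c₁) (hc₂ : 0 ≤ c₂) (hε : 0 < ε)
    {Ψ : Gain m n → Gain m n → ℝ} (hΨ : Measurable fun p : Gain m n × Gain m n => Ψ p.1 p.2)
    (hstep : ∀ K ∈ L.gapSet M, ∀ g e : Gain m n, ‖g‖ ≤ B → ‖e‖ ≤ δ →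
      K - η • g + η • e ∈ L.stab ∧ L.gap (K - η • g + η • e) ≤ Ψ K g)
    (hB : ∀ K ∈ L.gapSet M, ∀ᵐ z ∂(L.init.prod (unifSphere m n)), ‖G K z.2 z.1‖ ≤ B)
    (hint : ∀ K ∈ L.gapSet M, ∫⁻ z, ENNReal.ofReal (Ψ K (G K z.2 z.1))
      ∂(L.init.prod (unifSphere m n)) ≤ ENNReal.ofReal (c₁ * L.gap K + c₂)) :
    ∃ p e : ℕ → ℝ, p 0 = 1 ∧ e 0 = L.gap K₀ ∧
      (∀ s, p (s + 1) ≤ p s ∧ p s ≤ 1 ∧ 0 ≤ p s ∧ 0 ≤ e s) ∧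
      (∀ s, M * (p s - p (s + 1)) + e (s + 1) ≤ c₁ * e s + c₂ * p s) ∧
      ∀ s, p s - (c₁ * e s + c₂ * p s) / ε ≤ P.real {ω |
        let K := perturbedIterate G η K₀ (fun s => x s ω) (fun s => D s ω) (fun s => E s ω) (s + 1)
        K ∈ L.stab ∧ L.J K - L.J L.Kstar < ε} := by
  set K : ℕ → Ω → Gain m n := fun s ω =>
    perturbedIterate G η K₀ (fun s => x s ω) (fun s => D s ω) (fun s => E s ω) s with hK
  have hK0 : ∀ ω, K 0 ω = K₀ := fun ω => rfl
  have hKs : ∀ s ω, K (s + 1) ω = K s ω - η • G (K s ω) (D s ω) (x s ω) + η • E s ω :=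
    fun s ω => rfl
  have hKm : ∀ s, Measurable[past x D E s] (K s) := measurable_iterate hG
  have hKm' : ∀ s, Measurable (K s) := fun s => (hKm s).mono (hS.past_le s) le_rfl
  set A : ℕ → Set Ω := fun s => {ω | ∀ j ≤ s, K j ω ∈ L.gapSet M} with hA
  have hAm : ∀ s, MeasurableSet[past x D E s] (A s) := fun s => by
    have h1 : A s = ⋂ j, ⋂ (_ : j ≤ s), K j ⁻¹' L.gapSet M := by
      ext ω
      simp [hA]
    rw [h1]
    exact MeasurableSet.iInter fun j => MeasurableSet.iInter fun hj =>
      (hKm j).mono (past_mono hj) le_rfl (measurableSet_gapSet hL M)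
  have hAm' : ∀ s, MeasurableSet (A s) := fun s => hS.past_le s _ (hAm s)
  have hAsub : ∀ s, A (s + 1) ⊆ A s := fun s ω h j hj => h j (hj.trans (Nat.le_succ s))
  have hAmem : ∀ s, ∀ ω ∈ A s, K s ω ∈ L.gapSet M := fun s ω h => h s le_rfl
  have hAsucc : ∀ s ω, ω ∈ A s → K (s + 1) ω ∈ L.gapSet M → ω ∈ A (s + 1) := by
    intro s ω h1 h2 j hj
    rcases Nat.le_succ_iff.1 hj with h | h
    · exact h1 j h
    · rw [h]
      exact h2
  have hζ : ∀ s, Measurable fun ω => (x s ω, D s ω) := fun s =>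
    (hS.measurable_x s).prodMk (hS.measurable_D s)
  have hfB : ∀ s, ∀ᵐ ω ∂P, ω ∈ A s → ‖G (K s ω) (D s ω) (x s ω)‖ ≤ B := fun s =>
    ae_of_indep (hS.past_le s) (hζ s) (hKm s) (hS.indep s) (hAm s)
      (N := {q | ‖G q.1 q.2.2 q.2.1‖ ≤ B}) (measurableSet_le hG.norm measurable_const)
      fun ω hω => by
        rw [hS.law]
        exact hB _ (hAmem s ω hω)
  have hnext : ∀ s, ∀ᵐ ω ∂P, ω ∈ A s → K (s + 1) ω ∈ L.stab ∧
      L.gap (K (s + 1) ω) ≤ Ψ (K s ω) (G (K s ω) (D s ω) (x s ω)) := fun s => by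
    filter_upwards [hfB s, hS.bound s] with ω h1 h2 h3
    exact hstep _ (hAmem s ω h3) _ _ (h1 h3) h2
  have hgm : ∀ s, Measurable fun ω => L.gap (K s ω) := fun s => (measurable_gap hL).comp (hKm' s)
  have hlint : ∀ s, ∫⁻ ω in A s, ENNReal.ofReal (L.gap (K (s + 1) ω)) ∂P ≤
      ∫⁻ ω in A s, ENNReal.ofReal (c₁ * L.gap (K s ω) + c₂) ∂P := fun s => by
    have h1 : ∫⁻ ω in A s, ENNReal.ofReal (L.gap (K (s + 1) ω)) ∂P ≤
        ∫⁻ ω in A s, ENNReal.ofReal (Ψ (K s ω) (G (K s ω) (D s ω) (x s ω))) ∂P := by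
      refine setLIntegral_mono_ae' (hAm' s) ?_
      filter_upwards [hnext s] with ω h1 h2
      exact ENNReal.ofReal_le_ofReal (h1 h2).2
    have hf : Measurable fun q : Gain m n × ((Fin n → ℝ) × Gain m n) =>
        ENNReal.ofReal (Ψ q.1 (G q.1 q.2.2 q.2.1)) :=
      (hΨ.comp (measurable_fst.prodMk hG)).ennreal_ofReal
    have h2 := setLIntegral_of_indep (hS.past_le s) (hζ s) (hKm s) (hS.indep s) (hAm s) hf
    refine h1.trans (h2.trans_le ?_)
    refine setLIntegral_mono_ae' (hAm' s) (ae_of_all _ fun ω hω => ?_)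
    rw [hS.law]
    exact hint _ (hAmem s ω hω)
  have hM : 0 ≤ M := (hL.gap_nonneg hK₀.1).trans hK₀.2
  have hbd : ∀ s, ∀ ω ∈ A s, 0 ≤ L.gap (K s ω) ∧ L.gap (K s ω) ≤ M := fun s ω hω =>
    ⟨hL.gap_nonneg (hAmem s ω hω).1, (hAmem s ω hω).2⟩
  have hA0 : A 0 = Set.univ := by
    ext ω
    simp only [hA, Set.mem_ofPred_eq, Set.mem_univ, iff_true]
    intro j hj
    rw [Nat.le_zero.1 hj]
    exact hK₀
  refine ⟨fun s => P.real (A s), fun s => ∫ ω in A s, L.gap (K s ω) ∂P, ?_, ?_, fun s =>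
    ⟨measureReal_mono (hAsub s), measureReal_le_one, measureReal_nonneg,
      setIntegral_nonneg (hAm' s) fun ω hω => (hbd s ω hω).1⟩, fun s => ?_, fun s => ?_⟩
  · simp only [hA0, probReal_univ]
  · simp only [hA0, hK0]
    simp
  · refine stopped_step (hAm' s) (hAm' (s + 1)) (hAsub s) (hgm s) (hgm (s + 1)) hM hc₁ hc₂
      (hbd s) (ae_of_all _ (hbd (s + 1))) ?_ (hlint s)
    filter_upwards [hnext s] with ω h1 h2 h3
    by_contra! h4
    exact h3 (hAsucc s ω h2 ⟨(h1 h2).1, h4.le⟩)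
  · -- the same inequality, for stopping when the gap is at least `ε`
    set A' : Set Ω := A s ∩ {ω | L.gap (K (s + 1) ω) < ε} with hA'
    have hA'm : MeasurableSet A' := (hAm' s).inter (hgm (s + 1) measurableSet_Iio)
    have hsub : A' ⊆ A s := Set.inter_subset_left
    have hε' : ∀ᵐ ω ∂P, ω ∈ A' → 0 ≤ L.gap (K (s + 1) ω) ∧ L.gap (K (s + 1) ω) ≤ ε := by
      filter_upwards [hnext s] with ω h1 h2
      exact ⟨hL.gap_nonneg (h1 h2.1).1, h2.2.le⟩
    have hexit := stopped_step (M := ε) (hAm' s) hA'm hsub (hgm s) (hgm (s + 1)) hε.le hc₁ hc₂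
      (hbd s) hε' ?_ (hlint s)
    · have h0 : 0 ≤ ∫ ω in A', L.gap (K (s + 1) ω) ∂P := by
        refine setIntegral_nonneg_of_ae_restrict ((ae_restrict_iff' hA'm).2 ?_)
        filter_upwards [hε'] with ω h1 h2 using (h1 h2).1
      have h1 : P.real A' ≤ P.real {ω | K (s + 1) ω ∈ L.stab ∧
          L.J (K (s + 1) ω) - L.J L.Kstar < ε} := by
        refine ENNReal.toReal_mono (measure_ne_top _ _) (measure_mono_ae ?_)
        filter_upwards [hnext s] with ω h1 h2
        exact ⟨(h1 h2.1).1, h2.2⟩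
      refine le_trans ?_ h1
      rw [sub_le_iff_le_add, ← sub_le_iff_le_add', le_div_iff₀ hε]
      linarith
    · refine ae_of_all _ fun ω h1 h2 => ?_
      by_contra! h3
      exact h2 ⟨h1, h3⟩

end Iteration

end LQR

/-! ### Convergence from the recursion of the stopped iteration -/

section StoppedRecursion

variable {p e : ℕ → ℝ} {M c c₂ : ℝ}

theorem stopped_recursion_sum (hp0 : p 0 = 1)
    (hpe : ∀ s, p (s + 1) ≤ p s ∧ p s ≤ 1 ∧ 0 ≤ p s ∧ 0 ≤ e s)
    (hrec : ∀ s, M * (p s - p (s + 1)) + e (s + 1) ≤ c * e s + c₂ * p s) (hc : c ≤ 1)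
    (hc₂ : 0 ≤ c₂) (N : ℕ) : M * (1 - p N) + e N ≤ e 0 + N * c₂ := by
  induction N with
  | zero => simp [hp0]
  | succ N ih =>
    have h1 := hrec N
    obtain ⟨-, h2, -, h3⟩ := hpe N
    have h4 := mul_le_mul_of_nonneg_right hc h3
    have h5 := mul_le_mul_of_nonneg_left h2 hc₂
    push_cast
    linarith

/-- Lower bound for the probability that the stopped process ends with gap below `ε`, without
contraction of the mean gap: `M ≤ ε`, so a process that has not stopped is below `ε` up to the last
step, whose increment is controlled by Markov's inequality. -/
theorem le_of_stopped_recursion (hp0 : p 0 = 1)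
    (hpe : ∀ s, p (s + 1) ≤ p s ∧ p s ≤ 1 ∧ 0 ≤ p s ∧ 0 ≤ e s)
    (hrec : ∀ s, M * (p s - p (s + 1)) + e (s + 1) ≤ 1 * e s + c₂ * p s) (hc₂ : 0 ≤ c₂)
    {ε : ℝ} (hM : 0 < M) (hMε : M ≤ ε) (N : ℕ) :
    1 - (e 0 + N * c₂) / M - c₂ / ε ≤ p N - (1 * e N + c₂ * p N) / ε := by
  have hε := hM.trans_le hMε
  have h1 := stopped_recursion_sum hp0 hpe hrec le_rfl hc₂ N
  obtain ⟨-, h2, -, h3⟩ := hpe N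
  have h4 : e N / ε ≤ e N / M := div_le_div_of_nonneg_left h3 hM hMε
  have h5 : 1 - p N + e N / M ≤ (e 0 + N * c₂) / M := by
    rw [le_div_iff₀ hM, add_mul, div_mul_cancel₀ _ hM.ne']
    linarith
  have h6 : c₂ * p N / ε ≤ c₂ / ε := by
    gcongr
    exact mul_le_of_le_one_right hc₂ h2
  rw [one_mul, add_div (e N)]
  linarith

/-- Lower bound for the probability that the stopped process ends with gap below `ε`, with
contraction of the mean gap by the factor `1 - h`: Markov's inequality at level `M` for stopping,
and at level `ε` for the terminal gap. -/
theorem le_of_stopped_recursion_contraction (hp0 : p 0 = 1)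
    (hpe : ∀ s, p (s + 1) ≤ p s ∧ p s ≤ 1 ∧ 0 ≤ p s ∧ 0 ≤ e s) {h ε : ℝ} (hh : 0 < h) (hh1 : h ≤ 1)
    (hrec : ∀ s, M * (p s - p (s + 1)) + e (s + 1) ≤ (1 - h) * e s + c₂ * p s) (hc₂ : 0 ≤ c₂)
    (hM : 0 < M) (hε : 0 < ε) (N : ℕ) :
    1 - (e 0 + N * c₂) / M - ((1 - h) ^ (N + 1) * e 0 + c₂ / h) / ε ≤
      p N - ((1 - h) * e N + c₂ * p N) / ε := by
  have h1 := stopped_recursion_sum hp0 hpe hrec (by linarith) hc₂ N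
  have hgeo : ∀ N, e N ≤ (1 - h) ^ N * e 0 + c₂ / h := by
    intro N
    induction N with
    | zero =>
      have : 0 ≤ c₂ / h := by positivity
      simpa using this
    | succ N ih =>
      obtain ⟨h2, h3, -, -⟩ := hpe N
      have h4 := hrec N
      have h5 : 0 ≤ M * (p N - p (N + 1)) := mul_nonneg hM.le (by linarith)
      have h6 := mul_le_mul_of_nonneg_left ih (by linarith : 0 ≤ 1 - h)
      have h7 := mul_le_mul_of_nonneg_left h3 hc₂
      have h8 : (1 - h) * (c₂ / h) = c₂ / h - c₂ := by field_simp
      rw [pow_succ]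
      linarith
  obtain ⟨-, h2, -, h3⟩ := hpe N
  have h4 : 1 - p N ≤ (e 0 + N * c₂) / M := by
    rw [le_div_iff₀ hM]
    linarith
  have h5 : (1 - h) * e N + c₂ * p N ≤ (1 - h) ^ (N + 1) * e 0 + c₂ / h := by
    have h6 := mul_le_mul_of_nonneg_left (hgeo N) (by linarith : 0 ≤ 1 - h)
    have h7 := mul_le_mul_of_nonneg_left h2 hc₂
    have h8 : (1 - h) * (c₂ / h) = c₂ / h - c₂ := by field_simp
    rw [pow_succ]
    linarith
  have h6 : ((1 - h) * e N + c₂ * p N) / ε ≤ ((1 - h) ^ (N + 1) * e 0 + c₂ / h) / ε := by gcongr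
  linarith

/-- The bound `√M + √w < √(10 Δ)` for `M ≤ α Δ`, `w ≤ β Δ`; the last hypothesis says that
`2 √(α β) < 10 - α - β`. -/
theorem sq_sqrt_add_sqrt_lt {α β Δ M w : ℝ} (hΔ : 0 < Δ) (hα : 0 ≤ α) (hβ : 0 ≤ β)
    (hM : M ≤ α * Δ) (hw : w ≤ β * Δ) (hαβ : α + β < 10) (h : 4 * (α * β) < (10 - α - β) ^ 2) :
    (√M + √w) ^ 2 < 10 * Δ := by
  have h1 : (√M + √w) ^ 2 ≤ (√(α * Δ) + √(β * Δ)) ^ 2 := by gcongr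
  have h2 : √(α * Δ) * √(β * Δ) = √(α * β) * Δ := by
    rw [← Real.sqrt_mul (by positivity), show α * Δ * (β * Δ) = α * β * Δ ^ 2 by ring,
      Real.sqrt_mul (by positivity), Real.sqrt_sq hΔ.le]
  have h3 : √(α * β) < (10 - α - β) / 2 := by
    rw [Real.sqrt_lt' (by linarith)]
    linarith
  have h4 := mul_lt_mul_of_pos_right h3 hΔ
  have h5 := Real.sq_sqrt (show 0 ≤ α * Δ by positivity)
  have h6 := Real.sq_sqrt (show 0 ≤ β * Δ by positivity)
  nlinarith

/-- The level at which the iteration is stopped when `ε` is large compared to the initial gap. The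
last bound leaves, together with the loss `1 / 192` of the terminal step, a success probability of
at least `3 / 4`. -/
theorem exists_stopping_level {Δ ε : ℝ} (hΔ : 0 < Δ) (hε : 0 < ε) (h₁ : ε < 120 * Δ)
    (h₂ : 120 * Δ ≤ 19 * ε) (hlog : ε * Real.log (120 * Δ / ε) < 12 * Δ) :
    ∃ M, Δ ≤ M ∧ M ≤ ε ∧ (√M + √(ε / 240)) ^ 2 < 10 * Δ ∧
      (Δ + ε * Real.log (120 * Δ / ε) / 24) / M ≤ 611 / 2500 := by
  rcases le_or_gt (120 * Δ) (11 / 10 * ε) with h₃ | h₃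
  · -- here `log y ≤ y - 1` for `y = 120 Δ / ε ≤ 11 / 10` beats the hypothesis on `ε log y`
    refine ⟨6 * Δ, by linarith, by linarith, sq_sqrt_add_sqrt_lt (α := 6) (β := 1 / 2) hΔ
      (by norm_num) (by norm_num) le_rfl (by linarith) (by norm_num) (by norm_num), ?_⟩
    have h4 := mul_le_mul_of_nonneg_left
      (Real.log_le_sub_one_of_pos (show 0 < 120 * Δ / ε by positivity)) hε.le
    rw [mul_sub, mul_div_cancel₀ _ hε.ne', mul_one] at h4
    rw [div_le_iff₀ (by positivity)]
    linarith
  · refine ⟨617 / 100 * Δ, by linarith, by linarith, sq_sqrt_add_sqrt_lt (α := 617 / 100)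
      (β := 5 / 11) hΔ (by norm_num) (by norm_num) le_rfl (by linarith) (by norm_num)
      (by norm_num), ?_⟩
    rw [div_le_iff₀ (by positivity)]
    linarith

end StoppedRecursion

namespace LQR

variable {n m : ℕ} {L : LQR n m} {Cm : ℝ} {K₀ : Gain m n} {mu lam0 lamT0 phi0 rho0 : ℝ}

/-- The convergence theorem for an abstract gradient estimator. The iteration is stopped when its
gap exceeds a level `M`, chosen such that perturbations of length `r` of gains of gap at most `M`
have gap less than `10 Δ₀`. For `120 Δ₀ / ε ≤ 19` one takes `Δ₀ ≤ M ≤ ε`, so that it is enough not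
to have stopped, and the gap need not contract. For larger `120 Δ₀ / ε` one takes `M = 9 Δ₀`, and
the mean gap contracts to a small fraction of `ε`. -/
theorem succeeds_of_isEstimator (hL : L.Standing Cm) (hK₀ : K₀ ∈ L.stab)
    (hR : L.RegularityConstants K₀ mu lam0 lamT0 phi0 rho0) {Ω : Type*} [MeasurableSpace Ω]
    {P : Measure Ω} [IsProbabilityMeasure P] {x : ℕ → Ω → Fin n → ℝ} {D E : ℕ → Ω → Gain m n}
    {η r δ ε B V : ℝ} {T : ℕ} (hη : 0 < η) (hr : 0 < r) (hδ : 0 < δ) (hε : 0 < ε)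
    (hS : L.Sampling P δ x D E) (hgap : 0 < L.gap K₀)
    (hT : T = ⌈4 / (η * mu) * Real.log (120 * L.gap K₀ / ε)⌉₊)
    (hlog : ε * Real.log (120 * L.gap K₀ / ε) < 12 * L.gap K₀)
    (hδ2 : δ ^ 2 ≤ mu * ε / 120) (hr2 : (phi0 * r) ^ 2 ≤ mu * ε / 240) (hrho : r ≤ rho0)
    (hηφ : phi0 * η ≤ 1 / 4) (hstep : η * (B + δ) ≤ rho0) (hV : phi0 * η * V ≤ mu * ε / 240)
    {G : Gain m n → Gain m n → (Fin n → ℝ) → Gain m n} (hG : Measurable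
      fun p : Gain m n × ((Fin n → ℝ) × Gain m n) => G p.1 p.2.2 p.2.1)
    (hest : ∀ K ∈ L.sublevel K₀, (∀ D : Gain m n, ‖D‖ ≤ r → L.gap (K + D) < 10 * L.gap K₀) →
      L.IsEstimator G K B (phi0 * r) V) : L.Succeeds P G η K₀ x D E T ε := by
  have hK₀S := hL.mem_sublevel_self hK₀
  have hφ := hR.phi_pos hK₀S
  have hμ := hR.1.1
  have hμφ := hR.mu_le hL (hr.trans_le hrho) hK₀S hgap
  have : Nontrivial (Gain m n) := by
    refine ⟨K₀, L.Kstar, fun h => hgap.ne' ?_⟩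
    rw [gap, h, sub_self]
  set Δ := L.gap K₀ with hΔ
  set y := 120 * Δ / ε with hy
  have hy0 : 0 < y := by positivity
  have hpert : ∀ M, (√M + √(ε / 240)) ^ 2 < 10 * Δ → ∀ K ∈ L.gapSet M, K ∈ L.sublevel K₀ ∧
      ∀ D : Gain m n, ‖D‖ ≤ r → L.gap (K + D) < 10 * Δ := by
    intro M hM K hK
    have h1 : √(L.gap K) ≤ √M := Real.sqrt_le_sqrt hK.2
    have h2 : K ∈ L.sublevel K₀ := by
      refine ⟨hK.1, ?_⟩
      have h3 := Real.sq_sqrt (hL.gap_nonneg hK.1)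
      have h4 : √(L.gap K) ^ 2 ≤ (√M + √(ε / 240)) ^ 2 := by
        gcongr
        linarith [Real.sqrt_nonneg (ε / 240)]
      linarith
    refine ⟨h2, fun D hD => ?_⟩
    have h3 : phi0 / 2 * ‖D‖ ^ 2 ≤ √(ε / 240) ^ 2 := by
      rw [Real.sq_sqrt (by positivity)]
      have h4 : phi0 ^ 2 * ‖D‖ ^ 2 ≤ phi0 ^ 2 * r ^ 2 := by gcongr
      have h5 : mu * ε ≤ 2 * phi0 * ε := mul_le_mul_of_nonneg_right hμφ hε.le
      have h6 : phi0 * (phi0 / 2 * ‖D‖ ^ 2) ≤ phi0 * (ε / 240) := by nlinarith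
      exact le_of_mul_le_mul_left h6 hφ
    refine (hR.gap_add_le hL h2 (hD.trans hrho) (Real.sqrt_nonneg _) h3).trans_lt
      (lt_of_le_of_lt ?_ hM)
    gcongr
  have hu1 : η * mu ≤ 1 / 2 := by nlinarith
  have hu : 0 < η * mu := mul_pos hη hμ
  set u := η * mu
  rcases le_or_gt y 1 with hy1 | hy1
  · -- no rounds at all, and the initial gain is already good enough
    have hT0 : T = 0 := by
      rw [hT, Nat.ceil_eq_zero]
      exact mul_nonpos_of_nonneg_of_nonpos (by positivity) (Real.log_nonpos hy0.le hy1)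
    have h1 : Δ < ε := by
      have := (div_le_one hε).1 hy1
      linarith
    rw [Succeeds, hT0]
    refine le_trans ?_ (measureReal_mono (μ := P) (s₁ := Set.univ) fun ω _ => ⟨hK₀, h1⟩)
    rw [probReal_univ]
    norm_num
  have hly : 0 < Real.log y := Real.log_pos hy1
  obtain ⟨N, hN⟩ : ∃ N, T = N + 1 := by
    refine Nat.exists_eq_succ_of_ne_zero ?_
    rw [hT, Ne, Nat.ceil_eq_zero, not_le]
    positivity
  -- the number of rounds is `N + 1`, and `N u / 4 ≤ log y ≤ (N + 1) u / 4`
  have hNlt : N * u ≤ 4 * Real.log y := by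
    have h1 : N < ⌈4 / u * Real.log y⌉₊ := by rw [← hT, hN]; exact Nat.lt_succ_self N
    have h2 := (Nat.lt_ceil.1 h1).le
    rwa [div_mul_eq_mul_div, le_div_iff₀ hu] at h2
  have hNge : 4 * Real.log y ≤ (N + 1 : ℕ) * u := by
    have h1 := Nat.le_ceil (4 / u * Real.log y)
    rw [← hT, hN] at h1
    rwa [div_mul_eq_mul_div, div_le_iff₀ hu] at h1
  have hrec : ∀ M c₁ c₂ : ℝ, Δ ≤ M → (√M + √(ε / 240)) ^ 2 < 10 * Δ → 0 ≤ c₁ → 0 ≤ c₂ →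
      (c₁ = 1 ∧ c₂ = u * ε / 96 ∨ c₁ = 1 - u / 4 ∧ c₂ = 5 * (u * ε) / 384) → _ :=
    fun M c₁ c₂ hΔM hM h₁ h₂ hc => hS.exists_stopped_recursion hL hG (η := η) (B := B) (M := M)
      (K₀ := K₀) ⟨hK₀, hΔM⟩ h₁ h₂ hε (measurable_descentBound hL phi0 η δ)
      (fun K hK g e hg he => hR.gap_step_le hL (hpert M hM K hK).1 hη.le hg he hstep)
      (fun K hK => (hest K (hpert M hM K hK).1 (hpert M hM K hK).2).bound)
      (fun K hK => by
        have h := hR.lintegral_descentBound_le hL hG (hpert M hM K hK).1 hη hδ.le hstep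
          (hest K (hpert M hM K hK).1 (hpert M hM K hK).2) hηφ hδ2 hr2 hV
        rcases hc with ⟨rfl, rfl⟩ | ⟨rfl, rfl⟩
        · rw [one_mul]
          exact h.1
        · exact h.2)
  rw [Succeeds, hN]
  have hc₂ : 0 ≤ u * ε / 96 := by positivity
  have hc₂' : u * ε / 96 / ε ≤ 1 / 192 := by
    rw [div_le_iff₀ hε]
    nlinarith
  have hNc : N * (u * ε / 96) ≤ ε * Real.log y / 24 := by
    have := mul_le_mul_of_nonneg_right hNlt hε.le
    linarith
  rcases le_or_gt y 19 with hy2 | hy2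
  · obtain ⟨M, hΔM, hMε, hMs, hbd⟩ := exists_stopping_level hgap hε
      ((one_lt_div hε).1 hy1) ((div_le_iff₀ hε).1 hy2) hlog
    obtain ⟨p, e, hp0, he0, hpe, hre, hfin⟩ := hrec M 1 _ hΔM hMs zero_le_one hc₂
      (Or.inl ⟨rfl, rfl⟩)
    have hM0 : 0 < M := hgap.trans_le hΔM
    refine le_trans ?_ (hfin N)
    refine le_trans ?_ (le_of_stopped_recursion hp0 hpe hre hc₂ hM0 hMε N)
    rw [he0]
    have h1 : (Δ + N * (u * ε / 96)) / M ≤ (Δ + ε * Real.log y / 24) / M := by gcongr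
    linarith
  · have hc₂3 : 0 ≤ 5 * (u * ε) / 384 := by positivity
    have hw3 : ε / 240 ≤ 1 / 38 * Δ := by
      have := (lt_div_iff₀ hε).1 hy2
      linarith
    obtain ⟨p, e, hp0, he0, hpe, hre, hfin⟩ := hrec (9 * Δ) (1 - u / 4) _ (by linarith)
      (sq_sqrt_add_sqrt_lt (α := 9) (β := 1 / 38) hgap (by norm_num) (by norm_num) le_rfl
        hw3 (by norm_num) (by norm_num)) (by linarith) hc₂3 (Or.inr ⟨rfl, rfl⟩)
    refine le_trans ?_ (hfin N)
    refine le_trans ?_ (le_of_stopped_recursion_contraction hp0 hpe (h := u / 4) (by positivity)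
      (by linarith) hre hc₂3 (by positivity) hε N)
    rw [he0]
    have h1 : (Δ + N * (5 * (u * ε) / 384)) / (9 * Δ) ≤ 13 / 72 := by
      have h6 := mul_le_mul_of_nonneg_right hNlt hε.le
      rw [div_le_iff₀ (by positivity)]
      linarith
    have h2 : (1 - u / 4) ^ (N + 1) ≤ 1 / y := by
      have h3 : (1 - u / 4) ^ (N + 1) ≤ Real.exp (-(u / 4)) ^ (N + 1) := by
        gcongr
        · linarith
        · exact Real.one_sub_le_exp_neg _
      refine h3.trans ?_
      rw [← Real.exp_nat_mul, one_div, ← Real.exp_log hy0, ← Real.exp_neg]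
      refine Real.exp_le_exp.2 ?_
      linarith
    have h4 : ((1 - u / 4) ^ (N + 1) * Δ + 5 * (u * ε) / 384 / (u / 4)) / ε ≤ 29 / 480 := by
      have h5 : 5 * (u * ε) / 384 / (u / 4) = 5 * ε / 96 := by
        field_simp
        ring
      have h6 : (1 - u / 4) ^ (N + 1) * Δ ≤ ε / 120 := by
        refine (mul_le_mul_of_nonneg_right h2 hgap.le).trans (le_of_eq ?_)
        rw [hy]
        field_simp
      rw [h5, div_le_iff₀ hε]
      linarith
    linarith

end LQR

/-! ### The convergence theorem -/

theorem theorem1 {n m : ℕ} (L : LQR n m) (Cm : ℝ) (hL : L.Standing Cm)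
    (K₀ : Gain m n) (hK₀ : K₀ ∈ L.stab) :
    (∃ mu lam0 lamT0 phi0 rho0 : ℝ,
      L.RegularityConstants K₀ mu lam0 lamT0 phi0 rho0 ∧ 0 < rho0) ∧
    ∀ mu lam0 lamT0 phi0 rho0 : ℝ, L.RegularityConstants K₀ mu lam0 lamT0 phi0 rho0 →
      ∀ (Ω : Type*) [MeasurableSpace Ω] (P : Measure Ω) [IsProbabilityMeasure P]
        (x : ℕ → Ω → Fin n → ℝ) (D E : ℕ → Ω → Gain m n) (η r δ ε θ₀ d : ℝ) (T : ℕ),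
        0 < η → 0 < r → 0 < δ → 0 < ε →
        L.Sampling P δ x D E →
        θ₀ = min (1 / (2 * phi0)) (rho0 / lam0) →
        d = (m : ℝ) * (n : ℝ) →
        T = ⌈4 / (η * mu) * Real.log (120 * L.gap K₀ / ε)⌉₊ →
        ε * Real.log (120 * L.gap K₀ / ε) < 12 * L.gap K₀ →
        δ ≤ min (mu * θ₀ / 16 * √(ε / 15)) (1 / 2 * √(mu * ε / 30)) →
        r ≤ min (min (mu * θ₀ / (16 * phi0) * √(ε / 15)) (1 / (4 * phi0) * √(mu * ε / 15)))
          rho0 →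
        ((r ≤ 10 * L.J K₀ / lam0 →
          η ≤ min (min (mu * r ^ 2 * ε / (480 * phi0 * (20 * Cm * L.J K₀ * d) ^ 2))
            (1 / (4 * phi0))) (rho0 * r / (20 * Cm * L.J K₀ * d + δ * r)) →
          L.Succeeds P (L.onePoint r) η K₀ x D E T ε) ∧
        (η ≤ min (min (mu * ε / (480 * phi0 * d * lamT0 ^ 2))
            (1 / (4 * phi0))) (rho0 / (d * lamT0 + δ)) →
          L.Succeeds P (L.twoPoint r) η K₀ x D E T ε)) := by
  refine ⟨hL.exists_regularityConstants hK₀, fun mu lam0 lamT0 phi0 rho0 hR Ω _ P _ x D E η r δ ε θ₀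
    d T hη hr hδ hε hS _ hd hT hlog hδle hrle => ?_⟩
  have hK₀S := hL.mem_sublevel_self hK₀
  have hφ := hR.phi_pos hK₀S
  have hμ := hR.1.1
  have hrho : r ≤ rho0 := hrle.trans (min_le_right _ _)
  -- for an optimal `K₀` the hypothesis on `ε` would read `0 < 0`, as `log 0 = 0`
  have hgap : 0 < L.gap K₀ := by
    refine (hL.gap_nonneg hK₀).lt_of_ne fun h => ?_
    rw [← h] at hlog
    simp at hlog
  have hδ2 : δ ^ 2 ≤ mu * ε / 120 := by
    have h1 := pow_le_pow_left₀ hδ.le (hδle.trans (min_le_right _ _)) 2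
    rw [mul_pow, Real.sq_sqrt (by positivity)] at h1
    linarith
  have hr2 : (phi0 * r) ^ 2 ≤ mu * ε / 240 := by
    have h1 : r ≤ 1 / (4 * phi0) * √(mu * ε / 15) :=
      (hrle.trans (min_le_left _ _)).trans (min_le_right _ _)
    have h2 := pow_le_pow_left₀ (by positivity) (mul_le_mul_of_nonneg_left h1 hφ.le) 2
    refine h2.trans (le_of_eq ?_)
    rw [← mul_assoc, mul_pow, Real.sq_sqrt (by positivity)]
    field_simp
    norm_num
  have hnt : Nontrivial (Gain m n) := by
    refine ⟨K₀, L.Kstar, fun h => hgap.ne' ?_⟩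
    rw [LQR.gap, h, sub_self]
  have hdpos : 0 < d := by
    have h1 : 0 < m * n := by
      rw [← LQR.finrank_gain]
      exact Module.finrank_pos
    rw [hd]
    exact_mod_cast h1
  have hstar : 0 ≤ L.J L.Kstar := ENNReal.toReal_nonneg
  have hJ₀ : L.J K₀ = L.gap K₀ + L.J L.Kstar := by
    rw [LQR.gap]
    ring
  have hηφ : η ≤ 1 / (4 * phi0) → phi0 * η ≤ 1 / 4 := fun h => by
    rw [le_div_iff₀ (by positivity)] at h
    linarith
  have hpert : ∀ K ∈ L.sublevel K₀, ∀ D : Gain m n, ‖D‖ ≤ r →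
      K + D ∈ L.stab ∧ ‖gradient L.J (K + D) - gradient L.J K‖ ≤ phi0 * ‖D‖ := fun K hK D hD => by
    have := hR.smooth hK (K' := K + D) (by rw [add_sub_cancel_left]; exact hD.trans hrho)
    rwa [add_sub_cancel_left] at this
  refine ⟨fun _ hηle => ?_, fun hηle => ?_⟩
  · set b := 20 * Cm * L.J K₀ * d with hb
    have hCm := hL.Cm_pos
    have hJpos : 0 < L.J K₀ := by linarith
    have hb0 : 0 < b := by positivity
    have hη1 : η ≤ mu * r ^ 2 * ε / (480 * phi0 * b ^ 2) :=
      (hηle.trans (min_le_left _ _)).trans (min_le_left _ _)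
    have hη2 : η ≤ rho0 * r / (b + δ * r) := hηle.trans (min_le_right _ _)
    refine LQR.succeeds_of_isEstimator (B := b / r) (V := (b / r) ^ 2) hL hK₀ hR hη hr hδ hε hS hgap
      hT hlog hδ2 hr2 hrho (hηφ ((hηle.trans (min_le_left _ _)).trans (min_le_right _ _))) ?_ ?_
      (L.measurable_onePoint r) fun K hK hpertK => ?_
    · rw [le_div_iff₀ (by positivity)] at hη2
      have h1 : η * (b / r + δ) = η * (b + δ * r) / r := by field_simp
      rw [h1, div_le_iff₀ hr]
      exact hη2
    · rw [le_div_iff₀ (by positivity)] at hη1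
      have h1 : phi0 * η * (b / r) ^ 2 = η * (480 * phi0 * b ^ 2) / r ^ 2 / 480 := by
        field_simp
      have h2 : η * (480 * phi0 * b ^ 2) / r ^ 2 ≤ mu * ε := by
        rw [div_le_iff₀ (by positivity)]
        linarith
      have h3 : 0 < mu * ε := by positivity
      linarith
    · -- `J(K + D) ≤ 10 Δ₀ + J(K⋆) ≤ 20 J(K₀)`
      have h1 := LQR.isEstimator_onePoint hL (K := K) (C := 20 * L.J K₀) hr hφ.le fun D hD => by
        refine ⟨(hpert K hK D hD).1, (hpert K hK D hD).2, ?_⟩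
        have h2 := hpertK D hD
        have h3 : L.J (K + D) = L.gap (K + D) + L.J L.Kstar := by
          rw [LQR.gap]
          ring
        linarith
      have h2 : Cm * (20 * L.J K₀) * (m * n) = b := by
        rw [hb, hd]
        ring
      rwa [h2] at h1
  · have hlam := hR.lamT_pos hK₀S
    have hη1 : η ≤ mu * ε / (480 * phi0 * d * lamT0 ^ 2) :=
      (hηle.trans (min_le_left _ _)).trans (min_le_left _ _)
    have hη2 : η ≤ rho0 / (d * lamT0 + δ) := hηle.trans (min_le_right _ _)
    refine LQR.succeeds_of_isEstimator (B := d * lamT0) (V := 2 * d * lamT0 ^ 2) hL hK₀ hR hη hr hδ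
      hε hS hgap hT hlog hδ2 hr2 hrho
      (hηφ ((hηle.trans (min_le_left _ _)).trans (min_le_right _ _))) ?_ ?_
      (L.measurable_twoPoint r) fun K hK hpertK => ?_
    · rwa [le_div_iff₀ (by positivity)] at hη2
    · rw [le_div_iff₀ (by positivity)] at hη1
      linarith
    · have h1 := LQR.isEstimator_twoPoint hL hR hK hr hrho hpertK
      rwa [← hd] at h1
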